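/- **Conventions.** All C*-algebras and \*-homomorphisms are unital, and $\otimes$ is the minimal (spatial) tensor product. A *compact quantum group* (CQG) is a pair $(Q,\Delta)$ of a C*-algebra $Q$ and a \*-homomorphism $\Delta:Q\to Q\otimes Q$ with $(\Delta\otimes\mathrm{id})\Delta=(\mathrm{id}\otimes\Delta)\Delta$ such that the linear spans of $\Delta(Q)(1\otimes Q)$ and of $\Delta(Q)(Q\otimes 1)$ are dense in $Q\otimes Q$. A CQG morphism $\phi:(Q_1,\Delta_1)\to(Q_2,\Delta_2)$ is a \*-homomorphism with $(\phi\otimes\phi)\Delta_1=\Delta_2\phi$; it is an isomorphism if it is bijective. A *quantum transformation group* of a C*-algebra $\mathcal C$ is a CQG $(Q,\Delta)$ with a faithful action on $\mathcal C$, that is, a \*-homomorphism $\alpha:\mathcal C\to\mathcal C\otimes Q$ such that $(\alpha\otimes\mathrm{id})\alpha=(\mathrm{id}\otimes\Delta)\alpha$, the linear span of $\alpha(\mathcal C)(1\otimes Q)$ is dense in $\mathcal C\otimes Q$, and the \*-algebra generated by $\{(\theta\otimes\mathrm{id})\alpha(c):\theta\in\mathcal C^*,\,c\in\mathcal C\}$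 is dense in $Q$. **Graphs.** Let $\Gamma$ be a finite directed graph with vertex set $V$, edge set $E$, and source and range maps $s,r:E\to V$. It is *connected* if every vertex is the source or the range of some edge. A *path of length $m$* is a sequence of edges $e_1\cdots e_m$ with $r(e_i)=s(e_{i+1})$ (a path of length $0$ is a single vertex). It is a *cycle* if $m\ge1$, $r(e_m)=s(e_1)$ and the vertices $s(e_1),\dots,s(e_m)$ are pairwise distinct. $\Gamma$ has *property (R)* if - (R1) $\Gamma$ has no cycle of length $\ge 2$; - (R2) there is a path of length $|V|-1$ that passes through all vertices (so $V\neq\emptyset$); - (R3) for any two, possibly equal, vertices $v,w$ there is at most one edge from $v$ to $w$. **The graph C\*-algebra and the category.** $C^*(\Gamma)$ is the universal C*-algebra generated by partial isometries $S_e$ ($e\in E$) and mutually orthogonal projections $p_v$ ($v\in V$) with $S_e^*S_e=p_{r(e)}$ for all $e$ and $p_v=\sum_{s(f)=v}S_fS_f^*$ for every $v$ that is the source of at least one edge; its unit is $\sum_v p_v$. Let $$\mathcal V_{2,+}=\operatorname{span}\bigl(\{p_u: u\in V\text{ is not the source of any edge}\}\cup\{S_eS_f^*: e,f\in E,\ r(e)=r(f)\}\bigr)\subseteq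 C^*(\Gamma).$$ The displayed spanning set is linearly independent, and $\tau$ denotes the linear functional on $\mathcal V_{2,+}$ with $\tau(p_u)=1$ and $\tau(S_eS_f^*)=\delta_{ef}$. The objects of the category $\mathfrak C_\tau^{Lin}$ are the quantum transformation groups $((Q,\Delta),\alpha)$ of $C^*(\Gamma)$ that are *linear*, i.e. there are $q_{fe}\in Q$ with $\alpha(S_e)=\sum_{f\in E}S_f\otimes q_{fe}$ for all $e\in E$, and *preserve $\tau$*, i.e. $(\tau\otimes\mathrm{id})\alpha(x)=\tau(x)1$ for all $x\in\mathcal V_{2,+}$ (here $\alpha(\mathcal V_{2,+})$ lies in the algebraic tensor product of $\mathcal V_{2,+}$ and $Q$). A *universal object* of $\mathfrak C_\tau^{Lin}$ is an object $((\widehat Q,\widehat\Delta),\widehat\alpha)$ such that for every object $((B,\Delta_B),\beta)$ there is a surjective CQG morphism $\phi:\widehat Q\to B$ with $(\mathrm{id}\otimes\phi)\widehat\alpha=\beta$; its underlying CQG is denoted by $Q_\tau^{Lin}$. **Theorem.** Let $\Gamma$ be a finite, connected, directed graph with property (R). Then $\mathfrak C_\tau^{Lin}$ has a universal object, and the underlying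 CQG $Q_\tau^{Lin}$ of any universal object is isomorphic, as a compact quantum group, to $$\bigl(\underbrace{C(S^1)*\cdots*C(S^1)}_{|E|\text{ times}},\ \Delta_*\bigr),$$ the free product of $|E|$ copies of $C(S^1)$, that is, the universal C*-algebra generated by unitaries $z_e$ ($e\in E$), with $\Delta_*(z_e)=z_e\otimes z_e$. -/

import Mathlib

universe u

noncomputable section

open scoped TensorProduct
open UniformSpace (Completion)

/-! ### Completing a complex `*`-algebra in a C*-seminorm -/

/-- A C*-seminorm on a unital complex `*`-algebra. -/
structure CStarSeminorm (F : Type*) [Ring F] [Algebra ℂ F] [StarRing F] where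
  toSeminorm : Seminorm ℂ F
  mul_le : ∀ x y, toSeminorm (x * y) ≤ toSeminorm x * toSeminorm y
  star_mul_self : ∀ x, toSeminorm (star x * x) = toSeminorm x ^ 2

namespace CStarSeminorm

section Basic

variable {F : Type*} [Ring F] [Algebra ℂ F] [StarRing F]

instance : CoeFun (CStarSeminorm F) (fun _ => F → ℝ) := ⟨fun p => p.toSeminorm⟩

theorem apply_star (p : CStarSeminorm F) (x : F) : p (star x) = p x := by
  have key : ∀ y, p y ≤ p (star y) := by
    intro y
    have h1 := p.star_mul_self y
    have h2 := p.mul_le (star y) y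
    have h3 : 0 ≤ p y := apply_nonneg _ _
    have h4 : 0 ≤ p (star y) := apply_nonneg _ _
    rcases h3.eq_or_lt with h | h
    · rw [← h]; exact h4
    · have : p y * p y ≤ p (star y) * p y := by nlinarith
      exact le_of_mul_le_mul_right this h
  apply le_antisymm
  · simpa using key (star x)
  · exact key x

theorem apply_one_le (p : CStarSeminorm F) : p 1 ≤ 1 := by
  have h1 := p.star_mul_self 1
  simp only [star_one, mul_one] at h1
  have h3 : 0 ≤ p 1 := apply_nonneg _ _
  nlinarith

/-- The C*-seminorm `x ↦ ‖φ x‖` of a `*`-homomorphism into a C*-algebra. -/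
noncomputable def ofHom {D : Type*} [CStarAlgebra D] (φ : F →⋆ₐ[ℂ] D) : CStarSeminorm F where
  toSeminorm := (normSeminorm ℂ D).comp φ.toAlgHom.toLinearMap
  mul_le x y := by simpa using norm_mul_le (φ x) (φ y)
  star_mul_self x := by
    change ‖φ (star x * x)‖ = ‖φ x‖ ^ 2
    rw [map_mul, map_star, CStarRing.norm_star_mul_self, sq]

@[simp] theorem ofHom_apply {D : Type*} [CStarAlgebra D] (φ : F →⋆ₐ[ℂ] D) (x : F) :
    ofHom φ x = ‖φ x‖ := rfl

/-- The supremum of a pointwise bounded set of C*-seminorms is a C*-seminorm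
(it is `0` for the empty set). -/
noncomputable def sup (S : Set (CStarSeminorm F))
    (hS : ∀ x, BddAbove (Set.range fun p : S => p.1 x)) : CStarSeminorm F where
  toSeminorm :=
    { toFun := fun x => ⨆ p : S, p.1 x
      map_zero' := by simp
      add_le' := fun x y => by
        refine Real.iSup_le (fun p => ?_) (add_nonneg
          (Real.iSup_nonneg fun p => apply_nonneg _ _) (Real.iSup_nonneg fun p => apply_nonneg _ _))
        exact (map_add_le_add _ _ _).trans (add_le_add (le_ciSup (hS x) p) (le_ciSup (hS y) p))
      neg' := fun x => by simp
      smul' := fun a x => by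
        simp only [map_smul_eq_mul]
        rw [Real.mul_iSup_of_nonneg (norm_nonneg _)] }
  mul_le x y := by
    refine Real.iSup_le (fun p => ?_) (mul_nonneg
      (Real.iSup_nonneg fun p => apply_nonneg _ _) (Real.iSup_nonneg fun p => apply_nonneg _ _))
    exact (p.1.mul_le x y).trans (mul_le_mul (le_ciSup (hS x) p) (le_ciSup (hS y) p)
      (apply_nonneg _ _) (Real.iSup_nonneg fun p => apply_nonneg _ _))
  star_mul_self x := by
    have h0 : 0 ≤ ⨆ p : S, p.1 x := Real.iSup_nonneg fun p => apply_nonneg _ _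
    apply le_antisymm
    · refine Real.iSup_le (fun p => ?_) (by positivity)
      rw [p.1.star_mul_self]
      exact pow_le_pow_left₀ (apply_nonneg _ _) (le_ciSup (hS x) p) 2
    · have h1 : 0 ≤ ⨆ p : S, p.1 (star x * x) := Real.iSup_nonneg fun p => apply_nonneg _ _
      change (⨆ p : S, p.1 x) ^ 2 ≤ ⨆ p : S, p.1 (star x * x)
      rw [← Real.sqrt_le_sqrt_iff h1, Real.sqrt_sq h0]
      refine Real.iSup_le (fun p => ?_) (Real.sqrt_nonneg _)
      apply Real.le_sqrt_of_sq_le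
      rw [← p.1.star_mul_self]
      exact le_ciSup (hS (star x * x)) p

theorem le_sup {S : Set (CStarSeminorm F)}
    (hS : ∀ x, BddAbove (Set.range fun p : S => p.1 x)) {p : CStarSeminorm F} (hp : p ∈ S) (x : F) :
    p x ≤ sup S hS x :=
  le_ciSup (hS x) ⟨p, hp⟩

theorem sup_le {S : Set (CStarSeminorm F)}
    (hS : ∀ x, BddAbove (Set.range fun p : S => p.1 x)) {x : F} {a : ℝ} (ha : 0 ≤ a)
    (h : ∀ p ∈ S, p x ≤ a) : sup S hS x ≤ a :=
  Real.iSup_le (fun p => h p.1 p.2) ha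

end Basic

section Completion

variable {F : Type*} [Ring F] [Algebra ℂ F] [StarRing F] [StarModule ℂ F]

/-- A copy of `F`, topologized by the C*-seminorm `p`. -/
def Pre (_p : CStarSeminorm F) : Type _ := F

variable (p : CStarSeminorm F)

instance : Ring p.Pre := inferInstanceAs (Ring F)
instance : Algebra ℂ p.Pre := inferInstanceAs (Algebra ℂ F)
instance : StarRing p.Pre := inferInstanceAs (StarRing F)
instance : StarModule ℂ p.Pre := inferInstanceAs (StarModule ℂ F)

/-- The identity of `F`, as a map into its copy. -/
def toPre : F →⋆ₐ[ℂ] p.Pre := StarAlgHom.id ℂ F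

noncomputable instance : SeminormedRing p.Pre :=
  { (inferInstance : Ring p.Pre),
    (p.toSeminorm.toAddGroupSeminorm.toSeminormedAddCommGroup : SeminormedAddCommGroup F) with
    norm_mul_le := fun x y => p.mul_le x y }

noncomputable instance : NormedAlgebra ℂ p.Pre :=
  { (inferInstance : Algebra ℂ p.Pre) with
    norm_smul_le := fun a x => (map_smul_eq_mul p.toSeminorm a x).le }

theorem norm_toPre (x : F) : ‖p.toPre x‖ = p x := rfl

theorem norm_star_pre (x : p.Pre) : ‖star x‖ = ‖x‖ := p.apply_star x

theorem norm_star_mul_self_pre (x : p.Pre) : ‖star x * x‖ = ‖x‖ ^ 2 := p.star_mul_self x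

/-- The C*-algebra obtained from `F` by dividing out the null space of `p` and completing. -/
def CStarCompletion : Type _ := Completion p.Pre

noncomputable instance : NormedRing p.CStarCompletion :=
  inferInstanceAs (NormedRing (Completion p.Pre))

noncomputable instance : CompleteSpace p.CStarCompletion :=
  inferInstanceAs (CompleteSpace (Completion p.Pre))

noncomputable instance : NormedAlgebra ℂ p.CStarCompletion :=
  { (inferInstance : Algebra ℂ (Completion p.Pre)) with
    norm_smul_le := fun a x => norm_smul_le (β := Completion p.Pre) a x }

/-- The dense copy of `p.Pre` in its completion. -/
noncomputable def coeC (x : p.Pre) : p.CStarCompletion := (x : Completion p.Pre)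

theorem coeC_mul (x y : p.Pre) : p.coeC (x * y) = p.coeC x * p.coeC y :=
  Completion.coe_mul x y
theorem coeC_add (x y : p.Pre) : p.coeC (x + y) = p.coeC x + p.coeC y :=
  Completion.coe_add x y
theorem coeC_smul (a : ℂ) (x : p.Pre) : p.coeC (a • x) = a • p.coeC x :=
  Completion.coe_smul a x
theorem norm_coeC (x : p.Pre) : ‖p.coeC x‖ = ‖x‖ := Completion.norm_coe x
theorem continuous_coeC : Continuous p.coeC := Completion.continuous_coe _
theorem denseRange_coeC : DenseRange p.coeC := Completion.denseRange_coe

theorem uniformContinuous_star_pre : UniformContinuous (star : p.Pre → p.Pre) := by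
  refine (AddMonoidHomClass.isometry_of_norm (starAddEquiv (R := p.Pre)) ?_).uniformContinuous
  exact p.norm_star_pre

noncomputable instance : Star p.CStarCompletion :=
  ⟨(Completion.map (star : p.Pre → p.Pre) : Completion p.Pre → Completion p.Pre)⟩

theorem star_coeC (x : p.Pre) : star (p.coeC x) = p.coeC (star x) :=
  Completion.map_coe p.uniformContinuous_star_pre x

theorem continuous_star_completion :
    Continuous (star : p.CStarCompletion → p.CStarCompletion) :=
  Completion.continuous_map

noncomputable instance : StarRing p.CStarCompletion where
  star_involutive x := by
    have hc := p.continuous_star_completion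
    refine p.denseRange_coeC.induction_on x
      (isClosed_eq (hc.comp hc) continuous_id) (fun a => ?_)
    simp [star_coeC]
  star_mul x y := by
    have hc := p.continuous_star_completion
    refine p.denseRange_coeC.induction_on₂
      (isClosed_eq (hc.comp (continuous_fst.mul continuous_snd))
        ((hc.comp continuous_snd).mul (hc.comp continuous_fst))) (fun a b => ?_) x y
    simp only [← coeC_mul, star_coeC, star_mul]
  star_add x y := by
    have hc := p.continuous_star_completion
    refine p.denseRange_coeC.induction_on₂
      (isClosed_eq (hc.comp (continuous_fst.add continuous_snd))
        ((hc.comp continuous_fst).add (hc.comp continuous_snd))) (fun a b => ?_) x y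
    simp only [← coeC_add, star_coeC, star_add]

instance : StarModule ℂ p.CStarCompletion where
  star_smul a x := by
    have hc := p.continuous_star_completion
    refine p.denseRange_coeC.induction_on x
      (isClosed_eq (hc.comp (continuous_const_smul a)) ((continuous_const_smul (star a)).comp hc)) (fun b => ?_)
    simp only [← coeC_smul, star_coeC, star_smul]

instance : CStarRing p.CStarCompletion where
  norm_mul_self_le x := by
    have hc := p.continuous_star_completion
    refine p.denseRange_coeC.induction_on x
      (isClosed_le (by fun_prop) ((hc.mul continuous_id).norm)) (fun b => ?_)
    simp only [star_coeC, ← coeC_mul, norm_coeC, norm_star_mul_self_pre]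
    exact (sq _).ge

noncomputable instance : CStarAlgebra p.CStarCompletion where

/-- The canonical `*`-homomorphism with dense range from `F` to its C*-completion. -/
noncomputable def toCompletion : F →⋆ₐ[ℂ] p.CStarCompletion where
  toFun x := p.coeC (p.toPre x)
  map_one' := rfl
  map_mul' x y := p.coeC_mul x y
  map_zero' := rfl
  map_add' x y := p.coeC_add x y
  commutes' _ := rfl
  map_star' x := (p.star_coeC x).symm

theorem norm_toCompletion (x : F) : ‖p.toCompletion x‖ = p x := p.norm_coeC x

theorem denseRange_toCompletion : DenseRange p.toCompletion := p.denseRange_coeC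

section Lift

variable {D : Type*} [CStarAlgebra D] (φ : F →⋆ₐ[ℂ] D) (h : ∀ x, ‖φ x‖ ≤ p x)

/-- A `*`-homomorphism dominated by `p`, as a continuous linear map. -/
noncomputable def preCLM : p.Pre →L[ℂ] D :=
  LinearMap.mkContinuous (φ.toAlgHom.toLinearMap : p.Pre →ₗ[ℂ] D) 1
    (fun x => by rw [one_mul]; exact h x)

/-- A `*`-homomorphism into a C*-algebra dominated by `p` extends to the completion. -/
noncomputable def lift : p.CStarCompletion →⋆ₐ[ℂ] D :=
  have hcoe : ∀ x : p.Pre, (p.preCLM φ h).fromCompletion (p.coeC x) = φ x :=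
    fun x => ContinuousLinearMap.fromCompletion_apply_coe _ x
  have hc : Continuous fun x : p.CStarCompletion => (p.preCLM φ h).fromCompletion x :=
    (p.preCLM φ h).fromCompletion.continuous
  have hone : (p.preCLM φ h).fromCompletion (1 : p.CStarCompletion) = 1 :=
    (hcoe 1).trans (map_one φ)
  { toFun := fun x => (p.preCLM φ h).fromCompletion x
    map_one' := hone
    map_mul' := fun x y => by
      refine p.denseRange_coeC.induction_on₂
        (isClosed_eq (hc.comp (continuous_fst.mul continuous_snd))
          ((hc.comp continuous_fst).mul (hc.comp continuous_snd))) (fun a b => ?_) x y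
      rw [← coeC_mul, hcoe, hcoe, hcoe]
      exact map_mul φ _ _
    map_zero' := map_zero (p.preCLM φ h).fromCompletion
    map_add' := fun x y => map_add (p.preCLM φ h).fromCompletion x y
    commutes' := fun r => by
      rw [Algebra.algebraMap_eq_smul_one, Algebra.algebraMap_eq_smul_one, ← hone]
      exact map_smul (p.preCLM φ h).fromCompletion r _
    map_star' := fun x => by
      refine p.denseRange_coeC.induction_on x
        (isClosed_eq (hc.comp p.continuous_star_completion) hc.star) (fun a => ?_)
      rw [star_coeC, hcoe, hcoe]
      exact map_star φ _ }

@[simp] theorem lift_toCompletion (x : F) : p.lift φ h (p.toCompletion x) = φ x :=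
  ContinuousLinearMap.fromCompletion_apply_coe (p.preCLM φ h) x

end Lift

end Completion

end CStarSeminorm

/-! ### Universal C*-algebras given by generators and relations -/

/-- The free unital complex `*`-algebra on `X`: noncommutative polynomials in the letters
`x = inl x` and `x* = inr x`. -/
def FreeStarAlgebra (X : Type u) : Type u := FreeAlgebra ℂ (X ⊕ X)

namespace FreeStarAlgebra

variable {X : Type u}

instance : Ring (FreeStarAlgebra X) := inferInstanceAs (Ring (FreeAlgebra ℂ (X ⊕ X)))
instance : Algebra ℂ (FreeStarAlgebra X) := inferInstanceAs (Algebra ℂ (FreeAlgebra ℂ (X ⊕ X)))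

/-- A letter, as an element of the free `*`-algebra. -/
def letter (y : X ⊕ X) : FreeStarAlgebra X := FreeAlgebra.ι ℂ y

/-- A generator of the free `*`-algebra. -/
def gen (x : X) : FreeStarAlgebra X := letter (Sum.inl x)

/-- The algebra homomorphism sending the letters to prescribed elements. -/
def liftLetters {B : Type*} [Ring B] [Algebra ℂ B] (f : X ⊕ X → B) : FreeStarAlgebra X →ₐ[ℂ] B :=
  FreeAlgebra.lift ℂ f

@[simp] theorem liftLetters_letter {B : Type*} [Ring B] [Algebra ℂ B] (f : X ⊕ X → B) (y : X ⊕ X) :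
    liftLetters f (letter y) = f y :=
  FreeAlgebra.lift_ι_apply f y

@[elab_as_elim]
theorem induction_letters {motive : FreeStarAlgebra X → Prop}
    (scalar : ∀ r : ℂ, motive (algebraMap ℂ (FreeStarAlgebra X) r))
    (letters : ∀ y, motive (letter y))
    (mul : ∀ a b, motive a → motive b → motive (a * b))
    (add : ∀ a b, motive a → motive b → motive (a + b)) (a : FreeStarAlgebra X) : motive a :=
  FreeAlgebra.induction (R := ℂ) (X := X ⊕ X) (motive := motive) scalar letters mul add a

/-- The conjugate-linear antimultiplicative map exchanging `x` and `x*`. -/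
def starHom : FreeStarAlgebra X →+* (FreeStarAlgebra X)ᵐᵒᵖ :=
  letI : Algebra ℂ (FreeStarAlgebra X)ᵐᵒᵖ := Algebra.compHom _ (starRingEnd ℂ)
  (liftLetters fun y => MulOpposite.op (letter y.swap)).toRingHom

theorem starHom_letter (y : X ⊕ X) : starHom (letter y) = MulOpposite.op (letter y.swap) :=
  letI : Algebra ℂ (FreeStarAlgebra X)ᵐᵒᵖ := Algebra.compHom _ (starRingEnd ℂ)
  liftLetters_letter (fun y => MulOpposite.op (letter y.swap)) y

theorem starHom_algebraMap (r : ℂ) :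
    starHom (algebraMap ℂ (FreeStarAlgebra X) r) =
      MulOpposite.op (algebraMap ℂ (FreeStarAlgebra X) (star r)) :=
  letI : Algebra ℂ (FreeStarAlgebra X)ᵐᵒᵖ := Algebra.compHom _ (starRingEnd ℂ)
  (liftLetters fun y : X ⊕ X => MulOpposite.op (letter y.swap)).commutes r

instance : Star (FreeStarAlgebra X) := ⟨fun a => (starHom a).unop⟩

theorem star_letter (y : X ⊕ X) : star (letter y) = letter y.swap :=
  congrArg MulOpposite.unop (starHom_letter y)

theorem star_scalar (r : ℂ) :
    star (algebraMap ℂ (FreeStarAlgebra X) r) = algebraMap ℂ (FreeStarAlgebra X) (star r) :=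
  congrArg MulOpposite.unop (starHom_algebraMap r)

instance : StarRing (FreeStarAlgebra X) where
  star_mul a b := congrArg MulOpposite.unop (map_mul starHom a b)
  star_add a b := congrArg MulOpposite.unop (map_add starHom a b)
  star_involutive a := by
    have hm : ∀ a b : FreeStarAlgebra X, star (a * b) = star b * star a :=
      fun a b => congrArg MulOpposite.unop (map_mul starHom a b)
    have ha : ∀ a b : FreeStarAlgebra X, star (a + b) = star a + star b :=
      fun a b => congrArg MulOpposite.unop (map_add starHom a b)
    refine induction_letters (fun r => ?_) (fun y => ?_) (fun a b h1 h2 => ?_)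
      (fun a b h1 h2 => ?_) a
    · rw [star_scalar, star_scalar, star_star]
    · rw [star_letter, star_letter, Sum.swap_swap]
    · rw [hm, hm, h1, h2]
    · rw [ha, ha, h1, h2]

instance : StarModule ℂ (FreeStarAlgebra X) where
  star_smul r a := by
    rw [Algebra.smul_def, star_mul, star_scalar, Algebra.smul_def, Algebra.commutes]

/-- The `*`-homomorphism sending the generators to prescribed elements. -/
def lift {B : Type*} [Ring B] [Algebra ℂ B] [StarRing B] [StarModule ℂ B] (f : X → B) :
    FreeStarAlgebra X →⋆ₐ[ℂ] B :=
  { liftLetters (Sum.elim f fun x => star (f x)) with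
    map_star' := fun a => by
      change liftLetters (Sum.elim f fun x => star (f x)) (star a) =
        star (liftLetters (Sum.elim f fun x => star (f x)) a)
      refine induction_letters (fun r => ?_) (fun y => ?_) (fun a b h1 h2 => ?_)
        (fun a b h1 h2 => ?_) a
      · rw [star_scalar, AlgHom.commutes, AlgHom.commutes, algebraMap_star_comm]
      · rw [star_letter]
        cases y <;> simp
      · rw [star_mul, map_mul, h1, h2, map_mul, star_mul]
      · rw [star_add, map_add, h1, h2, map_add, star_add] }

@[simp] theorem lift_gen {B : Type*} [Ring B] [Algebra ℂ B] [StarRing B] [StarModule ℂ B]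
    (f : X → B) (x : X) : lift f (gen x) = f x :=
  liftLetters_letter _ (Sum.inl x)

end FreeStarAlgebra

/-- The C*-seminorms on the free `*`-algebra which are at most `1` on the generators and
vanish on the relators. -/
def admissibleSeminorms {X : Type u} (R : Set (FreeStarAlgebra X)) :
    Set (CStarSeminorm (FreeStarAlgebra X)) :=
  {p | (∀ x, p (FreeStarAlgebra.gen x) ≤ 1) ∧ ∀ r ∈ R, p r = 0}

theorem admissibleSeminorms_bddAbove {X : Type u} (R : Set (FreeStarAlgebra X))
    (a : FreeStarAlgebra X) :
    BddAbove (Set.range fun p : admissibleSeminorms R => p.1 a) := by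
  suffices h : ∃ C, ∀ p ∈ admissibleSeminorms R, p a ≤ C by
    obtain ⟨C, hC⟩ := h
    exact ⟨C, by rintro _ ⟨p, rfl⟩; exact hC p.1 p.2⟩
  refine FreeStarAlgebra.induction_letters (fun r => ?_) (fun y => ?_) ?_ ?_ a
  · refine ⟨‖r‖, fun p _ => ?_⟩
    rw [Algebra.algebraMap_eq_smul_one, map_smul_eq_mul]
    exact mul_le_of_le_one_right (norm_nonneg _) p.apply_one_le
  · refine ⟨1, fun p hp => ?_⟩
    cases y with
    | inl x => exact hp.1 x
    | inr x =>
      have h := p.apply_star (FreeStarAlgebra.gen x)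
      rw [FreeStarAlgebra.gen, FreeStarAlgebra.star_letter] at h
      exact h.trans_le (hp.1 x)
  · rintro a b ⟨C, hC⟩ ⟨D, hD⟩
    exact ⟨C * D, fun p hp => (p.mul_le a b).trans (mul_le_mul (hC p hp) (hD p hp)
      (apply_nonneg _ _) ((apply_nonneg _ _).trans (hC p hp)))⟩
  · rintro a b ⟨C, hC⟩ ⟨D, hD⟩
    exact ⟨C + D, fun p hp => (map_add_le_add _ a b).trans (add_le_add (hC p hp) (hD p hp))⟩

/-- The universal unital C*-algebra generated by contractions `x ∈ X` subject to the relations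
`r = 0`, `r ∈ R`. When the relations force the generators to be partial isometries, which is the
only case used below, the bound `1` on the generators is automatic. -/
def UniversalCStarAlgebra {X : Type u} (R : Set (FreeStarAlgebra X)) : Type u :=
  (CStarSeminorm.sup (admissibleSeminorms R) (admissibleSeminorms_bddAbove R)).CStarCompletion

namespace UniversalCStarAlgebra

variable {X : Type u} (R : Set (FreeStarAlgebra X))

instance : CStarAlgebra (UniversalCStarAlgebra R) := inferInstanceAs (CStarAlgebra
  (CStarSeminorm.sup (admissibleSeminorms R) (admissibleSeminorms_bddAbove R)).CStarCompletion)

/-- The canonical map from the free `*`-algebra. -/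
def mk : FreeStarAlgebra X →⋆ₐ[ℂ] UniversalCStarAlgebra R :=
  (CStarSeminorm.sup (admissibleSeminorms R) (admissibleSeminorms_bddAbove R)).toCompletion

/-- The images of the generators. -/
def of (x : X) : UniversalCStarAlgebra R := mk R (FreeStarAlgebra.gen x)

theorem denseRange_mk : DenseRange (mk R) := CStarSeminorm.denseRange_toCompletion _

theorem mk_eq_zero {r : FreeStarAlgebra X} (hr : r ∈ R) : mk R r = 0 := by
  rw [← norm_le_zero_iff]
  refine (CStarSeminorm.norm_toCompletion _ r).trans_le ?_
  exact CStarSeminorm.sup_le _ le_rfl (fun p hp => (hp.2 r hr).le)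

/-- The universal property: contractions in a C*-algebra satisfying the relations are
the images of the generators under a `*`-homomorphism. -/
def lift {B : Type*} [CStarAlgebra B] (f : X → B) (h1 : ∀ x, ‖f x‖ ≤ 1)
    (hR : ∀ r ∈ R, FreeStarAlgebra.lift f r = 0) : UniversalCStarAlgebra R →⋆ₐ[ℂ] B :=
  CStarSeminorm.lift _ (FreeStarAlgebra.lift f) (fun x =>
    CStarSeminorm.le_sup (admissibleSeminorms_bddAbove R)
      (p := CStarSeminorm.ofHom (FreeStarAlgebra.lift f))
      ⟨fun x => by simpa using h1 x, fun r hr => by simp [hR r hr]⟩ x)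

@[simp] theorem lift_of {B : Type*} [CStarAlgebra B] (f : X → B) (h1 : ∀ x, ‖f x‖ ≤ 1)
    (hR : ∀ r ∈ R, FreeStarAlgebra.lift f r = 0) (x : X) : lift R f h1 hR (of R x) = f x := by
  refine (CStarSeminorm.lift_toCompletion _ _ _ _).trans ?_
  simp

end UniversalCStarAlgebra

/-! ### The minimal tensor product -/

section HilbertTensor

variable {H K : Type u} [NormedAddCommGroup H] [InnerProductSpace ℂ H] [CompleteSpace H]
  [NormedAddCommGroup K] [InnerProductSpace ℂ K] [CompleteSpace K]

variable (H K) in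
/-- The Hilbert space tensor product: the completion of the algebraic tensor product for the
inner product `⟪u ⊗ v, u' ⊗ v'⟫ = ⟪u, u'⟫ ⟪v, v'⟫`. -/
def HilbertTensor : Type u := Completion (H ⊗[ℂ] K)

instance : NormedAddCommGroup (HilbertTensor H K) :=
  inferInstanceAs (NormedAddCommGroup (Completion (H ⊗[ℂ] K)))
instance : InnerProductSpace ℂ (HilbertTensor H K) :=
  inferInstanceAs (InnerProductSpace ℂ (Completion (H ⊗[ℂ] K)))
instance : CompleteSpace (HilbertTensor H K) :=
  inferInstanceAs (CompleteSpace (Completion (H ⊗[ℂ] K)))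

/-- The inclusion of the algebraic tensor product. -/
def toHilbertTensor : H ⊗[ℂ] K →ₗᵢ[ℂ] HilbertTensor H K :=
  { toFun := fun x => (x : Completion (H ⊗[ℂ] K))
    map_add' := Completion.coe_add
    map_smul' := Completion.coe_smul
    norm_map' := Completion.norm_coe }

theorem denseRange_toHilbertTensor : DenseRange (toHilbertTensor : H ⊗[ℂ] K → HilbertTensor H K) :=
  Completion.denseRange_coe

/-- The operator `S ⊗ T` on the Hilbert space tensor product of `H` and `K`. -/
def hilbertTensorOp (S : H →L[ℂ] H) (T : K →L[ℂ] K) :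
    HilbertTensor H K →L[ℂ] HilbertTensor H K :=
  ContinuousLinearMap.mk
    { toFun := fun x => (TensorProduct.mapL S T).completion x
      map_add' := map_add (TensorProduct.mapL S T).completion
      map_smul' := map_smul (TensorProduct.mapL S T).completion }
    (TensorProduct.mapL S T).completion.continuous

theorem hilbertTensorOp_coe (S : H →L[ℂ] H) (T : K →L[ℂ] K) (x : H ⊗[ℂ] K) :
    hilbertTensorOp S T (toHilbertTensor x) = toHilbertTensor (TensorProduct.mapL S T x) :=
  ContinuousLinearMap.completion_apply_coe _ x

theorem hilbert_ext {S T : HilbertTensor H K →L[ℂ] HilbertTensor H K}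
    (h : ∀ x : H ⊗[ℂ] K, S (toHilbertTensor x) = T (toHilbertTensor x)) : S = T := by
  ext x
  exact denseRange_toHilbertTensor.induction_on x (isClosed_eq S.continuous T.continuous) h

theorem norm_hilbertTensorOp_le (S : H →L[ℂ] H) (T : K →L[ℂ] K) :
    ‖hilbertTensorOp S T‖ ≤ ‖S‖ * ‖T‖ := by
  refine ContinuousLinearMap.opNorm_le_bound _ (by positivity) (fun x => ?_)
  refine denseRange_toHilbertTensor.induction_on x
    (isClosed_le (by fun_prop) (by fun_prop)) (fun a => ?_)
  rw [hilbertTensorOp_coe, LinearIsometry.norm_map, LinearIsometry.norm_map]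
  exact ((TensorProduct.mapL S T).le_opNorm a).trans
    (mul_le_mul_of_nonneg_right (TensorProduct.norm_mapL_le S T) (norm_nonneg _))

theorem hilbertTensorOp_mul (S S' : H →L[ℂ] H) (T T' : K →L[ℂ] K) :
    hilbertTensorOp (S * S') (T * T') = hilbertTensorOp S T * hilbertTensorOp S' T' := by
  refine hilbert_ext fun x => ?_
  rw [mul_apply_eq_comp, hilbertTensorOp_coe, hilbertTensorOp_coe,
    hilbertTensorOp_coe, TensorProduct.mapL_mul]
  rfl

theorem hilbertTensorOp_one : hilbertTensorOp (1 : H →L[ℂ] H) (1 : K →L[ℂ] K) = 1 := by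
  refine hilbert_ext fun x => ?_
  rw [hilbertTensorOp_coe]
  rw [show (1 : H →L[ℂ] H) = .id ℂ H from rfl, show (1 : K →L[ℂ] K) = .id ℂ K from rfl,
    TensorProduct.mapL_id_id]
  rfl

theorem hilbertTensorOp_star (S : H →L[ℂ] H) (T : K →L[ℂ] K) :
    hilbertTensorOp (star S) (star T) = star (hilbertTensorOp S T) := by
  rw [ContinuousLinearMap.star_eq_adjoint (hilbertTensorOp S T),
    ContinuousLinearMap.eq_adjoint_iff]
  intro x y
  refine denseRange_toHilbertTensor.induction_on₂ (isClosed_eq (by fun_prop) (by fun_prop))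
    (fun a b => ?_) x y
  rw [hilbertTensorOp_coe, hilbertTensorOp_coe, LinearIsometry.inner_map_map,
    LinearIsometry.inner_map_map]
  induction a with
  | zero => simp
  | add a a' h h' => rw [map_add, inner_add_left, h, h', inner_add_left]
  | tmul u v =>
    induction b with
    | zero => simp
    | add b b' h h' => rw [inner_add_right, h, h', map_add, inner_add_right]
    | tmul u' v' =>
      simp [ContinuousLinearMap.star_eq_adjoint, ContinuousLinearMap.adjoint_inner_left]

/-- `hilbertTensorOp` as a bilinear map. -/
def hilbertTensorBilin : (H →L[ℂ] H) →ₗ[ℂ] (K →L[ℂ] K) →ₗ[ℂ]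
    (HilbertTensor H K →L[ℂ] HilbertTensor H K) :=
  LinearMap.mk₂ ℂ hilbertTensorOp
    (fun S S' T => hilbert_ext fun x => by
      rw [add_apply, hilbertTensorOp_coe, hilbertTensorOp_coe,
        hilbertTensorOp_coe, TensorProduct.mapL_add_left, add_apply,
        map_add])
    (fun c S T => hilbert_ext fun x => by
      rw [smul_apply, hilbertTensorOp_coe, hilbertTensorOp_coe,
        TensorProduct.mapL_smul_left, smul_apply, map_smul])
    (fun S T T' => hilbert_ext fun x => by
      rw [add_apply, hilbertTensorOp_coe, hilbertTensorOp_coe,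
        hilbertTensorOp_coe, TensorProduct.mapL_add_right, add_apply,
        map_add])
    (fun c S T => hilbert_ext fun x => by
      rw [smul_apply, hilbertTensorOp_coe, hilbertTensorOp_coe,
        TensorProduct.mapL_smul_right, smul_apply, map_smul])

end HilbertTensor

section MinTensor

variable {A B A' B' : Type u} [CStarAlgebra A] [CStarAlgebra B] [CStarAlgebra A'] [CStarAlgebra B']

section Rep

variable {H K : Type u} [NormedAddCommGroup H] [InnerProductSpace ℂ H] [CompleteSpace H]
  [NormedAddCommGroup K] [InnerProductSpace ℂ K] [CompleteSpace K]

/-- The linear map underlying `tensorRep`. -/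
def tensorRepLinear (π : A →⋆ₐ[ℂ] (H →L[ℂ] H)) (σ : B →⋆ₐ[ℂ] (K →L[ℂ] K)) :
    A ⊗[ℂ] B →ₗ[ℂ] (HilbertTensor H K →L[ℂ] HilbertTensor H K) :=
  TensorProduct.lift (hilbertTensorBilin.compl₁₂ π.toAlgHom.toLinearMap σ.toAlgHom.toLinearMap)

theorem tensorRepLinear_tmul (π : A →⋆ₐ[ℂ] (H →L[ℂ] H)) (σ : B →⋆ₐ[ℂ] (K →L[ℂ] K))
    (a : A) (b : B) : tensorRepLinear π σ (a ⊗ₜ b) = hilbertTensorOp (π a) (σ b) := rfl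

theorem tensorRepLinear_mul (π : A →⋆ₐ[ℂ] (H →L[ℂ] H)) (σ : B →⋆ₐ[ℂ] (K →L[ℂ] K))
    (x y : A ⊗[ℂ] B) :
    tensorRepLinear π σ (x * y) = tensorRepLinear π σ x * tensorRepLinear π σ y := by
  induction x with
  | zero => simp
  | add x x' hx hx' => rw [add_mul, map_add, hx, hx', map_add, add_mul]
  | tmul a b =>
    induction y with
    | zero => simp
    | add y y' hy hy' => rw [mul_add, map_add, hy, hy', map_add, mul_add]
    | tmul a' b' =>
      rw [Algebra.TensorProduct.tmul_mul_tmul, tensorRepLinear_tmul, tensorRepLinear_tmul,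
        tensorRepLinear_tmul, map_mul, map_mul, hilbertTensorOp_mul]

theorem tensorRepLinear_one (π : A →⋆ₐ[ℂ] (H →L[ℂ] H)) (σ : B →⋆ₐ[ℂ] (K →L[ℂ] K)) :
    tensorRepLinear π σ 1 = 1 := by
  rw [Algebra.TensorProduct.one_def, tensorRepLinear_tmul, map_one, map_one, hilbertTensorOp_one]

theorem tensorRepLinear_star (π : A →⋆ₐ[ℂ] (H →L[ℂ] H)) (σ : B →⋆ₐ[ℂ] (K →L[ℂ] K))
    (x : A ⊗[ℂ] B) : tensorRepLinear π σ (star x) = star (tensorRepLinear π σ x) := by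
  induction x with
  | zero => simp
  | add x y hx hy => rw [star_add, map_add, hx, hy, map_add, star_add]
  | tmul a b =>
    rw [TensorProduct.star_tmul, tensorRepLinear_tmul, tensorRepLinear_tmul, map_star, map_star,
      hilbertTensorOp_star]

/-- The representation `a ⊗ b ↦ π a ⊗ σ b` of the algebraic tensor product on the
Hilbert space tensor product. -/
def tensorRep (π : A →⋆ₐ[ℂ] (H →L[ℂ] H)) (σ : B →⋆ₐ[ℂ] (K →L[ℂ] K)) :
    A ⊗[ℂ] B →⋆ₐ[ℂ] (HilbertTensor H K →L[ℂ] HilbertTensor H K) :=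
  { AlgHom.ofLinearMap (tensorRepLinear π σ) (tensorRepLinear_one π σ)
      (tensorRepLinear_mul π σ) with
    map_star' := tensorRepLinear_star π σ }

@[simp] theorem tensorRep_tmul (π : A →⋆ₐ[ℂ] (H →L[ℂ] H)) (σ : B →⋆ₐ[ℂ] (K →L[ℂ] K))
    (a : A) (b : B) : tensorRep π σ (a ⊗ₜ b) = hilbertTensorOp (π a) (σ b) := rfl

theorem norm_tensorRep_tmul_le (π : A →⋆ₐ[ℂ] (H →L[ℂ] H)) (σ : B →⋆ₐ[ℂ] (K →L[ℂ] K))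
    (a : A) (b : B) : ‖tensorRep π σ (a ⊗ₜ b)‖ ≤ ‖a‖ * ‖b‖ := by
  rw [tensorRep_tmul]
  exact (norm_hilbertTensorOp_le _ _).trans (mul_le_mul
    (NonUnitalStarAlgHom.norm_apply_le π a) (NonUnitalStarAlgHom.norm_apply_le σ b)
    (norm_nonneg _) (norm_nonneg _))

theorem tensorRep_map (f : A →⋆ₐ[ℂ] A') (g : B →⋆ₐ[ℂ] B') (π : A' →⋆ₐ[ℂ] (H →L[ℂ] H))
    (σ : B' →⋆ₐ[ℂ] (K →L[ℂ] K)) (x : A ⊗[ℂ] B) :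
    tensorRep π σ (Algebra.TensorProduct.map f.toAlgHom g.toAlgHom x) =
      tensorRep (π.comp f) (σ.comp g) x := by
  induction x with
  | zero => simp
  | add x y hx hy => rw [map_add, map_add, hx, hy, map_add]
  | tmul a b => rfl

end Rep

variable (A B) in
/-- The C*-seminorms `‖(π ⊗ σ)(·)‖` on the algebraic tensor product, where `π` and `σ` are
representations of `A` and `B` on Hilbert spaces. -/
def spatialSeminorms : Set (CStarSeminorm (A ⊗[ℂ] B)) :=
  {p | ∃ (H K : Type u) (_ : NormedAddCommGroup H) (_ : InnerProductSpace ℂ H)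
    (_ : CompleteSpace H) (_ : NormedAddCommGroup K) (_ : InnerProductSpace ℂ K)
    (_ : CompleteSpace K) (π : A →⋆ₐ[ℂ] (H →L[ℂ] H)) (σ : B →⋆ₐ[ℂ] (K →L[ℂ] K)),
    p = CStarSeminorm.ofHom (tensorRep π σ)}

theorem spatialSeminorms_bddAbove (x : A ⊗[ℂ] B) :
    BddAbove (Set.range fun p : spatialSeminorms A B => p.1 x) := by
  suffices h : ∃ C, ∀ p ∈ spatialSeminorms A B, p x ≤ C by
    obtain ⟨C, hC⟩ := h
    exact ⟨C, by rintro _ ⟨p, rfl⟩; exact hC p.1 p.2⟩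
  induction x with
  | zero => exact ⟨0, fun p _ => (map_zero p.toSeminorm).le⟩
  | add x y hx hy =>
    obtain ⟨C, hC⟩ := hx
    obtain ⟨D, hD⟩ := hy
    exact ⟨C + D, fun p hp => (map_add_le_add _ x y).trans (add_le_add (hC p hp) (hD p hp))⟩
  | tmul a b =>
    refine ⟨‖a‖ * ‖b‖, ?_⟩
    rintro p ⟨H, K, _, _, _, _, _, _, π, σ, rfl⟩
    exact norm_tensorRep_tmul_le π σ a b

variable (A B) in
/-- The minimal (spatial) C*-norm on the algebraic tensor product. -/
def minSeminorm : CStarSeminorm (A ⊗[ℂ] B) :=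
  CStarSeminorm.sup (spatialSeminorms A B) spatialSeminorms_bddAbove

variable (A B) in
/-- The minimal (spatial) tensor product of two C*-algebras. -/
def MinTensor : Type u := (minSeminorm A B).CStarCompletion

instance : CStarAlgebra (MinTensor A B) :=
  inferInstanceAs (CStarAlgebra (minSeminorm A B).CStarCompletion)

namespace MinTensor

variable (A B) in
/-- The canonical map from the algebraic to the minimal tensor product. -/
def ofAlgebraic : A ⊗[ℂ] B →⋆ₐ[ℂ] MinTensor A B := (minSeminorm A B).toCompletion

theorem denseRange_ofAlgebraic : DenseRange (ofAlgebraic A B) :=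
  (minSeminorm A B).denseRange_toCompletion

/-- Elementary tensors in the minimal tensor product. -/
def tmul (a : A) (b : B) : MinTensor A B := ofAlgebraic A B (a ⊗ₜ b)

theorem tmul_mul_tmul (a a' : A) (b b' : B) :
    tmul a b * tmul a' b' = tmul (a * a') (b * b') := by
  rw [tmul, tmul, ← map_mul, Algebra.TensorProduct.tmul_mul_tmul, tmul]

theorem star_tmul (a : A) (b : B) : star (tmul a b) = tmul (star a) (star b) := by
  rw [tmul, ← map_star, TensorProduct.star_tmul, tmul]

theorem one_eq : (1 : MinTensor A B) = tmul 1 1 := (map_one (ofAlgebraic A B)).symm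

theorem norm_tmul_le (a : A) (b : B) : ‖tmul a b‖ ≤ ‖a‖ * ‖b‖ := by
  refine ((minSeminorm A B).norm_toCompletion _).trans_le ?_
  refine CStarSeminorm.sup_le _ (by positivity) ?_
  rintro p ⟨H, K, _, _, _, _, _, _, π, σ, rfl⟩
  exact norm_tensorRep_tmul_le π σ a b

/-- The bounded bilinear map `(a, b) ↦ a ⊗ b`. -/
def tmulCLM : A →L[ℂ] B →L[ℂ] MinTensor A B :=
  LinearMap.mkContinuous₂
    ((TensorProduct.mk ℂ A B).compr₂ (ofAlgebraic A B).toAlgHom.toLinearMap) 1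
    (fun a b => by rw [one_mul]; exact norm_tmul_le a b)

theorem tmulCLM_apply (a : A) (b : B) : tmulCLM a b = tmul a b := rfl

/-- The `*`-homomorphism `f ⊗ g` between algebraic tensor products. -/
def algMap (f : A →⋆ₐ[ℂ] A') (g : B →⋆ₐ[ℂ] B') : A ⊗[ℂ] B →⋆ₐ[ℂ] A' ⊗[ℂ] B' :=
  { Algebra.TensorProduct.map f.toAlgHom g.toAlgHom with
    map_star' := fun x => by
      change Algebra.TensorProduct.map f.toAlgHom g.toAlgHom (star x) =
        star (Algebra.TensorProduct.map f.toAlgHom g.toAlgHom x)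
      induction x with
      | zero => simp
      | add x y hx hy => rw [star_add, map_add, hx, hy, map_add, star_add]
      | tmul a b =>
        change f (star a) ⊗ₜ[ℂ] g (star b) = star (f a) ⊗ₜ[ℂ] star (g b)
        rw [map_star, map_star] }

theorem minSeminorm_algMap_le (f : A →⋆ₐ[ℂ] A') (g : B →⋆ₐ[ℂ] B') (x : A ⊗[ℂ] B) :
    minSeminorm A' B' (algMap f g x) ≤ minSeminorm A B x := by
  refine CStarSeminorm.sup_le _ (apply_nonneg _ _) ?_
  rintro p ⟨H, K, _, _, _, _, _, _, π, σ, rfl⟩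
  rw [CStarSeminorm.ofHom_apply]
  change ‖tensorRep π σ (Algebra.TensorProduct.map f.toAlgHom g.toAlgHom x)‖ ≤ _
  rw [tensorRep_map]
  exact CStarSeminorm.le_sup spatialSeminorms_bddAbove
    (p := CStarSeminorm.ofHom (tensorRep (π.comp f) (σ.comp g)))
    ⟨H, K, _, _, _, _, _, _, π.comp f, σ.comp g, rfl⟩ x

/-- The `*`-homomorphism `f ⊗ g` between minimal tensor products. -/
def map (f : A →⋆ₐ[ℂ] A') (g : B →⋆ₐ[ℂ] B') : MinTensor A B →⋆ₐ[ℂ] MinTensor A' B' :=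
  (minSeminorm A B).lift ((ofAlgebraic A' B').comp (algMap f g)) (fun x =>
    ((minSeminorm A' B').norm_toCompletion _).trans_le (minSeminorm_algMap_le f g x))

@[simp] theorem map_tmul (f : A →⋆ₐ[ℂ] A') (g : B →⋆ₐ[ℂ] B') (a : A) (b : B) :
    map f g (tmul a b) = tmul (f a) (g b) :=
  (minSeminorm A B).lift_toCompletion _ _ (a ⊗ₜ b)

end MinTensor

end MinTensor

/-! ### Compact quantum groups and their actions -/

/-- The graph of the canonical isomorphism `(A ⊗ B) ⊗ C ≅ A ⊗ (B ⊗ C)`, that is, the closed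
linear span of the pairs `((a ⊗ b) ⊗ c, a ⊗ (b ⊗ c))`. -/
def associatorGraph (A B C : Type u) [CStarAlgebra A] [CStarAlgebra B] [CStarAlgebra C] :
    Submodule ℂ (MinTensor (MinTensor A B) C × MinTensor A (MinTensor B C)) :=
  (Submodule.span ℂ (Set.range fun t : A × B × C =>
    (MinTensor.tmul (MinTensor.tmul t.1 t.2.1) t.2.2,
      MinTensor.tmul t.1 (MinTensor.tmul t.2.1 t.2.2)))).topologicalClosure

/-- `u` and `v` are equal under the canonical identification of `(A ⊗ B) ⊗ C` with
`A ⊗ (B ⊗ C)`. -/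
def AssocEq {A B C : Type u} [CStarAlgebra A] [CStarAlgebra B] [CStarAlgebra C]
    (u : MinTensor (MinTensor A B) C) (v : MinTensor A (MinTensor B C)) : Prop :=
  (u, v) ∈ associatorGraph A B C

/-- A compact quantum group: a unital C*-algebra with a coassociative comultiplication for
which the linear spans of `Δ(Q)(1 ⊗ Q)` and `Δ(Q)(Q ⊗ 1)` are dense in `Q ⊗ Q`. -/
structure CompactQuantumGroup where
  carrier : Type u
  [cstarAlgebra : CStarAlgebra carrier]
  comul : carrier →⋆ₐ[ℂ] MinTensor carrier carrier
  coassoc : ∀ x, AssocEq (MinTensor.map comul (StarAlgHom.id ℂ carrier) (comul x))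
    (MinTensor.map (StarAlgHom.id ℂ carrier) comul (comul x))
  dense_one_tmul : Dense (Submodule.span ℂ
    {y | ∃ a b : carrier, y = comul a * MinTensor.tmul 1 b} : Set (MinTensor carrier carrier))
  dense_tmul_one : Dense (Submodule.span ℂ
    {y | ∃ a b : carrier, y = comul a * MinTensor.tmul b 1} : Set (MinTensor carrier carrier))

attribute [instance] CompactQuantumGroup.cstarAlgebra

/-- A `*`-homomorphism `φ` is a morphism of compact quantum groups if
`(φ ⊗ φ) ∘ Δ₁ = Δ₂ ∘ φ`. -/
def IsCQGMorphism (G₁ G₂ : CompactQuantumGroup.{u}) (φ : G₁.carrier →⋆ₐ[ℂ] G₂.carrier) : Prop :=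
  ∀ x, MinTensor.map φ φ (G₁.comul x) = G₂.comul (φ x)

/-- Two compact quantum groups are isomorphic if there is a bijective morphism between them. -/
def IsomorphicCQG (G₁ G₂ : CompactQuantumGroup.{u}) : Prop :=
  ∃ φ : G₁.carrier →⋆ₐ[ℂ] G₂.carrier, IsCQGMorphism G₁ G₂ φ ∧ Function.Bijective φ

/-- `R` is the slice map `θ ⊗ id : C ⊗ Q → Q`: the bounded linear map with
`c ⊗ q ↦ θ(c) q`. -/
def IsSliceMap {C Q : Type u} [CStarAlgebra C] [CStarAlgebra Q] (θ : C →L[ℂ] ℂ)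
    (R : MinTensor C Q →L[ℂ] Q) : Prop :=
  ∀ c q, R (MinTensor.tmul c q) = θ c • q

/-- A quantum transformation group of `C`: a compact quantum group with a faithful action
on `C`. -/
structure QuantumTransformationGroup (C : Type u) [CStarAlgebra C] where
  cqg : CompactQuantumGroup.{u}
  action : C →⋆ₐ[ℂ] MinTensor C cqg.carrier
  coaction : ∀ c, AssocEq (MinTensor.map action (StarAlgHom.id ℂ cqg.carrier) (action c))
    (MinTensor.map (StarAlgHom.id ℂ C) cqg.comul (action c))
  dense_span : Dense (Submodule.span ℂ
    {y | ∃ (c : C) (q : cqg.carrier), y = action c * MinTensor.tmul 1 q} :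
      Set (MinTensor C cqg.carrier))
  faithful : Dense (StarAlgebra.adjoin ℂ
    {q | ∃ (θ : C →L[ℂ] ℂ) (R : MinTensor C cqg.carrier →L[ℂ] cqg.carrier),
      IsSliceMap θ R ∧ ∃ c, q = R (action c)} : Set cqg.carrier)

/-- `U` is a universal object of the category of those quantum transformation groups of `C`
which satisfy `P`: it satisfies `P`, and for every `W` satisfying `P` there is a surjective
morphism of compact quantum groups `φ` from `U` to `W` with `(id ⊗ φ) ∘ α_U = α_W`. -/
def IsUniversalObject {C : Type u} [CStarAlgebra C] (P : QuantumTransformationGroup C → Prop)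
    (U : QuantumTransformationGroup C) : Prop :=
  P U ∧ ∀ W, P W → ∃ φ : U.cqg.carrier →⋆ₐ[ℂ] W.cqg.carrier, IsCQGMorphism U.cqg W.cqg φ ∧
    Function.Surjective φ ∧
    ∀ c, MinTensor.map (StarAlgHom.id ℂ C) φ (U.action c) = W.action c

/-! ### The free product of copies of the circle -/

theorem MinTensor.dense_of_tmul_mem {A B : Type u} [CStarAlgebra A] [CStarAlgebra B]
    (M : Submodule ℂ (MinTensor A B))
    (h : ∀ a b, MinTensor.tmul a b ∈ M.topologicalClosure) :
    Dense (M : Set (MinTensor A B)) := by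
  rw [Submodule.dense_iff_topologicalClosure_eq_top, Submodule.eq_top_iff']
  intro x
  refine MinTensor.denseRange_ofAlgebraic.induction_on
    (p := fun x => x ∈ M.topologicalClosure) x M.isClosed_topologicalClosure (fun t => ?_)
  induction t with
  | zero => rw [map_zero]; exact Submodule.zero_mem _
  | add x y hx hy => rw [map_add]; exact Submodule.add_mem _ hx hy
  | tmul a b => exact h a b

section CStarNorm

variable {B : Type*} [CStarAlgebra B]

theorem CStarAlgebra.norm_one_le : ‖(1 : B)‖ ≤ 1 := by
  have h := CStarRing.norm_star_mul_self (x := (1 : B))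
  rw [star_one, one_mul] at h
  nlinarith [norm_nonneg (1 : B)]

theorem CStarAlgebra.norm_le_one_of_star_mul_self_eq_one {a : B} (h : star a * a = 1) :
    ‖a‖ ≤ 1 := by
  have h1 := CStarRing.norm_star_mul_self (x := a)
  rw [h] at h1
  nlinarith [norm_nonneg a, CStarAlgebra.norm_one_le (B := B)]

end CStarNorm

/-- The relations `z_i* z_i = 1 = z_i z_i*`. -/
def unitaryRelators (I : Type u) : Set (FreeStarAlgebra I) :=
  {r | ∃ i, r = star (FreeStarAlgebra.gen i) * FreeStarAlgebra.gen i - 1 ∨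
    r = FreeStarAlgebra.gen i * star (FreeStarAlgebra.gen i) - 1}

/-- The free product of copies of `C(S¹)` indexed by `I`: the universal unital C*-algebra
generated by unitaries `z i`, `i ∈ I`. -/
def CircleFreeProduct (I : Type u) : Type u := UniversalCStarAlgebra (unitaryRelators I)

namespace CircleFreeProduct

variable {I : Type u}

instance : CStarAlgebra (CircleFreeProduct I) :=
  inferInstanceAs (CStarAlgebra (UniversalCStarAlgebra (unitaryRelators I)))

/-- The canonical map from the free `*`-algebra. -/
def mk : FreeStarAlgebra I →⋆ₐ[ℂ] CircleFreeProduct I := UniversalCStarAlgebra.mk _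

theorem denseRange_mk : DenseRange (mk : FreeStarAlgebra I → CircleFreeProduct I) :=
  UniversalCStarAlgebra.denseRange_mk _

/-- The canonical unitary generators. -/
def z (i : I) : CircleFreeProduct I := mk (FreeStarAlgebra.gen i)

theorem star_z_mul_z (i : I) : star (z i) * z i = 1 := by
  have h : mk (star (FreeStarAlgebra.gen i) * FreeStarAlgebra.gen i - 1) = 0 :=
    UniversalCStarAlgebra.mk_eq_zero _ ⟨i, Or.inl rfl⟩
  rwa [map_sub, map_mul, map_star, map_one, sub_eq_zero] at h

theorem z_mul_star_z (i : I) : z i * star (z i) = 1 := by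
  have h : mk (FreeStarAlgebra.gen i * star (FreeStarAlgebra.gen i) - 1) = 0 :=
    UniversalCStarAlgebra.mk_eq_zero _ ⟨i, Or.inr rfl⟩
  rwa [map_sub, map_mul, map_star, map_one, sub_eq_zero] at h

/-- The universal property: unitaries `u i` in a C*-algebra are the images of the generators
`z i` under a `*`-homomorphism. -/
def lift {B : Type*} [CStarAlgebra B] (f : I → B) (h1 : ∀ i, star (f i) * f i = 1)
    (h2 : ∀ i, f i * star (f i) = 1) : CircleFreeProduct I →⋆ₐ[ℂ] B :=
  UniversalCStarAlgebra.lift _ f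
    (fun i => CStarAlgebra.norm_le_one_of_star_mul_self_eq_one (h1 i))
    (by
      rintro r ⟨i, rfl | rfl⟩
      · simp [map_star, h1 i]
      · simp [map_star, h2 i])

@[simp] theorem lift_z {B : Type*} [CStarAlgebra B] (f : I → B) (h1 : ∀ i, star (f i) * f i = 1)
    (h2 : ∀ i, f i * star (f i) = 1) (i : I) : lift f h1 h2 (z i) = f i :=
  UniversalCStarAlgebra.lift_of _ f _ _ i

/-- The comultiplication, determined by `Δ(z i) = z i ⊗ z i`. -/
def comul : CircleFreeProduct I →⋆ₐ[ℂ] MinTensor (CircleFreeProduct I) (CircleFreeProduct I) :=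
  lift (fun i => MinTensor.tmul (z i) (z i))
    (fun i => by
      rw [MinTensor.star_tmul, MinTensor.tmul_mul_tmul, star_z_mul_z, MinTensor.one_eq])
    (fun i => by
      rw [MinTensor.star_tmul, MinTensor.tmul_mul_tmul, z_mul_star_z, MinTensor.one_eq])

theorem comul_z (i : I) : comul (z i) = MinTensor.tmul (z i) (z i) := lift_z _ _ _ i

/-- The images of the letters of the free `*`-algebra are group-like unitaries. -/
theorem letter_props (y : I ⊕ I) :
    comul (mk (FreeStarAlgebra.letter y)) =
        MinTensor.tmul (mk (FreeStarAlgebra.letter y)) (mk (FreeStarAlgebra.letter y)) ∧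
      mk (FreeStarAlgebra.letter y) * star (mk (FreeStarAlgebra.letter y)) = 1 := by
  cases y with
  | inl i => exact ⟨comul_z i, z_mul_star_z i⟩
  | inr i =>
    have h : mk (FreeStarAlgebra.letter (Sum.inr i)) = star (z i) := by
      rw [z, ← map_star, FreeStarAlgebra.gen, FreeStarAlgebra.star_letter]
      rfl
    rw [h, map_star, comul_z, MinTensor.star_tmul, star_star]
    exact ⟨rfl, star_z_mul_z i⟩

theorem mem_of_mul_letter {T : Submodule ℂ (CircleFreeProduct I)}
    (hT : IsClosed (T : Set (CircleFreeProduct I))) (h1 : 1 ∈ T)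
    (hl : ∀ y, ∀ a ∈ T, mk (FreeStarAlgebra.letter y) * a ∈ T) (a : CircleFreeProduct I) :
    a ∈ T := by
  have key : ∀ x : FreeStarAlgebra I, ∀ a ∈ T, mk x * a ∈ T := by
    intro x
    induction x using FreeStarAlgebra.induction_letters with
    | scalar r =>
      intro a ha
      rw [AlgHomClass.commutes, ← Algebra.smul_def]
      exact T.smul_mem r ha
    | letters y => exact hl y
    | mul x y hx hy =>
      intro a ha
      rw [map_mul, mul_assoc]
      exact hx _ (hy a ha)
    | add x y hx hy =>
      intro a ha
      rw [map_add, add_mul]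
      exact T.add_mem (hx a ha) (hy a ha)
  refine denseRange_mk.induction_on (p := fun a => a ∈ T) a hT (fun x => ?_)
  simpa using key x 1 h1

theorem coassoc (x : CircleFreeProduct I) :
    AssocEq (MinTensor.map comul (StarAlgHom.id ℂ _) (comul x))
      (MinTensor.map (StarAlgHom.id ℂ _) comul (comul x)) := by
  set L := (MinTensor.map comul (StarAlgHom.id ℂ (CircleFreeProduct I))).comp comul with hL
  set R := (MinTensor.map (StarAlgHom.id ℂ (CircleFreeProduct I)) comul).comp comul with hR
  let D := associatorGraph (CircleFreeProduct I) (CircleFreeProduct I) (CircleFreeProduct I)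
  have hD : IsClosed (D : Set (MinTensor (MinTensor (CircleFreeProduct I) (CircleFreeProduct I))
      (CircleFreeProduct I) × MinTensor (CircleFreeProduct I)
        (MinTensor (CircleFreeProduct I) (CircleFreeProduct I)))) :=
    Submodule.isClosed_topologicalClosure _
  have hmem : ∀ a b c, (MinTensor.tmul (MinTensor.tmul a b) c,
      MinTensor.tmul a (MinTensor.tmul b c)) ∈ D := fun a b c =>
    Submodule.le_topologicalClosure _ (Submodule.subset_span ⟨(a, b, c), rfl⟩)
  have hmul : ∀ (g : CircleFreeProduct I), ∀ w ∈ D,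
      ((MinTensor.tmul (MinTensor.tmul g g) g, MinTensor.tmul g (MinTensor.tmul g g)) :
        MinTensor (MinTensor _ _) _ × MinTensor _ (MinTensor _ _)) * w ∈ D := by
    intro g
    refine Submodule.topologicalClosure_minimal (t := D.comap (LinearMap.mulLeft ℂ _)) _ ?_
      (hD.preimage (continuous_const_mul _))
    rw [Submodule.span_le]
    rintro _ ⟨⟨a, b, c⟩, rfl⟩
    change (_ * _, _ * _) ∈ D
    simp only [MinTensor.tmul_mul_tmul]
    exact hmem _ _ _
  let T : Submodule ℂ (CircleFreeProduct I) :=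
    D.comap (L.toAlgHom.toLinearMap.prod R.toAlgHom.toLinearMap)
  have hT : ∀ x, x ∈ T ↔ (L x, R x) ∈ D := fun x => Iff.rfl
  have hLc : Continuous L :=
    AddMonoidHomClass.continuous_of_bound L 1 (by simpa using NonUnitalStarAlgHom.norm_apply_le L)
  have hRc : Continuous R :=
    AddMonoidHomClass.continuous_of_bound R 1 (by simpa using NonUnitalStarAlgHom.norm_apply_le R)
  have : x ∈ T := by
    refine mem_of_mul_letter (hD.preimage (hLc.prodMk hRc)) ?_ (fun y a ha => ?_) x
    · rw [hT, map_one, map_one, MinTensor.one_eq, MinTensor.one_eq, MinTensor.one_eq]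
      exact hmem 1 1 1
    · have h := (letter_props y).1
      rw [hT] at ha ⊢
      have h2 := hmul (mk (FreeStarAlgebra.letter y)) _ ha
      have hl : L (mk (FreeStarAlgebra.letter y)) = MinTensor.tmul
          (MinTensor.tmul (mk (FreeStarAlgebra.letter y)) (mk (FreeStarAlgebra.letter y)))
          (mk (FreeStarAlgebra.letter y)) := by
        rw [hL, StarAlgHom.comp_apply, h, MinTensor.map_tmul, h, StarAlgHom.coe_id, id_eq]
      have hr : R (mk (FreeStarAlgebra.letter y)) = MinTensor.tmul
          (mk (FreeStarAlgebra.letter y))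
          (MinTensor.tmul (mk (FreeStarAlgebra.letter y)) (mk (FreeStarAlgebra.letter y))) := by
        rw [hR, StarAlgHom.comp_apply, h, MinTensor.map_tmul, h, StarAlgHom.coe_id, id_eq]
      rw [map_mul, map_mul, hl, hr]
      exact h2
  exact this

theorem mul_mem_closure {M : Submodule ℂ (MinTensor (CircleFreeProduct I) (CircleFreeProduct I))}
    (g : MinTensor (CircleFreeProduct I) (CircleFreeProduct I)) (hM : ∀ w ∈ M, g * w ∈ M) :
    ∀ w ∈ M.topologicalClosure, g * w ∈ M.topologicalClosure := by
  refine Submodule.topologicalClosure_minimal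
    (t := M.topologicalClosure.comap (LinearMap.mulLeft ℂ g)) _ ?_
    (M.isClosed_topologicalClosure.preimage (continuous_const_mul g))
  exact fun w hw => Submodule.le_topologicalClosure _ (hM w hw)

theorem dense_one_tmul : Dense (Submodule.span ℂ
    {y | ∃ a b : CircleFreeProduct I, y = comul a * MinTensor.tmul 1 b} :
      Set (MinTensor (CircleFreeProduct I) (CircleFreeProduct I))) := by
  set M := Submodule.span ℂ
    {y | ∃ a b : CircleFreeProduct I, y = comul a * MinTensor.tmul 1 b} with hM
  refine MinTensor.dense_of_tmul_mem M fun a => ?_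
  let T : Submodule ℂ (CircleFreeProduct I) := ⨅ b, M.topologicalClosure.comap
    (MinTensor.tmulCLM.flip b : CircleFreeProduct I →L[ℂ] MinTensor _ _).toLinearMap
  have hT : ∀ x, x ∈ T ↔ ∀ b, MinTensor.tmul x b ∈ M.topologicalClosure := fun x => by
    simp only [T, Submodule.mem_iInf]
    rfl
  refine (hT a).1 (mem_of_mul_letter ?_ ?_ (fun y c hc => ?_) a)
  · have : (T : Set (CircleFreeProduct I)) = ⋂ b, (MinTensor.tmulCLM.flip b) ⁻¹'
        (M.topologicalClosure : Set (MinTensor (CircleFreeProduct I) (CircleFreeProduct I))) := by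
      ext x
      rw [SetLike.mem_coe, hT, Set.mem_iInter]
      rfl
    rw [this]
    exact isClosed_iInter fun b => M.isClosed_topologicalClosure.preimage (map_continuous _)
  · rw [hT]
    exact fun b => Submodule.le_topologicalClosure _
      (Submodule.subset_span ⟨1, b, by rw [map_one, one_mul]⟩)
  · obtain ⟨h1, h2⟩ := letter_props y
    rw [hT] at hc ⊢
    intro b
    have h3 : MinTensor.tmul (mk (FreeStarAlgebra.letter y) * c) b =
        comul (mk (FreeStarAlgebra.letter y)) *
          MinTensor.tmul c (star (mk (FreeStarAlgebra.letter y)) * b) := by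
      rw [h1, MinTensor.tmul_mul_tmul, ← mul_assoc, h2, one_mul]
    rw [h3]
    refine mul_mem_closure _ (fun w hw => ?_) _ (hc _)
    induction hw using Submodule.span_induction with
    | mem w hw =>
      obtain ⟨a, b, rfl⟩ := hw
      exact Submodule.subset_span ⟨_ * a, b, by rw [map_mul, mul_assoc]⟩
    | zero => rw [mul_zero]; exact Submodule.zero_mem _
    | add w w' _ _ hw hw' => rw [mul_add]; exact Submodule.add_mem _ hw hw'
    | smul r w _ hw => rw [mul_smul_comm]; exact Submodule.smul_mem _ r hw

theorem dense_tmul_one : Dense (Submodule.span ℂ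
    {y | ∃ a b : CircleFreeProduct I, y = comul a * MinTensor.tmul b 1} :
      Set (MinTensor (CircleFreeProduct I) (CircleFreeProduct I))) := by
  set M := Submodule.span ℂ
    {y | ∃ a b : CircleFreeProduct I, y = comul a * MinTensor.tmul b 1} with hM
  refine MinTensor.dense_of_tmul_mem M fun b a => ?_
  let T : Submodule ℂ (CircleFreeProduct I) := ⨅ b, M.topologicalClosure.comap
    (MinTensor.tmulCLM b : CircleFreeProduct I →L[ℂ] MinTensor _ _).toLinearMap
  have hT : ∀ x, x ∈ T ↔ ∀ b, MinTensor.tmul b x ∈ M.topologicalClosure := fun x => by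
    simp only [T, Submodule.mem_iInf]
    rfl
  refine (hT a).1 (mem_of_mul_letter ?_ ?_ (fun y c hc => ?_) a) b
  · have : (T : Set (CircleFreeProduct I)) = ⋂ b, (MinTensor.tmulCLM b) ⁻¹'
        (M.topologicalClosure : Set (MinTensor (CircleFreeProduct I) (CircleFreeProduct I))) := by
      ext x
      rw [SetLike.mem_coe, hT, Set.mem_iInter]
      rfl
    rw [this]
    exact isClosed_iInter fun b => M.isClosed_topologicalClosure.preimage (map_continuous _)
  · rw [hT]
    exact fun b => Submodule.le_topologicalClosure _
      (Submodule.subset_span ⟨1, b, by rw [map_one, one_mul]⟩)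
  · obtain ⟨h1, h2⟩ := letter_props y
    rw [hT] at hc ⊢
    intro b
    have h3 : MinTensor.tmul b (mk (FreeStarAlgebra.letter y) * c) =
        comul (mk (FreeStarAlgebra.letter y)) *
          MinTensor.tmul (star (mk (FreeStarAlgebra.letter y)) * b) c := by
      rw [h1, MinTensor.tmul_mul_tmul, ← mul_assoc, h2, one_mul]
    rw [h3]
    refine mul_mem_closure _ (fun w hw => ?_) _ (hc _)
    induction hw using Submodule.span_induction with
    | mem w hw =>
      obtain ⟨a, b, rfl⟩ := hw
      exact Submodule.subset_span ⟨_ * a, b, by rw [map_mul, mul_assoc]⟩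
    | zero => rw [mul_zero]; exact Submodule.zero_mem _
    | add w w' _ _ hw hw' => rw [mul_add]; exact Submodule.add_mem _ hw hw'
    | smul r w _ hw => rw [mul_smul_comm]; exact Submodule.smul_mem _ r hw

end CircleFreeProduct

/-- The free product of copies of `C(S¹)` indexed by `I`, as a compact quantum group with
`Δ(z i) = z i ⊗ z i`. -/
def circleFreeProductCQG (I : Type u) : CompactQuantumGroup.{u} where
  carrier := CircleFreeProduct I
  comul := CircleFreeProduct.comul
  coassoc := CircleFreeProduct.coassoc
  dense_one_tmul := CircleFreeProduct.dense_one_tmul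
  dense_tmul_one := CircleFreeProduct.dense_tmul_one

/-! ### Directed graphs -/

/-- A directed graph (loops and multiple edges allowed) with vertex set `V`, edge set `E`,
source map `src` and range map `rng`. -/
structure DirectedGraph (V E : Type u) where
  src : E → V
  rng : E → V

namespace DirectedGraph

variable {V E : Type u} (Γ : DirectedGraph V E)

/-- Every vertex is the source or the range of an edge. -/
def IsConnected : Prop := ∀ v, (∃ e, Γ.src e = v) ∨ ∃ e, Γ.rng e = v

/-- `l` is the list of edges of a path starting at `v` (of length `l.length`, possibly `0`). -/
def IsPathFrom : V → List E → Prop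
  | _, [] => True
  | v, e :: l => Γ.src e = v ∧ IsPathFrom (Γ.rng e) l

/-- The vertices visited by a path starting at `v`. -/
def pathVertices (v : V) (l : List E) : List V := v :: l.map Γ.rng

/-- `l` is a cycle: a path of positive length whose range is its source, and whose edges
have pairwise distinct sources. -/
def IsCycle (l : List E) : Prop :=
  l ≠ [] ∧ (∃ v, Γ.IsPathFrom v l ∧ (Γ.pathVertices v l).getLast? = some v) ∧
    (l.map Γ.src).Nodup

/-- Property (R). -/
structure PropertyR [Fintype V] : Prop where
  /-- There is no cycle of length at least `2`. -/
  no_cycle : ∀ l : List E, 2 ≤ l.length → ¬ Γ.IsCycle l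
  /-- There is a path of length `|V| - 1` through all vertices. -/
  exists_path : ∃ (v : V) (l : List E), Γ.IsPathFrom v l ∧ l.length + 1 = Fintype.card V ∧
    ∀ w, w ∈ Γ.pathVertices v l
  /-- There is at most one edge from a given vertex to a given vertex. -/
  edge_unique : ∀ e f, Γ.src e = Γ.src f → Γ.rng e = Γ.rng f → e = f

end DirectedGraph

/-! ### Graph C*-algebras -/

open Classical in
/-- Partial isometries `S e` and mutually orthogonal projections `p v` with sum `1` which satisfy
`S_e* S_e = p_{r(e)}`, and `p_v = ∑_{s(f) = v} S_f S_f*` for each `v` which is not a sink. -/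
structure IsCuntzKriegerFamily {V E : Type u} [Fintype V] [Fintype E] (Γ : DirectedGraph V E)
    {B : Type*} [Ring B] [StarRing B] (S : E → B) (p : V → B) : Prop where
  partial_isometry : ∀ e, S e * star (S e) * S e = S e
  idempotent : ∀ v, p v * p v = p v
  self_adjoint : ∀ v, star (p v) = p v
  orthogonal : ∀ v w, v ≠ w → p v * p w = 0
  sum_eq_one : ∑ v, p v = 1
  star_mul_self : ∀ e, star (S e) * S e = p (Γ.rng e)
  sum_mul_star : ∀ v, (∃ f, Γ.src f = v) → p v = ∑ f with Γ.src f = v, S f * star (S f)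

section GraphAlgebra

variable {V E : Type u} [Fintype V] [Fintype E] (Γ : DirectedGraph V E)

open FreeStarAlgebra in
open Classical in
/-- The defining relations of the graph C*-algebra, in the letters `S e = inl e` and
`p v = inr v`. -/
inductive GraphRelator : FreeStarAlgebra (E ⊕ V) → Prop
  | partial_isometry (e : E) : GraphRelator
      (gen (.inl e) * star (gen (.inl e)) * gen (.inl e) - gen (.inl e))
  | idempotent (v : V) : GraphRelator (gen (.inr v) * gen (.inr v) - gen (.inr v))
  | self_adjoint (v : V) : GraphRelator (star (gen (.inr v)) - gen (.inr v))
  | orthogonal (v w : V) (h : v ≠ w) : GraphRelator (gen (.inr v) * gen (.inr w))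
  | sum_eq_one : GraphRelator ((∑ v : V, gen (.inr v)) - 1)
  | star_mul_self (e : E) : GraphRelator
      (star (gen (.inl e)) * gen (.inl e) - gen (.inr (Γ.rng e)))
  | sum_mul_star (v : V) (h : ∃ f, Γ.src f = v) : GraphRelator
      (gen (.inr v) - ∑ f with Γ.src f = v, gen (.inl f) * star (gen (.inl f)))

/-- The graph C*-algebra `C*(Γ)`: the universal C*-algebra generated by partial isometries `S e`
and mutually orthogonal projections `p v` subject to the Cuntz-Krieger relations. Its unit is
`∑ v, p v`. -/
def GraphCStarAlgebra : Type u := UniversalCStarAlgebra {r | GraphRelator Γ r}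

namespace GraphCStarAlgebra

instance : CStarAlgebra (GraphCStarAlgebra Γ) :=
  inferInstanceAs (CStarAlgebra (UniversalCStarAlgebra {r | GraphRelator Γ r}))

/-- The canonical map from the free `*`-algebra. -/
def mk : FreeStarAlgebra (E ⊕ V) →⋆ₐ[ℂ] GraphCStarAlgebra Γ :=
  UniversalCStarAlgebra.mk {r | GraphRelator Γ r}

/-- The generating partial isometries. -/
def S (e : E) : GraphCStarAlgebra Γ := mk Γ (FreeStarAlgebra.gen (.inl e))

/-- The generating projections. -/
def p (v : V) : GraphCStarAlgebra Γ := mk Γ (FreeStarAlgebra.gen (.inr v))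

theorem isCuntzKriegerFamily : IsCuntzKriegerFamily Γ (S Γ) (p Γ) := by
  have h : ∀ r, GraphRelator Γ r → mk Γ r = 0 := fun r hr => UniversalCStarAlgebra.mk_eq_zero _ hr
  refine ⟨fun e => ?_, fun v => ?_, fun v => ?_, fun v w hvw => ?_, ?_, fun e => ?_, fun v hv => ?_⟩
  · simpa [S, p, map_star, sub_eq_zero] using h _ (.partial_isometry e)
  · simpa [S, p, map_star, sub_eq_zero] using h _ (.idempotent v)
  · simpa [S, p, map_star, sub_eq_zero] using h _ (.self_adjoint v)
  · simpa [S, p, map_star, sub_eq_zero] using h _ (.orthogonal v w hvw)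
  · simpa [p, sub_eq_zero] using h _ .sum_eq_one
  · simpa [S, p, map_star, sub_eq_zero] using h _ (.star_mul_self e)
  · simpa [S, p, map_star, sub_eq_zero] using h _ (.sum_mul_star v hv)

variable {Γ} in
/-- The universal property of the graph C*-algebra. -/
def lift {B : Type*} [CStarAlgebra B] {T : E → B} {q : V → B}
    (h : IsCuntzKriegerFamily Γ T q) : GraphCStarAlgebra Γ →⋆ₐ[ℂ] B :=
  UniversalCStarAlgebra.lift _ (Sum.elim T q)
    (by
      have hq : ∀ v, ‖q v‖ ≤ 1 := fun v => by
        have h1 := CStarRing.norm_star_mul_self (x := q v)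
        rw [h.self_adjoint, h.idempotent] at h1
        nlinarith [norm_nonneg (q v)]
      rintro (e | v)
      · have h1 := CStarRing.norm_star_mul_self (x := T e)
        rw [h.star_mul_self] at h1
        have h2 := hq (Γ.rng e)
        change ‖T e‖ ≤ 1
        nlinarith [norm_nonneg (T e)]
      · exact hq v)
    (by
      rintro r (e | v | v | ⟨v, w, hvw⟩ | _ | e | ⟨v, hv⟩)
      · simp [map_star, h.partial_isometry]
      · simp [h.idempotent]
      · simp [map_star, h.self_adjoint]
      · simp [h.orthogonal v w hvw]
      · simp [h.sum_eq_one]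
      · simp [map_star, h.star_mul_self]
      · simp [map_star, h.sum_mul_star v hv])

@[simp] theorem lift_S {B : Type*} [CStarAlgebra B] {T : E → B} {q : V → B}
    (h : IsCuntzKriegerFamily Γ T q) (e : E) : lift h (S Γ e) = T e :=
  UniversalCStarAlgebra.lift_of _ _ _ _ _

@[simp] theorem lift_p {B : Type*} [CStarAlgebra B] {T : E → B} {q : V → B}
    (h : IsCuntzKriegerFamily Γ T q) (v : V) : lift h (p Γ v) = q v :=
  UniversalCStarAlgebra.lift_of _ _ _ _ _

end GraphCStarAlgebra

/-! ### The category of linear actions on a graph C*-algebra preserving `τ` -/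

open GraphCStarAlgebra

/-- The space `V_{2,+}`: the span of the `p u`, for `u` not the source of any edge, and of the
`S_e S_f*` with `r(e) = r(f)`. -/
def V2plus : Submodule ℂ (GraphCStarAlgebra Γ) :=
  Submodule.span ℂ ({x | ∃ u, (¬ ∃ e, Γ.src e = u) ∧ x = p Γ u} ∪
    {x | ∃ e f, Γ.rng e = Γ.rng f ∧ x = S Γ e * star (S Γ f)})

variable {Γ} in
/-- `τ` is the linear functional on `V_{2,+}` with `τ(S_e S_f*) = δ_{ef}` and `τ(p_u) = 1`.
(There is exactly one: the spanning set defining `V_{2,+}` is linearly independent.) -/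
structure IsTau (τ : V2plus Γ →ₗ[ℂ] ℂ) : Prop where
  apply_self : ∀ (x : V2plus Γ) (e : E), (x : GraphCStarAlgebra Γ) = S Γ e * star (S Γ e) →
    τ x = 1
  apply_ne : ∀ (x : V2plus Γ) (e f : E), Γ.rng e = Γ.rng f → e ≠ f →
    (x : GraphCStarAlgebra Γ) = S Γ e * star (S Γ f) → τ x = 0
  apply_p : ∀ (x : V2plus Γ) (u : V), (¬ ∃ e, Γ.src e = u) →
    (x : GraphCStarAlgebra Γ) = p Γ u → τ x = 1

variable {Γ} in
/-- The action is linear: `α(S_e) = ∑_f S_f ⊗ q_{fe}` for some elements `q_{fe}`. -/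
def IsLinearAction (U : QuantumTransformationGroup (GraphCStarAlgebra Γ)) : Prop :=
  ∃ q : E → E → U.cqg.carrier, ∀ e, U.action (S Γ e) = ∑ f, MinTensor.tmul (S Γ f) (q f e)

variable {Γ} in
/-- The action preserves `τ`, that is, `(τ ⊗ id) ∘ α = τ(·) 1` on `V_{2,+}`: every `α(x)`,
`x ∈ V_{2,+}`, is (the image of) an element `t` of the algebraic tensor product `V_{2,+} ⊗ Q`
with `(τ ⊗ id)(t) = τ(x) 1`. -/
def PreservesTau (U : QuantumTransformationGroup (GraphCStarAlgebra Γ)) : Prop :=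
  ∃ τ : V2plus Γ →ₗ[ℂ] ℂ, IsTau τ ∧ ∀ x : V2plus Γ, ∃ t : V2plus Γ ⊗[ℂ] U.cqg.carrier,
    MinTensor.ofAlgebraic _ _ (TensorProduct.map (V2plus Γ).subtype LinearMap.id t) =
        U.action (x : GraphCStarAlgebra Γ) ∧
      TensorProduct.lid ℂ U.cqg.carrier (TensorProduct.map τ LinearMap.id t) =
        τ x • (1 : U.cqg.carrier)

/-- The objects of the category of quantum transformation groups of `C*(Γ)` which act linearly
and preserve `τ`. -/
def IsLinTauObject (U : QuantumTransformationGroup (GraphCStarAlgebra Γ)) : Prop :=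
  IsLinearAction U ∧ PreservesTau U

end GraphAlgebra

end

/-! Let `α` be a linear action preserving `τ`, with `α(S_e) = ∑ S_g ⊗ q g e`. The vertices can be
ordered along the path through all of them so that no edge goes down, and then `α(p_w)` is of the
form `∑ p_v ⊗ P v w` with projections `P v w`. The relations between `q` and `P` which express that
`α` is a `*`-homomorphism preserving `τ` show, by induction from the last vertex downwards, that `P`
is the identity matrix. As there are no multiple edges, `q` is then diagonal, so that
`α(S_e) = S_e ⊗ u_e` for unitaries `u_e`, which are group-like by coassociativity. Hence the
diagonal action `S_e ↦ S_e ⊗ z_e` of the free product of circles is universal. Two universal objects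
are isomorphic since the only endomorphism of a quantum group compatible with a faithful action is
the identity. -/

noncomputable section

open scoped TensorProduct
open UniformSpace (Completion)

/-! ### States and representations of C*-algebras -/

section States

open scoped ComplexOrder

section UnitalContractive

variable {A : Type*} [CStarAlgebra A]

theorem norm_add_mul_I_smul_one_sq_le {b : A} (hb : IsSelfAdjoint b) (t : ℝ) :
    ‖b + (t * Complex.I) • (1 : A)‖ ^ 2 ≤ ‖b‖ ^ 2 + t ^ 2 := by
  have hsq : star (b + (t * Complex.I) • (1 : A)) * (b + (t * Complex.I) • (1 : A)) =
      star b * b + ((t : ℂ) ^ 2) • (1 : A) := by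
    have hstar : star (t * Complex.I : ℂ) = -(t * Complex.I) := by simp
    have hmul : (t * Complex.I * (t * Complex.I) : ℂ) = -(t : ℂ) ^ 2 := by
      linear_combination (t : ℂ) ^ 2 * Complex.I_sq
    rw [star_add, star_smul, star_one, hb.star_eq, hstar, neg_smul, add_mul, neg_mul, smul_one_mul,
      mul_add, smul_add, mul_smul_one, smul_smul, hmul, neg_smul]
    abel
  calc ‖b + (t * Complex.I) • (1 : A)‖ ^ 2 = ‖star b * b + ((t : ℂ) ^ 2) • (1 : A)‖ := by
        rw [sq, ← CStarRing.norm_star_mul_self, hsq]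
    _ ≤ ‖star b * b‖ + ‖((t : ℂ) ^ 2) • (1 : A)‖ := norm_add_le _ _
    _ ≤ ‖b‖ ^ 2 + t ^ 2 := by
        rw [CStarRing.norm_star_mul_self, ← sq, norm_smul, norm_pow, Complex.norm_real,
          Real.norm_eq_abs, sq_abs]
        gcongr
        exact mul_le_of_le_one_right (sq_nonneg t) CStarAlgebra.norm_one_le

theorem im_apply_eq_zero_of_isSelfAdjoint {f : A →L[ℂ] ℂ} (hf : ‖f‖ ≤ 1) (h1 : f 1 = 1) {b : A}
    (hb : IsSelfAdjoint b) : (f b).im = 0 := by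
  have key (t : ℝ) : ((f b).im + t) ^ 2 ≤ ‖b‖ ^ 2 + t ^ 2 := by
    have him : (f b).im + t = (f (b + (t * Complex.I) • (1 : A))).im := by simp [h1]
    calc ((f b).im + t) ^ 2 ≤ ‖f (b + (t * Complex.I) • (1 : A))‖ ^ 2 := by
          rw [him, ← sq_abs]
          gcongr
          exact Complex.abs_im_le_norm _
      _ ≤ ‖b + (t * Complex.I) • (1 : A)‖ ^ 2 := by
          gcongr
          exact f.le_of_opNorm_le_of_le hf le_rfl |>.trans_eq (one_mul _)
      _ ≤ ‖b‖ ^ 2 + t ^ 2 := norm_add_mul_I_smul_one_sq_le hb t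
  by_contra hne
  have ht := key ((‖b‖ ^ 2 + 1) / (2 * (f b).im))
  have hmul : 2 * (f b).im * ((‖b‖ ^ 2 + 1) / (2 * (f b).im)) = ‖b‖ ^ 2 + 1 := by
    field_simp
  nlinarith [sq_nonneg (f b).im]

theorem apply_nonneg_of_norm_le_one [PartialOrder A] [StarOrderedRing A] {f : A →L[ℂ] ℂ}
    (hf : ‖f‖ ≤ 1) (h1 : f 1 = 1) {b : A} (hb : 0 ≤ b) : 0 ≤ f b := by
  have hsa : IsSelfAdjoint b := .of_nonneg hb
  refine Complex.nonneg_iff.2 ⟨?_, (im_apply_eq_zero_of_isSelfAdjoint hf h1 hsa).symm⟩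
  have hdist : ‖algebraMap ℝ A ‖b‖ - b‖ ≤ ‖b‖ :=
    (CStarAlgebra.norm_le_iff_le_algebraMap _ (norm_nonneg b)
      (sub_nonneg.2 hsa.le_algebraMap_norm_self)).2 (sub_le_self _ hb)
  have hf_dist : ‖f (algebraMap ℝ A ‖b‖ - b)‖ ≤ ‖b‖ :=
    (f.le_of_opNorm_le_of_le hf hdist).trans_eq (one_mul _)
  have hre : (f (algebraMap ℝ A ‖b‖ - b)).re = ‖b‖ - (f b).re := by
    rw [map_sub, Algebra.algebraMap_eq_smul_one, ← Complex.coe_smul ‖b‖ (1 : A), map_smul, h1]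
    simp
  have hle := (Complex.re_le_norm _).trans hf_dist
  rw [hre] at hle
  linarith

end UnitalContractive

variable {A : Type*} [CStarAlgebra A]

theorem exists_positive_functional_eq_norm [PartialOrder A] [StarOrderedRing A] {a : A}
    (ha : 0 ≤ a) : ∃ f : A →ₚ[ℂ] ℂ, f a = ‖a‖ ∧ ‖f 1‖ ≤ 1 := by
  rcases subsingleton_or_nontrivial A with hA | hA
  · exact ⟨0, by simp [Subsingleton.elim a 0], by simp⟩
  -- A character of the commutative algebra generated by `a` attains the norm of `a`;
  -- extend it by Hahn-Banach.
  let S : StarSubalgebra ℂ A := StarAlgebra.elemental ℂ a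
  have hS : IsClosed (S : Set A) := StarAlgebra.elemental.isClosed ℂ a
  let a' : S := ⟨a, StarAlgebra.elemental.self_mem ℂ a⟩
  have hn : IsStarNormal a := (IsSelfAdjoint.of_nonneg ha).isStarNormal
  have hspec : ((‖a‖ : ℝ) : ℂ) ∈ spectrum ℂ a' := by
    rw [StarSubalgebra.mem_spectrum_iff]
    have h := CStarAlgebra.norm_mem_spectrum_of_nonneg ha
    rwa [← spectrum.algebraMap_mem_iff ℂ] at h
  obtain ⟨χ, hχ⟩ := WeakDual.CharacterSpace.mem_spectrum_iff_exists.1 hspec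
  obtain ⟨g, hg, hgn⟩ := exists_extension_norm_eq (𝕜 := ℂ) S.toSubalgebra.toSubmodule
    (WeakDual.toStrongDual (χ : WeakDual ℂ S))
  have hg1 : g 1 = 1 := (hg (1 : S)).trans (map_one χ)
  have hga : g a = ‖a‖ := (hg a').trans hχ
  have hgn1 : ‖g‖ ≤ 1 := by
    rw [hgn]
    refine ContinuousLinearMap.opNorm_le_bound _ zero_le_one fun x => ?_
    rw [one_mul]
    have hx := spectrum.norm_le_norm_of_mem
      (AlgHom.apply_mem_spectrum (χ : WeakDual.characterSpace ℂ S) (show S from x))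
    exact hx
  refine ⟨PositiveLinearMap.mk₀ (g : A →ₗ[ℂ] ℂ)
    fun x hx => apply_nonneg_of_norm_le_one hgn1 hg1 hx, hga, ?_⟩
  change ‖g 1‖ ≤ 1
  rw [hg1, norm_one]

theorem exists_rep_norm_le {A : Type u} [CStarAlgebra A] (a : A) :
    ∃ (H : Type u) (_ : NormedAddCommGroup H) (_ : InnerProductSpace ℂ H) (_ : CompleteSpace H)
      (π : A →⋆ₐ[ℂ] (H →L[ℂ] H)), ‖a‖ ≤ ‖π a‖ := by
  let _ := CStarAlgebra.spectralOrder A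
  let _ := CStarAlgebra.spectralOrderedRing A
  obtain ⟨f, hf, hf1⟩ := exists_positive_functional_eq_norm (star_mul_self_nonneg a)
  refine ⟨f.GNS, inferInstance, inferInstance, inferInstance, f.gnsStarAlgHom, ?_⟩
  let ζ : f.GNS := ((f.toPreGNS 1 : f.PreGNS) : Completion f.PreGNS)
  have hζ : ‖ζ‖ ≤ 1 := by
    rw [← sq_le_one_iff₀ (norm_nonneg ζ), Completion.norm_coe, PositiveLinearMap.preGNS_norm_def]
    simp only [PositiveLinearMap.ofPreGNS_toPreGNS, star_one, mul_one]
    rw [Real.sq_sqrt']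
    exact max_le ((Complex.re_le_norm _).trans hf1) zero_le_one
  have ha : ‖f.gnsStarAlgHom a ζ‖ = ‖a‖ := by
    have haζ : f.gnsStarAlgHom a ζ = ((f.toPreGNS a : f.PreGNS) : Completion f.PreGNS) := by
      simp [ζ]
    rw [haζ, Completion.norm_coe, PositiveLinearMap.preGNS_norm_def]
    simp only [PositiveLinearMap.ofPreGNS_toPreGNS]
    rw [hf, Complex.ofReal_re, CStarRing.norm_star_mul_self, Real.sqrt_mul_self (norm_nonneg a)]
  calc ‖a‖ = ‖f.gnsStarAlgHom a ζ‖ := ha.symm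
    _ ≤ ‖f.gnsStarAlgHom a‖ := ContinuousLinearMap.unit_le_opNorm _ _ hζ

end States

/-! ### Continuity and closed range of `*`-homomorphisms -/

section Range

variable {A B : Type*} [CStarAlgebra A] [CStarAlgebra B]

theorem continuous_starAlgHom (φ : A →⋆ₐ[ℂ] B) : Continuous φ :=
  AddMonoidHomClass.continuous_of_bound φ 1 (by simpa using NonUnitalStarAlgHom.norm_apply_le φ)

theorem exists_norm_le_of_isSelfAdjoint (φ : A →⋆ₐ[ℂ] B) {a : A} (ha : IsSelfAdjoint a) :
    ∃ a', φ a' = φ a ∧ ‖a'‖ ≤ ‖φ a‖ := by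
  -- Cut the spectrum of `a` off at `‖φ a‖`.
  let f : ℝ → ℝ := fun t => max (-‖φ a‖) (min ‖φ a‖ t)
  have hf : Continuous f := by fun_prop
  refine ⟨cfc f a, ?_, ?_⟩
  · rw [StarAlgHomClass.map_cfc (S := ℂ) φ f a hf.continuousOn (continuous_starAlgHom φ) ha
      (ha.map φ)]
    conv_rhs => rw [← cfc_id' ℝ (φ a) (ha.map φ)]
    refine cfc_congr fun t ht => ?_
    have h1 : ‖t‖ ≤ ‖φ a‖ := (spectrum.norm_le_norm_mul_of_mem ht).trans
      (mul_le_of_le_one_right (norm_nonneg _) CStarAlgebra.norm_one_le)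
    rw [Real.norm_eq_abs, abs_le] at h1
    change max _ (min _ t) = t
    rw [min_eq_right h1.2, max_eq_right h1.1]
  · refine norm_cfc_le (norm_nonneg _) fun t _ => ?_
    rw [Real.norm_eq_abs, abs_le]
    exact ⟨le_max_left _ _, max_le (by linarith [norm_nonneg (φ a)]) (min_le_left _ _)⟩

theorem exists_norm_le_two_mul (φ : A →⋆ₐ[ℂ] B) (a : A) : ∃ a', φ a' = φ a ∧ ‖a'‖ ≤ 2 * ‖φ a‖ := by
  obtain ⟨x, hx, hxn⟩ := exists_norm_le_of_isSelfAdjoint φ (realPart a).2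
  obtain ⟨y, hy, hyn⟩ := exists_norm_le_of_isSelfAdjoint φ (imaginaryPart a).2
  rw [map_realPart] at hx hxn
  rw [map_imaginaryPart] at hy hyn
  refine ⟨x + Complex.I • y, ?_, ?_⟩
  · rw [map_add, map_smul, hx, hy, realPart_add_I_smul_imaginaryPart]
  · calc ‖x + Complex.I • y‖ ≤ ‖x‖ + ‖y‖ := by
          simpa [norm_smul] using norm_add_le x (Complex.I • y)
      _ ≤ ‖φ a‖ + ‖φ a‖ :=
          add_le_add (hxn.trans (realPart.norm_le (φ a))) (hyn.trans (imaginaryPart.norm_le (φ a)))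
      _ = 2 * ‖φ a‖ := (two_mul _).symm

theorem isClosed_range_starAlgHom (φ : A →⋆ₐ[ℂ] B) : IsClosed (Set.range φ) := by
  let f : NormedAddGroupHom A B := AddMonoidHom.mkNormedAddGroupHom (φ : A →+ B) 1
    (by simpa using NonUnitalStarAlgHom.norm_apply_le φ)
  have hlift : f.SurjectiveOnWith f.range 2 := by
    rintro _ ⟨a, rfl⟩
    exact exists_norm_le_two_mul φ a
  refine isClosed_of_closure_subset fun b hb => ?_
  obtain ⟨a, ha, -⟩ := controlled_closure_of_complete zero_lt_two zero_lt_one hlift b hb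
  exact ⟨a, ha⟩

end Range

/-! ### Projections with sum one -/

section Projections

variable {B : Type*} [CStarAlgebra B] {ι : Type*} {s : Finset ι}

theorem eq_zero_of_sum_star_mul_self_eq_zero {a : ι → B}
    (h : ∑ i ∈ s, star (a i) * a i = 0) {i : ι} (hi : i ∈ s) : a i = 0 := by
  let _ := CStarAlgebra.spectralOrder B
  let _ := CStarAlgebra.spectralOrderedRing B
  rw [Finset.sum_eq_zero_iff_of_nonneg fun i _ => star_mul_self_nonneg (a i)] at h
  exact (CStarRing.star_mul_self_eq_zero_iff _).1 (h i hi)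

theorem eq_zero_of_sum_mul_star_self_eq_zero {a : ι → B}
    (h : ∑ i ∈ s, a i * star (a i) = 0) {i : ι} (hi : i ∈ s) : a i = 0 :=
  star_eq_zero.1 <| eq_zero_of_sum_star_mul_self_eq_zero (a := fun i => star (a i))
    (by simpa using h) hi

theorem eq_zero_of_sum_isStarProjection_eq_zero {p : ι → B}
    (hp : ∀ i ∈ s, IsStarProjection (p i)) (h : ∑ i ∈ s, p i = 0) {i : ι} (hi : i ∈ s) :
    p i = 0 := by
  refine eq_zero_of_sum_star_mul_self_eq_zero (a := p) (h ▸ Finset.sum_congr rfl fun j hj => ?_) hi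
  rw [(hp j hj).isSelfAdjoint.star_eq, (hp j hj).isIdempotentElem]

theorem mul_eq_zero_of_sum_isStarProjection_eq_one {p : ι → B}
    (hp : ∀ i ∈ s, IsStarProjection (p i)) (h : ∑ i ∈ s, p i = 1) {i j : ι} (hi : i ∈ s)
    (hj : j ∈ s) (hij : i ≠ j) : p i * p j = 0 := by
  classical
  have hpj := (hp j hj).isIdempotentElem.eq
  have hconj : ∀ k ∈ s.erase j, star (p k * p j) * (p k * p j) = p j * p k * p j := by
    intro k hk
    have hk := hp k (Finset.mem_of_mem_erase hk)
    rw [star_mul, hk.isSelfAdjoint.star_eq, (hp j hj).isSelfAdjoint.star_eq, mul_assoc,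
      ← mul_assoc (p k), hk.isIdempotentElem.eq, mul_assoc]
  have hsum : ∑ k ∈ s.erase j, p k = 1 - p j := by
    rw [← h, Finset.sum_erase_eq_sub hj]
  refine eq_zero_of_sum_star_mul_self_eq_zero (s := s.erase j) (a := fun i => p i * p j) ?_
    (Finset.mem_erase.2 ⟨hij, hi⟩)
  rw [Finset.sum_congr rfl hconj, ← Finset.sum_mul, ← Finset.mul_sum, hsum, mul_sub, mul_one, hpj,
    sub_self, zero_mul]

end Projections

/-! ### Slice maps on the minimal tensor product -/

namespace MinTensor

section HilbertTensor

variable {H K : Type u} [NormedAddCommGroup H] [InnerProductSpace ℂ H]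
  [NormedAddCommGroup K] [InnerProductSpace ℂ K]

theorem inner_toHilbertTensor (ξ ξ' : H) (η η' : K) :
    inner ℂ (toHilbertTensor (ξ ⊗ₜ[ℂ] η)) (toHilbertTensor (ξ' ⊗ₜ[ℂ] η')) =
      inner ℂ ξ ξ' * inner ℂ η η' := by
  rw [LinearIsometry.inner_map_map, TensorProduct.inner_tmul]

theorem norm_toHilbertTensor_tmul (ξ : H) (η : K) :
    ‖toHilbertTensor (ξ ⊗ₜ[ℂ] η)‖ = ‖ξ‖ * ‖η‖ := by
  rw [LinearIsometry.norm_map, TensorProduct.norm_tmul]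

end HilbertTensor

section Rep

variable {A B C : Type u} [CStarAlgebra A] [CStarAlgebra B] [CStarAlgebra C]
variable {H K L : Type u} [NormedAddCommGroup H] [InnerProductSpace ℂ H] [CompleteSpace H]
  [NormedAddCommGroup K] [InnerProductSpace ℂ K] [CompleteSpace K]
  [NormedAddCommGroup L] [InnerProductSpace ℂ L] [CompleteSpace L]

theorem norm_tensorRep_le (π : A →⋆ₐ[ℂ] (H →L[ℂ] H)) (σ : B →⋆ₐ[ℂ] (K →L[ℂ] K))
    (x : A ⊗[ℂ] B) : ‖tensorRep π σ x‖ ≤ minSeminorm A B x :=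
  CStarSeminorm.le_sup spatialSeminorms_bddAbove (p := CStarSeminorm.ofHom (tensorRep π σ))
    ⟨H, K, _, _, _, _, _, _, π, σ, rfl⟩ x

/-- The representation `π ⊗ σ` of the minimal tensor product. -/
def rep (π : A →⋆ₐ[ℂ] (H →L[ℂ] H)) (σ : B →⋆ₐ[ℂ] (K →L[ℂ] K)) :
    MinTensor A B →⋆ₐ[ℂ] (HilbertTensor H K →L[ℂ] HilbertTensor H K) :=
  (minSeminorm A B).lift (tensorRep π σ) (norm_tensorRep_le π σ)

theorem rep_ofAlgebraic (π : A →⋆ₐ[ℂ] (H →L[ℂ] H)) (σ : B →⋆ₐ[ℂ] (K →L[ℂ] K))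
    (x : A ⊗[ℂ] B) : rep π σ (ofAlgebraic A B x) = tensorRep π σ x :=
  CStarSeminorm.lift_toCompletion _ _ _ _

theorem rep_tmul (π : A →⋆ₐ[ℂ] (H →L[ℂ] H)) (σ : B →⋆ₐ[ℂ] (K →L[ℂ] K)) (a : A) (b : B) :
    rep π σ (tmul a b) = hilbertTensorOp (π a) (σ b) :=
  rep_ofAlgebraic π σ _

theorem eq_zero_of_rep_eq_zero {x : MinTensor A B}
    (h : ∀ (H K : Type u) [NormedAddCommGroup H] [InnerProductSpace ℂ H] [CompleteSpace H]
      [NormedAddCommGroup K] [InnerProductSpace ℂ K] [CompleteSpace K]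
      (π : A →⋆ₐ[ℂ] (H →L[ℂ] H)) (σ : B →⋆ₐ[ℂ] (K →L[ℂ] K)), rep π σ x = 0) : x = 0 := by
  rw [← norm_le_zero_iff]
  refine le_of_forall_pos_le_add fun ε hε => ?_
  obtain ⟨t, ht⟩ := (denseRange_ofAlgebraic (A := A) (B := B)).exists_dist_lt x (half_pos hε)
  rw [dist_eq_norm] at ht
  have h1 : ‖ofAlgebraic A B t‖ ≤ ε / 2 := by
    refine ((minSeminorm A B).norm_toCompletion t).trans_le ?_
    refine CStarSeminorm.sup_le _ (half_pos hε).le ?_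
    rintro p ⟨H, K, _, _, _, _, _, _, π, σ, rfl⟩
    rw [CStarSeminorm.ofHom_apply, ← rep_ofAlgebraic]
    have h2 := NonUnitalStarAlgHom.norm_apply_le (rep π σ) (x - ofAlgebraic A B t)
    rw [map_sub, h, zero_sub, norm_neg] at h2
    exact h2.trans ht.le
  calc ‖x‖ = ‖(x - ofAlgebraic A B t) + ofAlgebraic A B t‖ := by rw [sub_add_cancel]
    _ ≤ ε / 2 + ε / 2 := (norm_add_le _ _).trans (add_le_add ht.le h1)
    _ = 0 + ε := by ring

theorem eq_zero_of_inner_toHilbertTensor_eq_zero {T : HilbertTensor H K →L[ℂ] HilbertTensor H K}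
    (h : ∀ ξ ξ' : H, ∀ η η' : K,
      inner ℂ (toHilbertTensor (ξ ⊗ₜ[ℂ] η)) (T (toHilbertTensor (ξ' ⊗ₜ[ℂ] η'))) = 0) : T = 0 := by
  refine hilbert_ext fun x => ?_
  rw [zero_apply]
  induction x with
  | zero => simp
  | add x y hx hy => rw [map_add, map_add, hx, hy, add_zero]
  | tmul ξ' η' =>
    refine ext_inner_left ℂ fun v => ?_
    rw [inner_zero_right]
    refine denseRange_toHilbertTensor.induction_on v (isClosed_eq (by fun_prop) (by fun_prop))
      fun y => ?_
    induction y with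
    | zero => simp
    | add y z hy hz => rw [map_add, inner_add_left, hy, hz, add_zero]
    | tmul ξ η => exact h ξ ξ' η η'

/-- The functional `a ↦ ⟪ξ, π(a) ξ'⟫`. -/
def vectorFunctional (π : A →⋆ₐ[ℂ] (H →L[ℂ] H)) (ξ ξ' : H) : A →L[ℂ] ℂ :=
  innerSL ℂ ξ ∘L ContinuousLinearMap.apply ℂ H ξ' ∘L
    ⟨(π : A →ₗ[ℂ] (H →L[ℂ] H)), continuous_starAlgHom π⟩

theorem vectorFunctional_apply (π : A →⋆ₐ[ℂ] (H →L[ℂ] H)) (ξ ξ' : H) (a : A) :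
    vectorFunctional π ξ ξ' a = inner ℂ ξ (π a ξ') := rfl

/-- The slice map `θ ⊗ id` on the algebraic tensor product. -/
def algSlice (θ : A →L[ℂ] ℂ) : A ⊗[ℂ] B →ₗ[ℂ] B :=
  (TensorProduct.lid ℂ B).toLinearMap ∘ₗ TensorProduct.map θ.toLinearMap LinearMap.id

theorem algSlice_tmul (θ : A →L[ℂ] ℂ) (a : A) (b : B) : algSlice θ (a ⊗ₜ[ℂ] b) = θ a • b := by
  simp [algSlice]

theorem inner_rep_algSlice (π : A →⋆ₐ[ℂ] (H →L[ℂ] H)) (σ : B →⋆ₐ[ℂ] (K →L[ℂ] K)) (ξ ξ' : H)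
    (η η' : K) (x : A ⊗[ℂ] B) :
    inner ℂ η (σ (algSlice (vectorFunctional π ξ ξ') x) η') =
      inner ℂ (toHilbertTensor (ξ ⊗ₜ[ℂ] η)) (tensorRep π σ x (toHilbertTensor (ξ' ⊗ₜ[ℂ] η'))) := by
  induction x with
  | zero => simp
  | add x y hx hy =>
    rw [map_add, map_add, add_apply, inner_add_right, hx, hy, map_add, add_apply, inner_add_right]
  | tmul a b =>
    rw [algSlice_tmul, map_smul, smul_apply, inner_smul_right, tensorRep_tmul, hilbertTensorOp_coe]
    exact (inner_toHilbertTensor _ _ _ _).symm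

theorem norm_inner_rep_algSlice_le (π : A →⋆ₐ[ℂ] (H →L[ℂ] H)) (σ : B →⋆ₐ[ℂ] (K →L[ℂ] K))
    (ξ ξ' : H) (η η' : K) (x : A ⊗[ℂ] B) :
    ‖inner ℂ η (σ (algSlice (vectorFunctional π ξ ξ') x) η')‖ ≤
      ‖ξ‖ * ‖ξ'‖ * minSeminorm A B x * ‖η'‖ * ‖η‖ := by
  rw [inner_rep_algSlice]
  calc _ ≤ ‖toHilbertTensor (ξ ⊗ₜ[ℂ] η)‖ *
        (‖tensorRep π σ x‖ * ‖toHilbertTensor (ξ' ⊗ₜ[ℂ] η')‖) :=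
      (norm_inner_le_norm _ _).trans (by gcongr; exact ContinuousLinearMap.le_opNorm _ _)
    _ ≤ ‖ξ‖ * ‖η‖ * (minSeminorm A B x * (‖ξ'‖ * ‖η'‖)) := by
      rw [norm_toHilbertTensor_tmul, norm_toHilbertTensor_tmul]
      gcongr
      exact norm_tensorRep_le π σ x
    _ = ‖ξ‖ * ‖ξ'‖ * minSeminorm A B x * ‖η'‖ * ‖η‖ := by ring

theorem norm_algSlice_le (π : A →⋆ₐ[ℂ] (H →L[ℂ] H)) (ξ ξ' : H) (x : A ⊗[ℂ] B) :
    ‖algSlice (vectorFunctional π ξ ξ') x‖ ≤ ‖ξ‖ * ‖ξ'‖ * minSeminorm A B x := by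
  obtain ⟨K, _, _, _, σ, hσ⟩ := exists_rep_norm_le (algSlice (vectorFunctional π ξ ξ') x)
  have : 0 ≤ minSeminorm A B x := apply_nonneg _ _
  refine hσ.trans (ContinuousLinearMap.opNorm_le_bound _ (by positivity) fun η' => ?_)
  set η := σ (algSlice (vectorFunctional π ξ ξ') x) η'
  have hη : ‖η‖ * ‖η‖ ≤ ‖ξ‖ * ‖ξ'‖ * minSeminorm A B x * ‖η'‖ * ‖η‖ := by
    have h := norm_inner_rep_algSlice_le π σ ξ ξ' η η' x
    rwa [inner_self_eq_norm_sq_to_K, norm_pow, RCLike.norm_ofReal, abs_norm, sq] at h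
  rcases (norm_nonneg η).eq_or_lt with h0 | h0
  · rw [← h0]
    positivity
  · exact le_of_mul_le_mul_right hη h0

/-- The algebraic slice map of a vector functional, as a continuous linear map. -/
def preSlice (π : A →⋆ₐ[ℂ] (H →L[ℂ] H)) (ξ ξ' : H) : (minSeminorm A B).Pre →L[ℂ] B :=
  LinearMap.mkContinuous
    (algSlice (vectorFunctional π ξ ξ') : (minSeminorm A B).Pre →ₗ[ℂ] B) (‖ξ‖ * ‖ξ'‖)
    (fun x => norm_algSlice_le π ξ ξ' x)

/-- The slice map of a vector functional. -/
def slice (π : A →⋆ₐ[ℂ] (H →L[ℂ] H)) (ξ ξ' : H) : MinTensor A B →L[ℂ] B where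
  toFun x := (preSlice π ξ ξ').fromCompletion x
  map_add' x y := map_add (preSlice π ξ ξ').fromCompletion x y
  map_smul' c x := map_smul (preSlice π ξ ξ').fromCompletion c x
  cont := (preSlice (B := B) π ξ ξ').fromCompletion.continuous

theorem slice_ofAlgebraic (π : A →⋆ₐ[ℂ] (H →L[ℂ] H)) (ξ ξ' : H) (x : A ⊗[ℂ] B) :
    slice π ξ ξ' (ofAlgebraic A B x) = algSlice (vectorFunctional π ξ ξ') x :=
  ContinuousLinearMap.fromCompletion_apply_coe (preSlice π ξ ξ') x

theorem slice_tmul (π : A →⋆ₐ[ℂ] (H →L[ℂ] H)) (ξ ξ' : H) (a : A) (b : B) :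
    slice π ξ ξ' (tmul a b) = inner ℂ ξ (π a ξ') • b :=
  (slice_ofAlgebraic π ξ ξ' _).trans (algSlice_tmul _ _ _)

theorem isSliceMap_slice (π : A →⋆ₐ[ℂ] (H →L[ℂ] H)) (ξ ξ' : H) :
    IsSliceMap (Q := B) (vectorFunctional π ξ ξ') (slice π ξ ξ') :=
  slice_tmul π ξ ξ'

theorem apply_eq_of_assocEq {u : MinTensor (MinTensor A B) C} {v : MinTensor A (MinTensor B C)}
    (h : AssocEq u v) {F : MinTensor (MinTensor A B) C →L[ℂ] ℂ}
    {G : MinTensor A (MinTensor B C) →L[ℂ] ℂ}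
    (hFG : ∀ a b c, F (tmul (tmul a b) c) = G (tmul a (tmul b c))) : F u = G v := by
  let D : Submodule ℂ (MinTensor (MinTensor A B) C × MinTensor A (MinTensor B C)) :=
    LinearMap.eqLocus (F.comp (ContinuousLinearMap.fst ℂ _ _)).toLinearMap
      (G.comp (ContinuousLinearMap.snd ℂ _ _)).toLinearMap
  have hD : associatorGraph A B C ≤ D := by
    refine Submodule.topologicalClosure_minimal _ (Submodule.span_le.2 ?_)
      (isClosed_eq (F.comp (ContinuousLinearMap.fst ℂ _ _)).continuous
        (G.comp (ContinuousLinearMap.snd ℂ _ _)).continuous)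
    rintro _ ⟨⟨a, b, c⟩, rfl⟩
    exact hFG a b c
  exact hD h

theorem inner_eq_of_assocEq {u : MinTensor (MinTensor A B) C} {v : MinTensor A (MinTensor B C)}
    (h : AssocEq u v) (π : A →⋆ₐ[ℂ] (H →L[ℂ] H)) (σ : B →⋆ₐ[ℂ] (K →L[ℂ] K))
    (ρ : C →⋆ₐ[ℂ] (L →L[ℂ] L)) (ξ ξ' : H) (η η' : K) (ζ ζ' : L) :
    inner ℂ (toHilbertTensor (toHilbertTensor (ξ ⊗ₜ[ℂ] η) ⊗ₜ[ℂ] ζ))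
        (rep (rep π σ) ρ u (toHilbertTensor (toHilbertTensor (ξ' ⊗ₜ[ℂ] η') ⊗ₜ[ℂ] ζ'))) =
      inner ℂ (toHilbertTensor (ξ ⊗ₜ[ℂ] toHilbertTensor (η ⊗ₜ[ℂ] ζ)))
        (rep π (rep σ ρ) v (toHilbertTensor (ξ' ⊗ₜ[ℂ] toHilbertTensor (η' ⊗ₜ[ℂ] ζ')))) := by
  refine apply_eq_of_assocEq h (F := vectorFunctional (rep (rep π σ) ρ) _ _)
    (G := vectorFunctional (rep π (rep σ ρ)) _ _) fun a b c => ?_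
  simp only [vectorFunctional_apply, rep_tmul, hilbertTensorOp_coe, TensorProduct.mapL_tmul,
    inner_toHilbertTensor]
  ring

theorem eq_tmul_of_assocEq {a : A} {b : B} {c : C} {x : MinTensor B C}
    (h : AssocEq (tmul (tmul a b) c) (tmul a x)) (ha : a ≠ 0) : x = tmul b c := by
  obtain ⟨H, _, _, _, π, hπ⟩ := exists_rep_norm_le a
  obtain ⟨ξ', hξ'⟩ : ∃ ξ', π a ξ' ≠ 0 := by
    by_contra! hzero
    exact ha (norm_le_zero_iff.1 (hπ.trans_eq (norm_eq_zero.2 (ContinuousLinearMap.ext hzero))))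
  refine sub_eq_zero.1 (eq_zero_of_rep_eq_zero fun K L _ _ _ _ _ _ σ ρ =>
    eq_zero_of_inner_toHilbertTensor_eq_zero fun η η' ζ ζ' => ?_)
  have hcoeff := inner_eq_of_assocEq h π σ ρ (π a ξ') ξ' η η' ζ ζ'
  simp only [rep_tmul, hilbertTensorOp_coe, TensorProduct.mapL_tmul, inner_toHilbertTensor,
    mul_assoc] at hcoeff
  rw [map_sub, sub_apply, inner_sub_right, rep_tmul, hilbertTensorOp_coe, TensorProduct.mapL_tmul,
    inner_toHilbertTensor, sub_eq_zero]
  exact (mul_left_cancel₀ (inner_self_ne_zero.2 hξ') hcoeff).symm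

end Rep

end MinTensor

/-! ### The ordering of the vertices of a graph with property (R) -/

theorem exists_linearOrder_of_list {α : Type*} {L : List α} (hnd : L.Nodup) (hmem : ∀ a, a ∈ L)
    {R T : α → α → Prop} (hR : L.Pairwise R) (hT : L.IsChain T) :
    ∃ _ : LinearOrder α, (∀ a b, a < b → R a b) ∧ ∀ a b, a ⋖ b → T a b := by
  classical
  let σ : Fin L.length ≃ α := hnd.getEquivOfForallMemList L hmem
  let _ : LinearOrder α := LinearOrder.lift' σ.symm σ.symm.injective
  let f : α ≃o Fin L.length := ⟨σ.symm, Iff.rfl⟩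
  have hget (a : α) : L[(f a : ℕ)] = a := σ.apply_symm_apply a
  refine ⟨inferInstance, fun a b hab => ?_, fun a b hab => ?_⟩
  · rw [← hget a, ← hget b]
    exact List.pairwise_iff_getElem.1 hR _ _ _ _ (f.lt_iff_lt.2 hab)
  · have hsucc : (f a : ℕ) + 1 = f b := Nat.covBy_iff_add_one_eq.1
      (Fin.covBy_iff.1 ((apply_covBy_apply_iff f).2 hab))
    rw [← hget a, ← hget b]
    simpa only [hsucc] using List.isChain_iff_getElem.1 hT (f a) (by omega)

namespace DirectedGraph

open scoped List

variable {V E : Type u} {Γ : DirectedGraph V E}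

theorem isChain_pathVertices {v : V} {l : List E} (hl : Γ.IsPathFrom v l) :
    (Γ.pathVertices v l).IsChain fun a b => ∃ e, Γ.src e = a ∧ Γ.rng e = b := by
  induction l generalizing v with
  | nil => exact .singleton _
  | cons e l ih => exact .cons_cons ⟨e, hl.1, rfl⟩ (ih hl.2)

theorem exists_isPathFrom_append_singleton {v : V} {l : List E} (hl : Γ.IsPathFrom v l) {e : E}
    (he : Γ.src e ∈ Γ.pathVertices v l) :
    ∃ m, Γ.IsPathFrom v (m ++ [e]) ∧ (m ++ [e]).map Γ.src <+ Γ.pathVertices v l := by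
  induction l generalizing v with
  | nil =>
    have hev : Γ.src e = v := List.mem_singleton.1 he
    exact ⟨[], ⟨hev, trivial⟩, by simp [pathVertices, hev]⟩
  | cons f l ih =>
    rcases List.mem_cons.1 he with hev | he'
    · exact ⟨[], ⟨hev, trivial⟩, by simp [pathVertices, hev]⟩
    · obtain ⟨m, hm, hsub⟩ := ih hl.2 he'
      refine ⟨f :: m, ⟨hl.1, hm⟩, ?_⟩
      rw [List.cons_append, List.map_cons, hl.1]
      exact hsub.cons_cons v

theorem src_eq_of_rng_eq (hΓ : ∀ l : List E, 2 ≤ l.length → ¬ Γ.IsCycle l) {v : V} {l : List E}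
    (hl : Γ.IsPathFrom v l) (hnd : (Γ.pathVertices v l).Nodup) {e : E}
    (hsrc : Γ.src e ∈ Γ.pathVertices v l) (hrng : Γ.rng e = v) : Γ.src e = v := by
  obtain ⟨m, hm, hsub⟩ := exists_isPathFrom_append_singleton hl hsrc
  rcases m.eq_nil_or_concat with rfl | ⟨m', f, rfl⟩
  · exact hm.1
  · refine absurd ⟨by simp, ⟨v, hm, ?_⟩, hnd.sublist hsub⟩ (hΓ _ (by simp))
    rw [pathVertices, List.map_append, ← List.cons_append, ← hrng]
    exact List.getLast?_concat

theorem pairwise_pathVertices (hΓ : ∀ l : List E, 2 ≤ l.length → ¬ Γ.IsCycle l) {v : V}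
    {l : List E} (hl : Γ.IsPathFrom v l) (hnd : (Γ.pathVertices v l).Nodup) :
    (Γ.pathVertices v l).Pairwise fun a b => ∀ e, Γ.src e = b → Γ.rng e ≠ a := by
  induction l generalizing v with
  | nil => exact List.pairwise_singleton _ _
  | cons e l ih =>
    have hnd' := List.nodup_cons.1 hnd
    refine List.pairwise_cons.2 ⟨?_, ih hl.2 hnd'.2⟩
    rintro _ hb f rfl hrng
    have hsrc := src_eq_of_rng_eq hΓ hl hnd (List.mem_cons_of_mem v hb) hrng
    exact hnd'.1 (hsrc ▸ hb)

/-- The vertices are linearly ordered in such a way that no edge goes down, and that there is an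
edge from each vertex to its successor. -/
structure IsPathOrder [LinearOrder V] (Γ : DirectedGraph V E) : Prop where
  src_le_rng : ∀ e, Γ.src e ≤ Γ.rng e
  exists_edge_of_covBy : ∀ v w, v ⋖ w → ∃ e, Γ.src e = v ∧ Γ.rng e = w

theorem PropertyR.injective_src_rng [Fintype V] (hR : Γ.PropertyR) :
    Function.Injective fun e => (Γ.src e, Γ.rng e) :=
  fun e f hef => hR.edge_unique e f (Prod.ext_iff.1 hef).1 (Prod.ext_iff.1 hef).2

theorem PropertyR.exists_isPathOrder [Fintype V] (hR : Γ.PropertyR) :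
    ∃ _ : LinearOrder V, IsPathOrder Γ := by
  classical
  obtain ⟨v, l, hl, hcard, hmem⟩ := hR.exists_path
  have hnd : (Γ.pathVertices v l).Nodup := by
    have hfin : (Γ.pathVertices v l).toFinset.card = (Γ.pathVertices v l).length := by
      rw [Finset.eq_univ_of_forall fun w => List.mem_toFinset.2 (hmem w), Finset.card_univ, ← hcard]
      simp [pathVertices]
    exact Multiset.toFinset_card_eq_card_iff_nodup.1 hfin
  obtain ⟨_, hlt, hcov⟩ := exists_linearOrder_of_list hnd hmem
    (pairwise_pathVertices hR.no_cycle hl hnd) (isChain_pathVertices hl)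
  exact ⟨inferInstance, fun e => not_lt.1 fun h => hlt _ _ h e rfl rfl, hcov⟩

namespace IsPathOrder

variable [LinearOrder V] [Finite V]

theorem exists_src_eq_of_lt (hΓ : IsPathOrder Γ) {v w : V} (hvw : v < w) :
    ∃ e, Γ.src e = v ∧ v < Γ.rng e ∧ Γ.rng e ≤ w := by
  obtain ⟨x, hvx, hxw⟩ := exists_covBy_le_of_lt hvw
  obtain ⟨e, hsrc, rfl⟩ := hΓ.exists_edge_of_covBy v x hvx
  exact ⟨e, hsrc, hvx.lt, hxw⟩

theorem exists_rng_eq_of_lt (hΓ : IsPathOrder Γ) {v w : V} (hvw : v < w) : ∃ e, Γ.rng e = w := by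
  obtain ⟨x, -, hxw⟩ := exists_le_covBy_of_lt hvw
  obtain ⟨e, -, hrng⟩ := hΓ.exists_edge_of_covBy x w hxw
  exact ⟨e, hrng⟩

end IsPathOrder

end DirectedGraph

/-! ### Rigidity of the coefficients of a linear action preserving `τ` -/

section Rigidity

variable {V E : Type u} [Fintype V] [Fintype E] {Γ : DirectedGraph V E} {B : Type*}
  [CStarAlgebra B]

open Classical in
/-- The relations between the coefficients `q` of a linear action on `C*(Γ)` preserving `τ` and
the coefficients `P` of its restriction to the vertex projections: `α(S_e) = ∑ S_g ⊗ q g e` and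
`α(p_w) = ∑ p_v ⊗ P v w`. -/
structure LinTauRelations (Γ : DirectedGraph V E) (q : E → E → B) (P : V → V → B) : Prop where
  proj : ∀ v w, IsStarProjection (P v w)
  row_sum : ∀ v, ∑ w, P v w = 1
  star_mul : ∀ e v, ∑ g with Γ.rng g = v, star (q g e) * q g e = P v (Γ.rng e)
  mul_star : ∀ w, (∃ e, Γ.src e = w) → ∀ g,
    ∑ e with Γ.src e = w, q g e * star (q g e) = P (Γ.src g) w
  sink : ∀ u w, (¬ ∃ e, Γ.src e = u) → (∃ e, Γ.src e = w) → P u w = 0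
  tau_edge : ∀ e, ∑ g, q g e * star (q g e) = 1
  tau_sink : ∀ u, (¬ ∃ e, Γ.src e = u) →
    ∑ g, P (Γ.src g) u + ∑ u' with ¬ ∃ e, Γ.src e = u', P u' u = 1

/-- The entries of the matrix `P` in the column `w` vanish off the diagonal. -/
def IsDiagonalColumn (P : V → V → B) (w : V) : Prop := ∀ v, v ≠ w → P v w = 0

namespace LinTauRelations

variable {q : E → E → B} {P : V → V → B}

theorem coeff_eq_zero_of_rng (h : LinTauRelations Γ q P) {g e : E}
    (h0 : P (Γ.rng g) (Γ.rng e) = 0) : q g e = 0 := by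
  classical
  rw [← h.star_mul] at h0
  exact eq_zero_of_sum_star_mul_self_eq_zero h0 (by simp)

theorem coeff_eq_zero_of_src (h : LinTauRelations Γ q P) {g e : E}
    (h0 : P (Γ.src g) (Γ.src e) = 0) : q g e = 0 := by
  classical
  rw [← h.mul_star _ ⟨e, rfl⟩] at h0
  exact eq_zero_of_sum_mul_star_self_eq_zero h0 (by simp)

theorem coeff_eq_zero_of_isDiagonalColumn (h : LinTauRelations Γ q P)
    (hE : Function.Injective fun e => (Γ.src e, Γ.rng e)) {g e : E} (hge : g ≠ e)
    (hsrc : IsDiagonalColumn P (Γ.src e)) (hrng : IsDiagonalColumn P (Γ.rng e)) : q g e = 0 := by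
  by_cases hs : Γ.src g = Γ.src e
  · exact h.coeff_eq_zero_of_rng (hrng _ fun hr => hge (hE (Prod.ext hs hr)))
  · exact h.coeff_eq_zero_of_src (hsrc _ hs)

theorem coeff_mul_star_self (h : LinTauRelations Γ q P) {e : E} (he : ∀ g, g ≠ e → q g e = 0) :
    q e e * star (q e e) = 1 := by
  rw [← h.tau_edge e, Fintype.sum_eq_single e]
  intro g hg
  rw [he g hg, zero_mul]

theorem row_eq_zero (h : LinTauRelations Γ q P) {w : V} (hw : P w w = 1) {v : V} (hv : v ≠ w) :
    P w v = 0 := by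
  have horth := mul_eq_zero_of_sum_isStarProjection_eq_one (fun v _ => h.proj w v) (h.row_sum w)
    (Finset.mem_univ v) (Finset.mem_univ w) hv
  rwa [hw, mul_one] at horth

theorem vertex_eq_one (h : LinTauRelations Γ q P)
    (hE : Function.Injective fun e => (Γ.src e, Γ.rng e)) {w : V} (hw : ∃ e, Γ.src e = w)
    (hsrc : IsDiagonalColumn P w) (hrng : ∀ e, Γ.src e = w → IsDiagonalColumn P (Γ.rng e)) :
    P w w = 1 := by
  classical
  obtain ⟨e, rfl⟩ := hw
  have hcol : ∀ g, g ≠ e → q g e = 0 := fun g hge =>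
    h.coeff_eq_zero_of_isDiagonalColumn hE hge hsrc (hrng e rfl)
  rw [← h.mul_star _ ⟨e, rfl⟩ e, ← h.coeff_mul_star_self hcol]
  refine Finset.sum_eq_single_of_mem e (by simp) fun f hf hfe => ?_
  have hf' := (Finset.mem_filter.1 hf).2
  rw [h.coeff_eq_zero_of_isDiagonalColumn hE hfe.symm (hf'.symm ▸ hsrc) (hrng f hf'), zero_mul]

section Order

variable [LinearOrder V]

theorem column_of_sink (h : LinTauRelations Γ q P) (hΓ : Γ.IsPathOrder) {w : V}
    (hw : ¬ ∃ e, Γ.src e = w) : IsDiagonalColumn P w ∧ P w w = 1 := by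
  have hsrc : ∀ v, v ≠ w → ∃ e, Γ.src e = v := by
    intro v hv
    rcases lt_or_gt_of_ne hv with hlt | hgt
    · exact (hΓ.exists_src_eq_of_lt hlt).imp fun e he => he.1
    · exact absurd ((hΓ.exists_src_eq_of_lt hgt).imp fun e he => he.1) hw
  have hone : P w w = 1 := by
    rw [← h.row_sum w]
    exact (Fintype.sum_eq_single w fun v hv => h.sink w v hw (hsrc v hv)).symm
  have hzero : ∑ g, P (Γ.src g) w = 0 := by
    have hτ := h.tau_sink w hw
    rwa [Finset.sum_eq_single w, hone, add_eq_right] at hτ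
    · exact fun v hv hvw => absurd (hsrc v hvw) (by simpa using hv)
    · exact fun hmem => absurd hw (by simpa using hmem)
  refine ⟨fun v hv => ?_, hone⟩
  obtain ⟨g, rfl⟩ := hsrc v hv
  exact eq_zero_of_sum_isStarProjection_eq_zero (fun g _ => h.proj (Γ.src g) w) hzero
    (Finset.mem_univ g)

section Above

variable {w : V}

theorem vertex_eq_zero_of_gt (h : LinTauRelations Γ q P)
    (hup : ∀ x, w < x → IsDiagonalColumn P x ∧ P x x = 1) {v : V} (hv : w < v) : P v w = 0 :=
  h.row_eq_zero (hup v hv).2 hv.ne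

theorem coeff_eq_zero_of_rng_le (h : LinTauRelations Γ q P)
    (hup : ∀ x, w < x → IsDiagonalColumn P x ∧ P x x = 1) {g e : E} (hg : Γ.rng g ≤ w)
    (he : w < Γ.rng e) : q g e = 0 :=
  h.coeff_eq_zero_of_rng ((hup _ he).1 _ (hg.trans_lt he).ne)

theorem isDiagonalColumn_of_no_loop (h : LinTauRelations Γ q P) (hΓ : Γ.IsPathOrder)
    (hup : ∀ x, w < x → IsDiagonalColumn P x ∧ P x x = 1) (hw : ∃ e, Γ.src e = w)
    (hloop : ∀ e, Γ.src e = w → w < Γ.rng e) : IsDiagonalColumn P w := by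
  intro v hv
  rcases lt_or_gt_of_ne hv with hlt | hgt
  · obtain ⟨g, rfl, -, hg⟩ := hΓ.exists_src_eq_of_lt hlt
    rw [← h.mul_star w hw g]
    refine Finset.sum_eq_zero fun e he => ?_
    rw [h.coeff_eq_zero_of_rng_le hup hg (hloop e (by simpa using he)), zero_mul]
  · exact h.vertex_eq_zero_of_gt hup hgt

section Loop

variable {l : E}

theorem coeff_loop_mul_star (h : LinTauRelations Γ q P) (hΓ : Γ.IsPathOrder)
    (hE : Function.Injective fun e => (Γ.src e, Γ.rng e))
    (hup : ∀ x, w < x → IsDiagonalColumn P x ∧ P x x = 1) (hsrc : Γ.src l = w)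
    (hrng : Γ.rng l = w) {g : E} (hg : Γ.rng g ≤ w) : q g l * star (q g l) = P (Γ.src g) w := by
  rw [← h.mul_star w ⟨l, hsrc⟩ g]
  symm
  refine Finset.sum_eq_single_of_mem l (by simp [hsrc]) fun e he hel => ?_
  have hes : Γ.src e = w := by simpa using he
  have her : Γ.rng e ≠ w := fun hr => hel (hE (Prod.ext (hes.trans hsrc.symm) (hr.trans hrng.symm)))
  have hlt : w < Γ.rng e := lt_of_le_of_ne (hes ▸ hΓ.src_le_rng e) her.symm
  rw [h.coeff_eq_zero_of_rng_le hup hg hlt, zero_mul]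

theorem isStarProjection_coeff_loop (h : LinTauRelations Γ q P) (hΓ : Γ.IsPathOrder)
    (hE : Function.Injective fun e => (Γ.src e, Γ.rng e))
    (hup : ∀ x, w < x → IsDiagonalColumn P x ∧ P x x = 1) (hsrc : Γ.src l = w)
    (hrng : Γ.rng l = w) (g : E) : IsStarProjection (q g l * star (q g l)) := by
  rcases le_or_gt (Γ.rng g) w with hg | hg
  · rw [h.coeff_loop_mul_star hΓ hE hup hsrc hrng hg]
    exact h.proj _ _
  · rw [h.coeff_eq_zero_of_rng (hrng.symm ▸ h.vertex_eq_zero_of_gt hup hg), zero_mul]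
    exact IsStarProjection.zero B

theorem vertex_eq_zero_of_lt_of_loop (h : LinTauRelations Γ q P) (hΓ : Γ.IsPathOrder)
    (hE : Function.Injective fun e => (Γ.src e, Γ.rng e))
    (hup : ∀ x, w < x → IsDiagonalColumn P x ∧ P x x = 1) (hsrc : Γ.src l = w)
    (hrng : Γ.rng l = w) {v : V} (hv : v < w) : P v w = 0 := by
  induction v using WellFoundedLT.induction with
  | ind v ih =>
  obtain ⟨g, hgs, hvg, hgw⟩ := hΓ.exists_src_eq_of_lt hv
  by_cases hloop : ∃ m, Γ.src m = v ∧ Γ.rng m = v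
  · -- `P v w` is the square of the product of two orthogonal projections.
    obtain ⟨m, hms, hmr⟩ := hloop
    have hmg : m ≠ g := by
      rintro rfl
      exact hvg.ne' hmr
    have horth := mul_eq_zero_of_sum_isStarProjection_eq_one
      (fun g _ => h.isStarProjection_coeff_loop hΓ hE hup hsrc hrng g) (h.tau_edge l)
      (Finset.mem_univ m) (Finset.mem_univ g) hmg
    rwa [h.coeff_loop_mul_star hΓ hE hup hsrc hrng (hmr.trans_le hv.le),
      h.coeff_loop_mul_star hΓ hE hup hsrc hrng hgw, hms, hgs,
      (h.proj v w).isIdempotentElem.eq] at horth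
  · rw [← hrng, ← h.star_mul l v]
    refine Finset.sum_eq_zero fun m hm => ?_
    have hmr : Γ.rng m = v := by simpa using hm
    have hmv : Γ.src m < v :=
      lt_of_le_of_ne (hmr ▸ hΓ.src_le_rng m) fun hms => hloop ⟨m, hms, hmr⟩
    rw [h.coeff_eq_zero_of_src (hsrc.symm ▸ ih _ hmv (hmv.trans hv)), mul_zero]

end Loop

end Above

theorem column (h : LinTauRelations Γ q P) (hΓ : Γ.IsPathOrder)
    (hE : Function.Injective fun e => (Γ.src e, Γ.rng e)) (w : V) :
    IsDiagonalColumn P w ∧ P w w = 1 := by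
  induction w using WellFoundedGT.induction with
  | ind w hup =>
  by_cases hw : ∃ e, Γ.src e = w
  · have hle : ∀ e, Γ.src e = w → w ≤ Γ.rng e := fun e he => he ▸ hΓ.src_le_rng e
    have hcol : IsDiagonalColumn P w := by
      by_cases hloop : ∃ l, Γ.src l = w ∧ Γ.rng l = w
      · obtain ⟨l, hsrc, hrng⟩ := hloop
        exact fun v hv => (lt_or_gt_of_ne hv).elim
          (h.vertex_eq_zero_of_lt_of_loop hΓ hE hup hsrc hrng) (h.vertex_eq_zero_of_gt hup)
      · exact h.isDiagonalColumn_of_no_loop hΓ hup hw fun e he =>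
          lt_of_le_of_ne (hle e he) fun hr => hloop ⟨e, he, hr.symm⟩
    refine ⟨hcol, h.vertex_eq_one hE hw hcol fun e he => ?_⟩
    rcases (hle e he).eq_or_lt with hr | hr
    · exact hr ▸ hcol
    · exact (hup _ hr).1
  · exact h.column_of_sink hΓ hw

end Order

theorem coeff_eq_zero (h : LinTauRelations Γ q P) (hR : Γ.PropertyR) {g e : E} (hge : g ≠ e) :
    q g e = 0 := by
  obtain ⟨_, hΓ⟩ := hR.exists_isPathOrder
  have hE := hR.injective_src_rng
  exact h.coeff_eq_zero_of_isDiagonalColumn hE hge (h.column hΓ hE _).1 (h.column hΓ hE _).1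

theorem coeff_mem_unitary (h : LinTauRelations Γ q P) (hR : Γ.PropertyR) (e : E) :
    q e e ∈ unitary B := by
  classical
  refine Unitary.mem_iff.2 ⟨?_, h.coeff_mul_star_self fun g => h.coeff_eq_zero hR⟩
  obtain ⟨_, hΓ⟩ := hR.exists_isPathOrder
  rw [← (h.column hΓ hR.injective_src_rng (Γ.rng e)).2, ← h.star_mul e]
  symm
  refine Finset.sum_eq_single_of_mem e (by simp) fun g _ hg => ?_
  rw [h.coeff_eq_zero hR hg, mul_zero]

end LinTauRelations

end Rigidity

/-! ### Cuntz-Krieger families -/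

namespace IsCuntzKriegerFamily

variable {V E : Type u} [Fintype V] [Fintype E] {Γ : DirectedGraph V E} {B : Type*}
  [CStarAlgebra B] {S : E → B} {p : V → B}

theorem isStarProjection_p (h : IsCuntzKriegerFamily Γ S p) (v : V) : IsStarProjection (p v) :=
  ⟨h.idempotent v, h.self_adjoint v⟩

theorem isStarProjection_S_mul_star (h : IsCuntzKriegerFamily Γ S p) (e : E) :
    IsStarProjection (S e * star (S e)) :=
  ⟨by rw [IsIdempotentElem, ← mul_assoc, h.partial_isometry], .mul_star_self _⟩

open Classical in
theorem sum_S_mul_star_add_sum_p (h : IsCuntzKriegerFamily Γ S p) :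
    ∑ e, S e * star (S e) + ∑ v, (if ∃ e, Γ.src e = v then 0 else p v) = 1 := by
  rw [← Finset.sum_fiberwise Finset.univ Γ.src, ← Finset.sum_add_distrib, ← h.sum_eq_one]
  refine Finset.sum_congr rfl fun v _ => ?_
  split_ifs with hv
  · rw [add_zero, h.sum_mul_star v hv]
  · rw [Finset.sum_eq_zero, zero_add]
    exact fun e he => (hv ⟨e, by simpa using he⟩).elim

theorem star_S_mul_S_of_ne (h : IsCuntzKriegerFamily Γ S p) {e f : E} (hef : e ≠ f) :
    star (S e) * S f = 0 := by
  classical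
  let r : E ⊕ V → B :=
    Sum.elim (fun e => S e * star (S e)) (fun v => if ∃ e, Γ.src e = v then 0 else p v)
  have hr : ∀ i ∈ Finset.univ, IsStarProjection (r i) := by
    rintro (e | v) -
    · exact h.isStarProjection_S_mul_star e
    · dsimp only [r, Sum.elim_inr]
      split_ifs
      · exact IsStarProjection.zero B
      · exact h.isStarProjection_p v
  have hsum : ∑ i, r i = 1 := (Fintype.sum_sum_type r).trans h.sum_S_mul_star_add_sum_p
  have horth : r (.inl e) * r (.inl f) = 0 :=
    mul_eq_zero_of_sum_isStarProjection_eq_one hr hsum (Finset.mem_univ _) (Finset.mem_univ _)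
      (Sum.inl_injective.ne hef)
  have hstar : star (S e) * S e * star (S e) = star (S e) := by
    simpa [mul_assoc] using congrArg star (h.partial_isometry e)
  calc star (S e) * S f = star (S e) * S e * star (S e) * (S f * star (S f) * S f) := by
        rw [hstar, h.partial_isometry]
    _ = star (S e) * (r (.inl e) * r (.inl f)) * S f := by
        simp only [r, Sum.elim_inl, mul_assoc]
    _ = 0 := by rw [horth, mul_zero, zero_mul]

theorem p_src_mul_S (h : IsCuntzKriegerFamily Γ S p) (e : E) : p (Γ.src e) * S e = S e := by
  classical
  rw [h.sum_mul_star _ ⟨e, rfl⟩, Finset.sum_mul, Finset.sum_eq_single e, h.partial_isometry]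
  · intro f _ hfe
    rw [mul_assoc, h.star_S_mul_S_of_ne hfe, mul_zero]
  · simp

theorem p_mul_S_of_ne (h : IsCuntzKriegerFamily Γ S p) {v : V} {e : E} (hv : Γ.src e ≠ v) :
    p v * S e = 0 := by
  rw [← h.p_src_mul_S e, ← mul_assoc, h.orthogonal _ _ hv.symm, zero_mul]

end IsCuntzKriegerFamily

/-! ### A representation of `C*(Γ)` on `ℓ²(V × ℕ)` -/

section PartialShift

variable {X ι κ H : Type*} [NormedAddCommGroup H] [InnerProductSpace ℂ H]
  (b : HilbertBasis X ℂ H)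

/-- The isometry `ℓ²(ι) → H` with `δ_n ↦ b (j n)`. -/
def basisIsometry [CompleteSpace H] (j : ι ↪ X) : lp (fun _ : ι => ℂ) 2 →L[ℂ] H :=
  (b.orthonormal.comp j j.injective).orthogonalFamily.linearIsometry.toContinuousLinearMap

theorem clm_ext_hilbertBasis {S T : H →L[ℂ] H} (h : ∀ x, S (b x) = T (b x)) : S = T := by
  refine ContinuousLinearMap.ext_on
    (Submodule.dense_iff_topologicalClosure_eq_top.2 b.dense_span) ?_
  rintro _ ⟨x, rfl⟩
  exact h x

variable [CompleteSpace H]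

theorem basisIsometry_single (j : ι ↪ X) [DecidableEq ι] (n : ι) :
    basisIsometry b j (lp.single 2 n 1) = b (j n) := by
  refine ((b.orthonormal.comp j j.injective).orthogonalFamily.linearIsometry_apply_single
    (1 : ℂ)).trans ?_
  simp

theorem adjoint_basisIsometry_apply (j : ι ↪ X) (x : lp (fun _ : ι => ℂ) 2) :
    (basisIsometry b j).adjoint (basisIsometry b j x) = x := by
  refine ext_inner_left ℂ fun y => ?_
  rw [ContinuousLinearMap.adjoint_inner_right]
  exact LinearIsometry.inner_map_map _ _ _

theorem adjoint_basisIsometry_apply_of_notMem (j : ι ↪ X) {x : X} (hx : x ∉ Set.range j) :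
    (basisIsometry b j).adjoint (b x) = 0 := by
  refine ext_inner_right ℂ fun y => ?_
  rw [ContinuousLinearMap.adjoint_inner_left, inner_zero_left]
  have hsum := (innerSL ℂ (b x)).hasSum
    ((b.orthonormal.comp j j.injective).orthogonalFamily.hasSum_linearIsometry y)
  refine hsum.unique ?_
  convert hasSum_zero using 2 with n
  have horth : inner ℂ (b x) (b (j n)) = 0 := b.orthonormal.2 fun hn => hx ⟨n, hn.symm⟩
  simp [horth]

/-- The partial isometry with `b (k n) ↦ b (j n)` which vanishes on the other basis vectors. -/
def partialShift (j k : ι ↪ X) : H →L[ℂ] H := basisIsometry b j ∘L (basisIsometry b k).adjoint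

theorem partialShift_apply (j k : ι ↪ X) (n : ι) : partialShift b j k (b (k n)) = b (j n) := by
  classical
  rw [partialShift, ContinuousLinearMap.comp_apply, ← basisIsometry_single b k,
    adjoint_basisIsometry_apply, basisIsometry_single]

theorem partialShift_apply_of_notMem (j k : ι ↪ X) {x : X} (hx : x ∉ Set.range k) :
    partialShift b j k (b x) = 0 := by
  rw [partialShift, ContinuousLinearMap.comp_apply, adjoint_basisIsometry_apply_of_notMem b k hx,
    map_zero]

open Classical in
theorem partialShift_self_apply (j : ι ↪ X) (x : X) :
    partialShift b j j (b x) = if x ∈ Set.range j then b x else 0 := by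
  split_ifs with h
  · obtain ⟨n, rfl⟩ := h
    exact partialShift_apply b j j n
  · exact partialShift_apply_of_notMem b j j h

theorem star_partialShift (j k : ι ↪ X) : star (partialShift b j k) = partialShift b k j := by
  rw [partialShift, ContinuousLinearMap.star_eq_adjoint, ContinuousLinearMap.adjoint_comp,
    ContinuousLinearMap.adjoint_adjoint, partialShift]

theorem partialShift_mul (j k l : ι ↪ X) :
    partialShift b j k * partialShift b k l = partialShift b j l := by
  refine ContinuousLinearMap.ext fun x => ?_
  rw [mul_apply_eq_comp]
  simp only [partialShift, ContinuousLinearMap.comp_apply, adjoint_basisIsometry_apply]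

theorem isStarProjection_partialShift (j : ι ↪ X) : IsStarProjection (partialShift b j j) :=
  ⟨partialShift_mul b j j j, star_partialShift b j j⟩

theorem sum_partialShift_self {I : Type*} {s : Finset I} {j : I → ι ↪ X} {k : κ ↪ X}
    (hdisj : (s : Set I).PairwiseDisjoint fun i => Set.range (j i))
    (hunion : ⋃ i ∈ s, Set.range (j i) = Set.range k) :
    ∑ i ∈ s, partialShift b (j i) (j i) = partialShift b k k := by
  classical
  refine clm_ext_hilbertBasis b fun x => ?_
  rw [sum_apply, partialShift_self_apply]
  split_ifs with hx
  · obtain ⟨i, hi, hxi⟩ := Set.mem_iUnion₂.1 (hunion ▸ hx)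
    rw [Finset.sum_eq_single_of_mem i hi, partialShift_self_apply, if_pos hxi]
    exact fun i' hi' hne => partialShift_apply_of_notMem b _ _ fun hxi' =>
      Set.disjoint_left.1 (hdisj hi' hi hne) hxi' hxi
  · exact Finset.sum_eq_zero fun i hi => partialShift_apply_of_notMem b _ _ fun hxi =>
      hx (hunion ▸ Set.mem_biUnion hi hxi)

end PartialShift

section GraphRep

open Function.Embedding (sectR)

/-- A splitting of the vertices `(v, n)`, `n ∈ ℕ`, for `v` not a sink, into sequences indexed by
the edges with source `v`. -/
structure EdgeSplitting {V E : Type u} (Γ : DirectedGraph V E) where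
  toEmbedding : E × ℕ ↪ V × ℕ
  fst_apply : ∀ e n, (toEmbedding (e, n)).1 = Γ.src e
  exists_apply_eq : ∀ e n, ∃ x, toEmbedding x = (Γ.src e, n)

theorem EdgeSplitting.nonempty {V E : Type u} [Countable E] (Γ : DirectedGraph V E) :
    Nonempty (EdgeSplitting Γ) := by
  have hequiv : ∀ v, ∃ ψ : {e // Γ.src e = v} × ℕ → ℕ, ψ.Injective ∧
      ((∃ e, Γ.src e = v) → ψ.Surjective) := by
    intro v
    by_cases hv : ∃ e, Γ.src e = v
    · have : Nonempty {e // Γ.src e = v} := nonempty_subtype.2 hv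
      obtain ⟨ψ⟩ := nonempty_equiv_of_countable (α := {e // Γ.src e = v} × ℕ) (β := ℕ)
      exact ⟨ψ, ψ.injective, fun _ => ψ.surjective⟩
    · exact ⟨Prod.snd, fun x => (hv ⟨x.1, x.1.2⟩).elim, fun h => (hv h).elim⟩
  choose ψ hinj hsurj using hequiv
  have hψ : ∀ {e v} (he : Γ.src e = v) n, ψ (Γ.src e) (⟨e, rfl⟩, n) = ψ v (⟨e, he⟩, n) := by
    rintro e _ rfl n
    rfl
  refine ⟨⟨⟨fun x => (Γ.src x.1, ψ _ (⟨x.1, rfl⟩, x.2)), ?_⟩, fun e n => rfl, fun e n => ?_⟩⟩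
  · rintro ⟨e, n⟩ ⟨f, m⟩ h
    obtain ⟨hsrc, hval⟩ := Prod.ext_iff.1 h
    have hef := hinj _ ((hψ hsrc n).symm.trans hval)
    simpa using hef
  · obtain ⟨⟨⟨f, hf⟩, m⟩, hx⟩ := hsurj (Γ.src e) ⟨e, rfl⟩ n
    exact ⟨(f, m), Prod.ext hf ((hψ hf m).trans hx)⟩

/-- The sequence of vertices `(src e, n)` which a splitting assigns to the edge `e`. -/
def EdgeSplitting.edge {V E : Type u} {Γ : DirectedGraph V E} (σ : EdgeSplitting Γ) (e : E) :
    ℕ ↪ V × ℕ :=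
  (sectR e ℕ).trans σ.toEmbedding

variable {V E : Type u} [Fintype E] {Γ : DirectedGraph V E} {H : Type*} [NormedAddCommGroup H]
  [InnerProductSpace ℂ H] [CompleteSpace H] (b : HilbertBasis (V × ℕ) ℂ H)

open Classical in
theorem EdgeSplitting.sum_partialShift_edge (σ : EdgeSplitting Γ) (g : E) :
    ∑ e with Γ.src e = Γ.src g, partialShift b (σ.edge e) (σ.edge e) =
      partialShift b (sectR (Γ.src g) ℕ) (sectR (Γ.src g) ℕ) := by
  refine sum_partialShift_self b ?_ (Set.Subset.antisymm (Set.iUnion₂_subset ?_) ?_)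
  · rintro e - f - hef
    refine Set.disjoint_left.2 ?_
    rintro _ ⟨n, rfl⟩ ⟨m, hm⟩
    exact hef (congrArg Prod.fst (σ.toEmbedding.injective hm)).symm
  · rintro e he _ ⟨n, rfl⟩
    exact ⟨_, Prod.ext ((Finset.mem_filter.1 he).2.symm.trans (σ.fst_apply e n).symm) rfl⟩
  · rintro _ ⟨n, rfl⟩
    obtain ⟨⟨e, m⟩, hx⟩ := σ.exists_apply_eq g n
    have he : Γ.src e = Γ.src g := by rw [← σ.fst_apply e m, hx]
    exact Set.mem_iUnion₂.2 ⟨e, by simp [he], m, hx⟩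

variable [Fintype V]

theorem sum_partialShift_sectR : ∑ v : V, partialShift b (sectR v ℕ) (sectR v ℕ) = 1 := by
  refine (sum_partialShift_self b (k := .refl _) ?_ ?_).trans ?_
  · rintro v - w - hvw
    refine Set.disjoint_left.2 ?_
    rintro _ ⟨n, rfl⟩ ⟨m, hm⟩
    exact hvw (congrArg Prod.fst hm).symm
  · exact Set.ext fun x => by simp
  · refine clm_ext_hilbertBasis b fun x => ?_
    rw [partialShift_self_apply, if_pos ⟨x, rfl⟩, one_apply_eq_self]

theorem EdgeSplitting.isCuntzKriegerFamily (σ : EdgeSplitting Γ) : IsCuntzKriegerFamily Γ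
    (fun e => partialShift b (σ.edge e) (sectR (Γ.rng e) ℕ))
    (fun v => partialShift b (sectR v ℕ) (sectR v ℕ)) where
  partial_isometry e := by rw [star_partialShift, partialShift_mul, partialShift_mul]
  idempotent v := partialShift_mul b _ _ _
  self_adjoint v := star_partialShift b _ _
  orthogonal v w hvw := mul_eq_zero_of_sum_isStarProjection_eq_one
    (fun v _ => isStarProjection_partialShift b _) (sum_partialShift_sectR b)
    (Finset.mem_univ v) (Finset.mem_univ w) hvw
  sum_eq_one := sum_partialShift_sectR b
  star_mul_self e := by rw [star_partialShift, partialShift_mul]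
  sum_mul_star v hv := by
    obtain ⟨g, rfl⟩ := hv
    simp only [star_partialShift, partialShift_mul, σ.sum_partialShift_edge b g]

/-- A representation `π` of `C*(Γ)` with a unit vector `ζ v` in the range of each projection
`π (p v)`. -/
structure VertexRep (Γ : DirectedGraph V E) where
  H : Type u
  [normedAddCommGroup : NormedAddCommGroup H]
  [innerProductSpace : InnerProductSpace ℂ H]
  [completeSpace : CompleteSpace H]
  π : GraphCStarAlgebra Γ →⋆ₐ[ℂ] (H →L[ℂ] H)
  ζ : V → H
  norm_ζ : ∀ v, ‖ζ v‖ = 1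
  π_p_ζ : ∀ v, π (GraphCStarAlgebra.p Γ v) (ζ v) = ζ v

attribute [instance] VertexRep.normedAddCommGroup VertexRep.innerProductSpace
  VertexRep.completeSpace

theorem VertexRep.nonempty (Γ : DirectedGraph V E) : Nonempty (VertexRep Γ) := by
  obtain ⟨σ⟩ := EdgeSplitting.nonempty Γ
  let b : HilbertBasis (V × ℕ) ℂ (lp (fun _ : V × ℕ => ℂ) 2) := ⟨LinearIsometryEquiv.refl ℂ _⟩
  refine ⟨⟨_, GraphCStarAlgebra.lift (σ.isCuntzKriegerFamily b), fun v => b (v, 0), fun v => ?_,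
    fun v => ?_⟩⟩
  · exact b.orthonormal.1 (v, 0)
  · rw [GraphCStarAlgebra.lift_p]
    exact partialShift_apply b _ (sectR v ℕ) 0

end GraphRep

/-! ### The coefficients of a linear action preserving `τ` -/

namespace MinTensor

variable {A B : Type u} [CStarAlgebra A] [CStarAlgebra B]

theorem tmul_sum {ι : Type*} (s : Finset ι) (a : A) (b : ι → B) :
    tmul a (∑ i ∈ s, b i) = ∑ i ∈ s, tmul a (b i) := map_sum (tmulCLM a) b s

theorem sum_tmul {ι : Type*} (s : Finset ι) (a : ι → A) (b : B) :
    tmul (∑ i ∈ s, a i) b = ∑ i ∈ s, tmul (a i) b :=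
  map_sum ((tmulCLM (A := A) (B := B)).flip b) a s

@[simp] theorem tmul_zero (a : A) : tmul a (0 : B) = 0 := map_zero (tmulCLM a)

@[simp] theorem zero_tmul (b : B) : tmul (0 : A) b = 0 :=
  map_zero ((tmulCLM (A := A) (B := B)).flip b)

end MinTensor

section Coefficients

open MinTensor GraphCStarAlgebra

variable {V E : Type u} [Fintype V] [Fintype E] {Γ : DirectedGraph V E}

theorem IsCuntzKriegerFamily.p_mem {B : Type*} [CStarAlgebra B] {S : E → B} {p : V → B}
    [LinearOrder V] (h : IsCuntzKriegerFamily Γ S p) (hΓ : Γ.IsPathOrder) {A : Subalgebra ℂ B}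
    (hA : ∀ e, p (Γ.rng e) ∈ A) (w : V) : p w ∈ A := by
  by_cases hw : ∃ e, Γ.rng e = w
  · obtain ⟨e, rfl⟩ := hw
    exact hA e
  · have hp : p w = 1 - ∑ v ∈ Finset.univ.erase w, p v := by
      rw [eq_sub_iff_add_eq, Finset.add_sum_erase _ _ (Finset.mem_univ w), h.sum_eq_one]
    rw [hp]
    refine A.sub_mem A.one_mem (A.sum_mem fun v hv => ?_)
    rcases lt_or_gt_of_ne (Finset.ne_of_mem_erase hv) with hlt | hgt
    · exact (hw (hΓ.exists_rng_eq_of_lt hlt)).elim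
    · obtain ⟨e, rfl⟩ := hΓ.exists_rng_eq_of_lt hgt
      exact hA e

namespace VertexRep

variable (R : VertexRep Γ)

/-- The unit vector `S_e ζ_{r(e)}` in the range of `S_e S_e*`. -/
def ξ (e : E) : R.H := R.π (S Γ e) (R.ζ (Γ.rng e))

open Classical in
theorem inner_ζ_p (v w : V) :
    inner ℂ (R.ζ v) (R.π (p Γ w) (R.ζ v)) = if w = v then (1 : ℂ) else 0 := by
  split_ifs with hwv
  · rw [hwv, R.π_p_ζ]
    exact inner_self_eq_one_of_norm_eq_one (R.norm_ζ v)
  · rw [← R.π_p_ζ v, ← mul_apply_eq_comp, ← map_mul,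
      (isCuntzKriegerFamily Γ).orthogonal _ _ hwv, map_zero, zero_apply, inner_zero_right]

theorem inner_ζ_S_mul {u : V} (hu : ¬ ∃ e, Γ.src e = u) (e : E) (a : GraphCStarAlgebra Γ) :
    inner ℂ (R.ζ u) (R.π (S Γ e * a) (R.ζ u)) = (0 : ℂ) := by
  have hp : R.π (p Γ u * (S Γ e * a)) = 0 := by
    rw [← mul_assoc, (isCuntzKriegerFamily Γ).p_mul_S_of_ne fun he => hu ⟨e, he⟩, zero_mul,
      map_zero]
  rw [← R.π_p_ζ u, ← ContinuousLinearMap.adjoint_inner_right, ← ContinuousLinearMap.star_eq_adjoint,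
    ← map_star, (isCuntzKriegerFamily Γ).self_adjoint, ← mul_apply_eq_comp, ← map_mul, hp,
    zero_apply, inner_zero_right]

theorem inner_ξ (e : E) (a : GraphCStarAlgebra Γ) (η : R.H) :
    inner ℂ (R.ξ e) (R.π a η) = inner ℂ (R.ζ (Γ.rng e)) (R.π (star (S Γ e) * a) η) := by
  rw [ξ, ← ContinuousLinearMap.adjoint_inner_right, ← ContinuousLinearMap.star_eq_adjoint,
    ← map_star, ← mul_apply_eq_comp, ← map_mul]

open Classical in
theorem inner_ξ_S (e f : E) :
    inner ℂ (R.ξ e) (R.π (S Γ f) (R.ζ (Γ.rng e))) = if f = e then (1 : ℂ) else 0 := by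
  rw [inner_ξ]
  split_ifs with hfe
  · rw [hfe, (isCuntzKriegerFamily Γ).star_mul_self, inner_ζ_p, if_pos rfl]
  · rw [(isCuntzKriegerFamily Γ).star_S_mul_S_of_ne (Ne.symm hfe), map_zero, zero_apply,
      inner_zero_right]

open Classical in
theorem inner_ξ_p (e : E) (v : V) :
    inner ℂ (R.ξ e) (R.π (p Γ v) (R.ξ e)) = if v = Γ.src e then (1 : ℂ) else 0 := by
  nth_rw 2 [ξ]
  rw [← mul_apply_eq_comp, ← map_mul]
  split_ifs with hv
  · rw [hv, (isCuntzKriegerFamily Γ).p_src_mul_S, inner_ξ_S, if_pos rfl]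
  · rw [(isCuntzKriegerFamily Γ).p_mul_S_of_ne (Ne.symm hv), map_zero, zero_apply,
      inner_zero_right]

open Classical in
theorem inner_ξ_S_mul_star (g e f : E) :
    inner ℂ (R.ξ g) (R.π (S Γ e * star (S Γ f)) (R.ξ g)) =
      if e = g ∧ f = g then (1 : ℂ) else 0 := by
  nth_rw 2 [ξ]
  rw [← mul_apply_eq_comp, ← map_mul, mul_assoc]
  by_cases hf : f = g
  · rw [hf, (isCuntzKriegerFamily Γ).star_mul_self, map_mul, mul_apply_eq_comp, R.π_p_ζ, inner_ξ_S]
    simp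
  · rw [(isCuntzKriegerFamily Γ).star_S_mul_S_of_ne hf, mul_zero, map_zero, zero_apply,
      inner_zero_right, if_neg fun h => hf h.2]

end VertexRep

theorem GraphCStarAlgebra.S_ne_zero (e : E) : S Γ e ≠ 0 := by
  classical
  obtain ⟨R⟩ := VertexRep.nonempty Γ
  intro hS
  have hcoeff := R.inner_ξ_S e e
  rw [hS, map_zero, zero_apply, inner_zero_right, if_pos rfl] at hcoeff
  exact zero_ne_one hcoeff

theorem IsTau.eq {τ τ' : V2plus Γ →ₗ[ℂ] ℂ} (h : IsTau τ) (h' : IsTau τ') : τ = τ' := by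
  refine LinearMap.ext_on Submodule.span_span_coe_preimage ?_
  rintro x (⟨u, hu, hx⟩ | ⟨e, f, hef, hx⟩)
  · rw [h.apply_p x u hu hx, h'.apply_p x u hu hx]
  · obtain rfl | hne := eq_or_ne e f
    · rw [h.apply_self x e hx, h'.apply_self x e hx]
    · rw [h.apply_ne x e f hef hne hx, h'.apply_ne x e f hef hne hx]

namespace VertexRep

variable (R : VertexRep Γ) {Q : Type u} [CStarAlgebra Q]

open Classical in
/-- An extension of `τ` to the graph C*-algebra. -/
def tau : GraphCStarAlgebra Γ →L[ℂ] ℂ :=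
  ∑ g, vectorFunctional R.π (R.ξ g) (R.ξ g) +
    ∑ u with ¬ ∃ e, Γ.src e = u, vectorFunctional R.π (R.ζ u) (R.ζ u)

open Classical in
/-- The slice map `τ ⊗ id` for the extension `VertexRep.tau` of `τ`. -/
def tauSlice : MinTensor (GraphCStarAlgebra Γ) Q →L[ℂ] Q :=
  ∑ g, slice R.π (R.ξ g) (R.ξ g) + ∑ u with ¬ ∃ e, Γ.src e = u, slice R.π (R.ζ u) (R.ζ u)

theorem tauSlice_tmul (a : GraphCStarAlgebra Γ) (b : Q) :
    R.tauSlice (tmul a b) = R.tau a • b := by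
  simp only [tauSlice, tau, add_apply, sum_apply, slice_tmul, vectorFunctional_apply, add_smul,
    Finset.sum_smul]

open Classical in
theorem tau_S_mul_star (e f : E) : R.tau (S Γ e * star (S Γ f)) = if e = f then 1 else 0 := by
  have hsink : ∀ u ∈ Finset.univ.filter fun u => ¬ ∃ e, Γ.src e = u,
      inner ℂ (R.ζ u) (R.π (S Γ e * star (S Γ f)) (R.ζ u)) = (0 : ℂ) :=
    fun u hu => R.inner_ζ_S_mul (Finset.mem_filter.1 hu).2 e _
  simp only [tau, add_apply, sum_apply, vectorFunctional_apply, inner_ξ_S_mul_star]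
  rw [Finset.sum_eq_zero hsink, add_zero]
  split_ifs with hef
  · simp [hef]
  · exact Finset.sum_eq_zero fun g _ => if_neg fun hg => hef (hg.1.trans hg.2.symm)

theorem tau_p {u : V} (hu : ¬ ∃ e, Γ.src e = u) : R.tau (p Γ u) = 1 := by
  classical
  simp only [tau, add_apply, sum_apply, vectorFunctional_apply, inner_ξ_p, inner_ζ_p]
  rw [Finset.sum_eq_zero fun g _ => if_neg fun hg => hu ⟨g, hg.symm⟩, zero_add]
  simpa using hu

theorem isTau_tau : IsTau (R.tau.toLinearMap ∘ₗ (V2plus Γ).subtype) := by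
  classical
  refine ⟨fun x e hx => ?_, fun x e f _ hef hx => ?_, fun x u hu hx => ?_⟩
  all_goals rw [LinearMap.comp_apply, Submodule.subtype_apply, hx, ContinuousLinearMap.coe_coe]
  · rw [tau_S_mul_star, if_pos rfl]
  · rw [tau_S_mul_star, if_neg hef]
  · rw [R.tau_p hu]

theorem tauSlice_action {U : QuantumTransformationGroup (GraphCStarAlgebra Γ)}
    (hU : PreservesTau U) {x : GraphCStarAlgebra Γ} (hx : x ∈ V2plus Γ) :
    R.tauSlice (U.action x) = R.tau x • (1 : U.cqg.carrier) := by
  obtain ⟨τ, hτ, hpres⟩ := hU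
  obtain ⟨t, himage, hslice⟩ := hpres ⟨x, hx⟩
  rw [hτ.eq R.isTau_tau] at hslice
  refine Eq.trans ?_ hslice
  rw [← himage]
  clear himage hslice
  induction t with
  | zero => simp
  | add s t hs ht => simp only [map_add, hs, ht]
  | tmul y b =>
    rw [TensorProduct.map_tmul, TensorProduct.map_tmul, TensorProduct.lid_tmul]
    exact R.tauSlice_tmul _ _

end VertexRep

end Coefficients

section VertexHom

open MinTensor GraphCStarAlgebra

variable {V E : Type u} [Fintype V] [Fintype E] {Γ : DirectedGraph V E} {Q : Type u}
  [CStarAlgebra Q]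

variable (Γ Q) in
/-- The embedding `X ↦ ∑ v, p_v ⊗ X v` of `ℂ^V ⊗ Q`. -/
def vertexHom : (V → Q) →⋆ₐ[ℂ] MinTensor (GraphCStarAlgebra Γ) Q where
  toFun X := ∑ v, tmul (p Γ v) (X v)
  map_one' := by
    simp only [Pi.one_apply]
    rw [← sum_tmul, (isCuntzKriegerFamily Γ).sum_eq_one, one_eq]
  map_mul' X Y := by
    rw [Finset.sum_mul_sum]
    refine Finset.sum_congr rfl fun v _ => ?_
    rw [Finset.sum_eq_single v, tmul_mul_tmul, (isCuntzKriegerFamily Γ).idempotent, Pi.mul_apply]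
    · intro w _ hw
      rw [tmul_mul_tmul, (isCuntzKriegerFamily Γ).orthogonal _ _ hw.symm, zero_tmul]
    · simp
  map_zero' := by simp
  map_add' X Y := by
    simp only [Pi.add_apply, ← tmulCLM_apply, map_add, Finset.sum_add_distrib]
  commutes' c := by
    simp only [Algebra.algebraMap_eq_smul_one, Pi.smul_apply, Pi.one_apply, ← tmulCLM_apply,
      map_smul, ← Finset.smul_sum]
    simp only [tmulCLM_apply]
    rw [← sum_tmul, (isCuntzKriegerFamily Γ).sum_eq_one, one_eq]
  map_star' X := by
    rw [star_sum]
    exact Finset.sum_congr rfl fun v _ => by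
      rw [star_tmul, (isCuntzKriegerFamily Γ).self_adjoint, Pi.star_apply]

theorem vertexHom_apply (X : V → Q) : vertexHom Γ Q X = ∑ v, tmul (p Γ v) (X v) := rfl

namespace VertexRep

variable (R : VertexRep Γ)

theorem slice_ζ_vertexHom (v : V) (X : V → Q) :
    slice R.π (R.ζ v) (R.ζ v) (vertexHom Γ Q X) = X v := by
  classical
  simp only [vertexHom_apply, map_sum, slice_tmul, inner_ζ_p, ite_smul, one_smul, zero_smul,
    Finset.sum_ite_eq', Finset.mem_univ, if_true]

theorem slice_ξ_vertexHom (g : E) (X : V → Q) :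
    slice R.π (R.ξ g) (R.ξ g) (vertexHom Γ Q X) = X (Γ.src g) := by
  classical
  simp only [vertexHom_apply, map_sum, slice_tmul, inner_ξ_p, ite_smul, one_smul, zero_smul,
    Finset.sum_ite_eq', Finset.mem_univ, if_true]

theorem slice_ξ_mul_star (g : E) (X : E → Q) :
    slice R.π (R.ξ g) (R.ξ g)
      ((∑ e, tmul (S Γ e) (X e)) * star (∑ e, tmul (S Γ e) (X e))) = X g * star (X g) := by
  classical
  simp only [star_sum, Finset.sum_mul_sum, star_tmul, tmul_mul_tmul, map_sum, slice_tmul,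
    inner_ξ_S_mul_star, ite_and, ite_smul, one_smul, zero_smul]
  simp

theorem slice_ζ_mul_star {u : V} (hu : ¬ ∃ e, Γ.src e = u) (X : E → Q) :
    slice R.π (R.ζ u) (R.ζ u)
      ((∑ e, tmul (S Γ e) (X e)) * star (∑ e, tmul (S Γ e) (X e))) = 0 := by
  simp only [star_sum, Finset.sum_mul_sum, star_tmul, tmul_mul_tmul, map_sum, slice_tmul,
    R.inner_ζ_S_mul hu, zero_smul, Finset.sum_const_zero]

end VertexRep

variable (Γ Q) in
theorem vertexHom_injective : Function.Injective (vertexHom Γ Q) := by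
  obtain ⟨R⟩ := VertexRep.nonempty Γ
  intro X Y h
  funext v
  rw [← R.slice_ζ_vertexHom v X, h, R.slice_ζ_vertexHom]

variable {α : GraphCStarAlgebra Γ →⋆ₐ[ℂ] MinTensor (GraphCStarAlgebra Γ) Q} {q : E → E → Q}

open Classical in
theorem apply_p_rng (hq : ∀ e, α (S Γ e) = ∑ f, tmul (S Γ f) (q f e)) (e : E) :
    α (p Γ (Γ.rng e)) =
      vertexHom Γ Q fun v => ∑ g with Γ.rng g = v, star (q g e) * q g e := by
  rw [← (isCuntzKriegerFamily Γ).star_mul_self, map_mul, map_star, hq, star_sum,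
    Finset.sum_mul_sum, vertexHom_apply, ← Finset.sum_fiberwise Finset.univ Γ.rng]
  refine Finset.sum_congr rfl fun v _ => ?_
  rw [tmul_sum]
  refine Finset.sum_congr rfl fun g hg => ?_
  rw [Finset.sum_eq_single g, star_tmul, tmul_mul_tmul, (isCuntzKriegerFamily Γ).star_mul_self,
    (Finset.mem_filter.1 hg).2]
  · intro f _ hf
    rw [star_tmul, tmul_mul_tmul, (isCuntzKriegerFamily Γ).star_S_mul_S_of_ne hf.symm, zero_tmul]
  · simp

open Classical in
theorem apply_p_src (hq : ∀ e, α (S Γ e) = ∑ f, tmul (S Γ f) (q f e)) {w : V}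
    (hw : ∃ e, Γ.src e = w) : α (p Γ w) =
      ∑ e with Γ.src e = w, (∑ f, tmul (S Γ f) (q f e)) * star (∑ f, tmul (S Γ f) (q f e)) := by
  simp only [(isCuntzKriegerFamily Γ).sum_mul_star w hw, map_sum, map_mul, map_star, hq]

theorem exists_vertexHom_eq_apply_p (hR : Γ.PropertyR)
    (hq : ∀ e, α (S Γ e) = ∑ f, tmul (S Γ f) (q f e)) (w : V) :
    ∃ X, vertexHom Γ Q X = α (p Γ w) := by
  classical
  obtain ⟨_, hΓ⟩ := hR.exists_isPathOrder
  exact (isCuntzKriegerFamily Γ).p_mem hΓ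
    (A := (vertexHom Γ Q).toAlgHom.range.comap α.toAlgHom) (fun e => ⟨_, (apply_p_rng hq e).symm⟩) w

section Relations

variable {P : V → V → Q} (hP : ∀ w, vertexHom Γ Q (fun v => P v w) = α (p Γ w))

include hP

theorem isStarProjection_vertexCoeff (v w : V) : IsStarProjection (P v w) := by
  have hidem : (fun v => P v w) * (fun v => P v w) = fun v => P v w := vertexHom_injective Γ Q <| by
    rw [map_mul, hP, ← map_mul, (isCuntzKriegerFamily Γ).idempotent]
  have hstar : star (fun v => P v w) = fun v => P v w := vertexHom_injective Γ Q <| by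
    rw [map_star, hP, ← map_star, (isCuntzKriegerFamily Γ).self_adjoint]
  exact ⟨congrFun hidem v, congrFun hstar v⟩

theorem sum_vertexCoeff (v : V) : ∑ w, P v w = 1 := by
  have hone : ∑ w, (fun v => P v w) = 1 := vertexHom_injective Γ Q <| by
    simp only [map_sum, map_one, hP]
    rw [← map_sum, (isCuntzKriegerFamily Γ).sum_eq_one, map_one]
  simpa using congrFun hone v

variable (hq : ∀ e, α (S Γ e) = ∑ f, tmul (S Γ f) (q f e))

include hq

open Classical in
theorem sum_star_mul_coeff (e : E) (v : V) :
    ∑ g with Γ.rng g = v, star (q g e) * q g e = P v (Γ.rng e) :=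
  congrFun (vertexHom_injective Γ Q ((apply_p_rng hq e).symm.trans (hP _).symm)) v

open Classical in
theorem sum_coeff_mul_star {w : V} (hw : ∃ e, Γ.src e = w) (g : E) :
    ∑ e with Γ.src e = w, q g e * star (q g e) = P (Γ.src g) w := by
  obtain ⟨R⟩ := VertexRep.nonempty Γ
  rw [← R.slice_ξ_vertexHom g fun v => P v w, hP, apply_p_src hq hw, map_sum]
  exact Finset.sum_congr rfl fun e _ => (R.slice_ξ_mul_star g fun f => q f e).symm

theorem vertexCoeff_eq_zero_of_sink {u w : V} (hu : ¬ ∃ e, Γ.src e = u)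
    (hw : ∃ e, Γ.src e = w) : P u w = 0 := by
  classical
  obtain ⟨R⟩ := VertexRep.nonempty Γ
  rw [← R.slice_ζ_vertexHom u fun v => P v w, hP, apply_p_src hq hw, map_sum]
  exact Finset.sum_eq_zero fun e _ => R.slice_ζ_mul_star hu _

theorem linTauRelations_of_tauSlice (R : VertexRep Γ)
    (hτ : ∀ x ∈ V2plus Γ, R.tauSlice (α x) = R.tau x • (1 : Q)) : LinTauRelations Γ q P where
  proj := isStarProjection_vertexCoeff hP
  row_sum := sum_vertexCoeff hP
  star_mul := sum_star_mul_coeff hP hq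
  mul_star _ := sum_coeff_mul_star hP hq
  sink _ _ := vertexCoeff_eq_zero_of_sink hP hq
  tau_edge e := by
    classical
    have hone := hτ (S Γ e * star (S Γ e)) (Submodule.subset_span (.inr ⟨e, e, rfl, rfl⟩))
    have hsink : ∀ u ∈ Finset.univ.filter fun u => ¬ ∃ e, Γ.src e = u, slice R.π (R.ζ u) (R.ζ u)
        ((∑ f, tmul (S Γ f) (q f e)) * star (∑ f, tmul (S Γ f) (q f e))) = 0 :=
      fun u hu => R.slice_ζ_mul_star (Finset.mem_filter.1 hu).2 _
    rw [R.tau_S_mul_star, if_pos rfl, one_smul, map_mul, map_star, hq] at hone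
    simpa only [VertexRep.tauSlice, add_apply, sum_apply, R.slice_ξ_mul_star,
      Finset.sum_eq_zero hsink, add_zero] using hone
  tau_sink u hu := by
    have hone := hτ (p Γ u) (Submodule.subset_span (.inl ⟨u, hu, rfl⟩))
    rw [R.tau_p hu, one_smul, ← hP] at hone
    simpa only [VertexRep.tauSlice, add_apply, sum_apply, R.slice_ξ_vertexHom,
      R.slice_ζ_vertexHom] using hone

end Relations

theorem IsLinTauObject.exists_unitary (hR : Γ.PropertyR)
    {U : QuantumTransformationGroup (GraphCStarAlgebra Γ)} (hU : IsLinTauObject Γ U) :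
    ∃ u : E → unitary U.cqg.carrier,
      ∀ e, U.action (S Γ e) = tmul (S Γ e) (u e : U.cqg.carrier) := by
  obtain ⟨⟨q, hq⟩, hτ⟩ := hU
  obtain ⟨R⟩ := VertexRep.nonempty Γ
  choose X hX using exists_vertexHom_eq_apply_p hR hq
  have hrel : LinTauRelations Γ q fun v w => X w v :=
    linTauRelations_of_tauSlice hX hq R fun x hx => R.tauSlice_action hτ hx
  refine ⟨fun e => ⟨q e e, hrel.coeff_mem_unitary hR e⟩, fun e => ?_⟩
  rw [hq, Finset.sum_eq_single e]
  · intro f _ hf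
    rw [hrel.coeff_eq_zero hR hf, tmul_zero]
  · simp

end VertexHom

/-! ### Generators of universal C*-algebras -/

theorem mem_of_dense_span {A : Type*} [AddCommMonoid A] [Module ℂ A] [TopologicalSpace A]
    {s : Set A} (hs : Dense (Submodule.span ℂ s : Set A)) {T : Submodule ℂ A}
    (hT : IsClosed (T : Set A)) (hsT : s ⊆ T) (a : A) : a ∈ T :=
  closure_minimal (Submodule.span_le.2 hsT) hT (hs a)

theorem mem_of_dense_adjoin {A : Type*} [Semiring A] [StarRing A] [Algebra ℂ A] [StarModule ℂ A]
    [TopologicalSpace A] {s : Set A} (hs : Dense (StarAlgebra.adjoin ℂ s : Set A))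
    {T : StarSubalgebra ℂ A} (hT : IsClosed (T : Set A)) (hsT : s ⊆ T) (a : A) : a ∈ T :=
  closure_minimal (StarAlgebra.adjoin_le hsT) hT (hs a)

theorem dense_span_of_dense_adjoin {A : Type*} [Semiring A] [StarRing A] [Algebra ℂ A]
    [StarModule ℂ A] [TopologicalSpace A] {s : Set A}
    (hs : Dense (StarAlgebra.adjoin ℂ s : Set A)) {M : Submonoid A}
    (hM : ∀ a ∈ M, star a ∈ M) (hsM : s ⊆ M) : Dense (Submodule.span ℂ (M : Set A) : Set A) := by
  refine hs.mono fun a ha => ?_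
  have hle : Submonoid.closure (s ∪ star s) ≤ M :=
    Submonoid.closure_le.2 <| Set.union_subset hsM fun b hb => star_star b ▸ hM _ (hsM hb)
  have ha' : a ∈ Algebra.adjoin ℂ (s ∪ star s) := ha
  rw [← Subalgebra.mem_toSubmodule, Algebra.adjoin_eq_span] at ha'
  exact Submodule.span_mono hle ha'

theorem starAlgHom_ext_of_dense_adjoin {A B : Type*} [CStarAlgebra A] [CStarAlgebra B] {s : Set A}
    (hs : Dense (StarAlgebra.adjoin ℂ s : Set A)) {φ ψ : A →⋆ₐ[ℂ] B}
    (h : ∀ a ∈ s, φ a = ψ a) : φ = ψ :=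
  StarAlgHom.ext <| mem_of_dense_adjoin hs (T := StarAlgHom.equalizer φ ψ)
    (isClosed_eq (continuous_starAlgHom φ) (continuous_starAlgHom ψ)) h

theorem FreeStarAlgebra.adjoin_range_gen (X : Type u) :
    StarAlgebra.adjoin ℂ (Set.range (gen : X → FreeStarAlgebra X)) = ⊤ := by
  have hgen : ∀ x : X, gen x ∈ StarAlgebra.adjoin ℂ (Set.range (gen : X → FreeStarAlgebra X)) :=
    fun x => StarAlgebra.subset_adjoin ℂ _ ⟨x, rfl⟩
  refine eq_top_iff.2 fun a _ => ?_
  induction a using induction_letters with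
  | scalar r => exact algebraMap_mem _ r
  | letters y =>
    cases y with
    | inl x => exact hgen x
    | inr x =>
      rw [← Sum.swap_inl, ← star_letter]
      exact star_mem (hgen x)
  | mul a b ha hb => exact mul_mem (ha trivial) (hb trivial)
  | add a b ha hb => exact add_mem (ha trivial) (hb trivial)

theorem UniversalCStarAlgebra.dense_adjoin_range_of {X : Type u} (R : Set (FreeStarAlgebra X)) :
    Dense (StarAlgebra.adjoin ℂ (Set.range (of R)) : Set (UniversalCStarAlgebra R)) := by
  refine (denseRange_mk R).mono ?_
  have hmap := StarAlgHom.map_adjoin (mk R) (Set.range FreeStarAlgebra.gen)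
  rw [FreeStarAlgebra.adjoin_range_gen, ← Set.range_comp] at hmap
  rintro _ ⟨t, rfl⟩
  exact hmap.le ⟨t, trivial, rfl⟩

theorem CircleFreeProduct.dense_adjoin_range_z (I : Type u) :
    Dense (StarAlgebra.adjoin ℂ (Set.range (z : I → CircleFreeProduct I)) :
      Set (CircleFreeProduct I)) :=
  UniversalCStarAlgebra.dense_adjoin_range_of _

theorem CircleFreeProduct.hom_ext {I : Type u} {B : Type*} [CStarAlgebra B]
    {φ ψ : CircleFreeProduct I →⋆ₐ[ℂ] B} (h : ∀ i, φ (z i) = ψ (z i)) : φ = ψ :=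
  starAlgHom_ext_of_dense_adjoin (dense_adjoin_range_z I) (Set.forall_mem_range.2 h)

namespace GraphCStarAlgebra

variable {V E : Type u} [Fintype V] [Fintype E]

theorem dense_adjoin_range_S_union_range_p (Γ : DirectedGraph V E) :
    Dense (StarAlgebra.adjoin ℂ (Set.range (S Γ) ∪ Set.range (p Γ)) :
      Set (GraphCStarAlgebra Γ)) := by
  have hof : Sum.elim (S Γ) (p Γ) = UniversalCStarAlgebra.of {r | GraphRelator Γ r} :=
    funext <| Sum.rec (fun _ => rfl) fun _ => rfl
  rw [← Set.Sum.elim_range, hof]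
  exact UniversalCStarAlgebra.dense_adjoin_range_of _

theorem hom_ext_S {Γ : DirectedGraph V E} (hR : Γ.PropertyR) {B : Type*} [CStarAlgebra B]
    {φ ψ : GraphCStarAlgebra Γ →⋆ₐ[ℂ] B} (hS : ∀ e, φ (S Γ e) = ψ (S Γ e)) : φ = ψ := by
  obtain ⟨_, hΓ⟩ := hR.exists_isPathOrder
  have hrng (e : E) : φ (p Γ (Γ.rng e)) = ψ (p Γ (Γ.rng e)) := by
    rw [← (isCuntzKriegerFamily Γ).star_mul_self, map_mul, map_mul, map_star, map_star, hS]
  have hp : ∀ v, φ (p Γ v) = ψ (p Γ v) := (isCuntzKriegerFamily Γ).p_mem hΓ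
    (A := AlgHom.equalizer φ.toAlgHom ψ.toAlgHom) hrng
  refine starAlgHom_ext_of_dense_adjoin (dense_adjoin_range_S_union_range_p Γ) ?_
  rintro _ (⟨e, rfl⟩ | ⟨v, rfl⟩)
  exacts [hS e, hp v]

end GraphCStarAlgebra

/-! ### Actions with homogeneous generators -/

section Homogeneous

open MinTensor

variable {A Q : Type u} [CStarAlgebra A] [CStarAlgebra Q]

/-- The elements which an action `α` multiplies by a unitary that is group-like for `Δ`. -/
def homogeneous (Δ : Q →⋆ₐ[ℂ] MinTensor Q Q) (α : A →⋆ₐ[ℂ] MinTensor A Q) : Submonoid A where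
  carrier := {a | ∃ x ∈ unitary Q, Δ x = tmul x x ∧ α a = tmul a x}
  one_mem' := ⟨1, one_mem _, by rw [map_one, one_eq], by rw [map_one, one_eq]⟩
  mul_mem' := by
    rintro a b ⟨x, hx, hΔx, hαa⟩ ⟨y, hy, hΔy, hαb⟩
    exact ⟨x * y, mul_mem hx hy, by rw [map_mul, hΔx, hΔy, tmul_mul_tmul],
      by rw [map_mul, hαa, hαb, tmul_mul_tmul]⟩

variable {Δ : Q →⋆ₐ[ℂ] MinTensor Q Q} {α : A →⋆ₐ[ℂ] MinTensor A Q}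

theorem star_mem_homogeneous {a : A} (ha : a ∈ homogeneous Δ α) : star a ∈ homogeneous Δ α := by
  obtain ⟨x, hx, hΔx, hαa⟩ := ha
  exact ⟨star x, Unitary.star_mem hx, by rw [map_star, hΔx, star_tmul],
    by rw [map_star, hαa, star_tmul]⟩

theorem assocEq_of_dense_span_homogeneous
    (h : Dense (Submodule.span ℂ (homogeneous Δ α : Set A) : Set A)) (a : A) :
    AssocEq (MinTensor.map α (StarAlgHom.id ℂ Q) (α a))
      (MinTensor.map (StarAlgHom.id ℂ A) Δ (α a)) := by
  let L := (MinTensor.map α (StarAlgHom.id ℂ Q)).comp α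
  let R := (MinTensor.map (StarAlgHom.id ℂ A) Δ).comp α
  refine mem_of_dense_span h (T := (associatorGraph A Q Q).comap
    (L.toAlgHom.toLinearMap.prod R.toAlgHom.toLinearMap))
    ((Submodule.isClosed_topologicalClosure _).preimage
      ((continuous_starAlgHom L).prodMk (continuous_starAlgHom R))) ?_ a
  rintro b ⟨x, -, hΔx, hαb⟩
  change AssocEq (MinTensor.map α (StarAlgHom.id ℂ Q) (α b))
    (MinTensor.map (StarAlgHom.id ℂ A) Δ (α b))
  rw [hαb, map_tmul, map_tmul, hαb, hΔx]
  exact Submodule.le_topologicalClosure _ (Submodule.subset_span ⟨(b, x, x), rfl⟩)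

theorem dense_span_mul_one_tmul (h : Dense (Submodule.span ℂ (homogeneous Δ α : Set A) : Set A)) :
    Dense (Submodule.span ℂ {y | ∃ a b, y = α a * tmul 1 b} : Set (MinTensor A Q)) := by
  refine dense_of_tmul_mem _ fun a b => ?_
  set M := Submodule.span ℂ {y | ∃ a b, y = α a * tmul 1 b}
  let f : A →L[ℂ] MinTensor A Q := tmulCLM.flip b
  refine mem_of_dense_span h (T := M.topologicalClosure.comap f.toLinearMap)
    (M.isClosed_topologicalClosure.preimage f.continuous) ?_ a
  rintro c ⟨x, hx, -, hαc⟩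
  have hcb : tmul c b = α c * tmul 1 (star x * b) := by
    rw [hαc, tmul_mul_tmul, mul_one, ← mul_assoc, Unitary.mul_star_self_of_mem hx, one_mul]
  change tmul c b ∈ M.topologicalClosure
  exact M.le_topologicalClosure (Submodule.subset_span ⟨c, star x * b, hcb⟩)

end Homogeneous

/-! ### The diagonal action of the free product of circles -/

section Diagonal

open MinTensor GraphCStarAlgebra CircleFreeProduct

theorem z_mem_unitary {I : Type u} (i : I) : z i ∈ unitary (CircleFreeProduct I) :=
  ⟨star_z_mul_z i, z_mul_star_z i⟩

variable {V E : Type u} [Fintype V] [Fintype E] {Γ : DirectedGraph V E}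

theorem IsCuntzKriegerFamily.tmul_unitary {A Q : Type u} [CStarAlgebra A] [CStarAlgebra Q]
    {S : E → A} {p : V → A} (h : IsCuntzKriegerFamily Γ S p) (u : E → unitary Q) :
    IsCuntzKriegerFamily Γ (fun e => tmul (S e) (u e : Q)) fun v => tmul (p v) (1 : Q) where
  partial_isometry e := by
    rw [star_tmul, tmul_mul_tmul, tmul_mul_tmul, h.partial_isometry,
      Unitary.mul_star_self_of_mem (u e).2, one_mul]
  idempotent v := by rw [tmul_mul_tmul, h.idempotent, one_mul]
  self_adjoint v := by rw [star_tmul, h.self_adjoint, star_one]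
  orthogonal v w hvw := by rw [tmul_mul_tmul, h.orthogonal v w hvw, zero_tmul]
  sum_eq_one := by rw [← sum_tmul, h.sum_eq_one, one_eq]
  star_mul_self e := by
    rw [star_tmul, tmul_mul_tmul, h.star_mul_self, Unitary.star_mul_self_of_mem (u e).2]
  sum_mul_star v hv := by
    rw [h.sum_mul_star v hv, sum_tmul]
    exact Finset.sum_congr rfl fun e _ => by
      rw [star_tmul, tmul_mul_tmul, Unitary.mul_star_self_of_mem (u e).2]

variable (Γ) in
/-- The diagonal action `S_e ↦ S_e ⊗ z_e`, `p_v ↦ p_v ⊗ 1` on `C*(Γ)`. -/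
def diagonalAction : GraphCStarAlgebra Γ →⋆ₐ[ℂ]
    MinTensor (GraphCStarAlgebra Γ) (CircleFreeProduct E) :=
  GraphCStarAlgebra.lift <| (isCuntzKriegerFamily Γ).tmul_unitary fun e => ⟨z e, z_mem_unitary e⟩

theorem diagonalAction_S (e : E) : diagonalAction Γ (S Γ e) = tmul (S Γ e) (z e) :=
  lift_S _ _ e

theorem diagonalAction_p (v : V) : diagonalAction Γ (p Γ v) = tmul (p Γ v) 1 :=
  lift_p _ _ v

theorem dense_span_homogeneous_diagonalAction :
    Dense (Submodule.span ℂ (homogeneous comul (diagonalAction Γ) : Set (GraphCStarAlgebra Γ)) :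
      Set (GraphCStarAlgebra Γ)) := by
  refine dense_span_of_dense_adjoin (dense_adjoin_range_S_union_range_p Γ)
    (fun _ => star_mem_homogeneous) ?_
  rintro _ (⟨e, rfl⟩ | ⟨v, rfl⟩)
  · exact ⟨z e, z_mem_unitary e, comul_z e, diagonalAction_S e⟩
  · exact ⟨1, one_mem _, by rw [map_one, one_eq], diagonalAction_p v⟩

theorem dense_adjoin_coefficients_diagonalAction : Dense (StarAlgebra.adjoin ℂ
    {q | ∃ (θ : GraphCStarAlgebra Γ →L[ℂ] ℂ)
      (R : MinTensor (GraphCStarAlgebra Γ) (CircleFreeProduct E) →L[ℂ] CircleFreeProduct E),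
      IsSliceMap θ R ∧ ∃ c, q = R (diagonalAction Γ c)} : Set (CircleFreeProduct E)) := by
  classical
  obtain ⟨R⟩ := VertexRep.nonempty Γ
  refine (dense_adjoin_range_z E).mono (StarAlgebra.adjoin_mono ?_)
  rintro _ ⟨e, rfl⟩
  refine ⟨_, _, isSliceMap_slice R.π (R.ξ e) (R.ζ (Γ.rng e)), S Γ e, ?_⟩
  rw [diagonalAction_S, slice_tmul, R.inner_ξ_S, if_pos rfl, one_smul]

variable (Γ) in
/-- The free product of circles with its diagonal action on `C*(Γ)`. -/
def diagonalQTG : QuantumTransformationGroup (GraphCStarAlgebra Γ) where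
  cqg := circleFreeProductCQG E
  action := diagonalAction Γ
  coaction := assocEq_of_dense_span_homogeneous dense_span_homogeneous_diagonalAction
  dense_span := dense_span_mul_one_tmul dense_span_homogeneous_diagonalAction
  faithful := dense_adjoin_coefficients_diagonalAction

theorem isLinearAction_diagonalQTG : IsLinearAction (diagonalQTG Γ) := by
  classical
  let q (f e : E) : CircleFreeProduct E := if f = e then z e else 0
  have hq (e : E) : diagonalAction Γ (S Γ e) = ∑ f, tmul (S Γ f) (q f e) := by
    rw [diagonalAction_S, Finset.sum_eq_single e]
    · simp only [q, if_true]
    · intro f _ hf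
      simp only [q, if_neg hf, tmul_zero]
    · simp
  exact ⟨q, hq⟩

theorem preservesTau_diagonalQTG : PreservesTau (diagonalQTG Γ) := by
  classical
  obtain ⟨R⟩ := VertexRep.nonempty Γ
  let τ := R.tau.toLinearMap ∘ₗ (V2plus Γ).subtype
  let Φ : V2plus Γ ⊗[ℂ] CircleFreeProduct E →ₗ[ℂ] _ × CircleFreeProduct E :=
    ((ofAlgebraic _ _).toAlgHom.toLinearMap ∘ₗ
        TensorProduct.map (V2plus Γ).subtype LinearMap.id).prod
      ((TensorProduct.lid ℂ _).toLinearMap ∘ₗ TensorProduct.map τ LinearMap.id)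
  let Ψ : GraphCStarAlgebra Γ →ₗ[ℂ] _ × CircleFreeProduct E :=
    (diagonalAction Γ).toAlgHom.toLinearMap.prod (R.tau.toLinearMap.smulRight 1)
  have hmem (a : V2plus Γ) (x : CircleFreeProduct E)
      (haction : diagonalAction Γ a = tmul (a : GraphCStarAlgebra Γ) x)
      (htau : R.tau a • x = R.tau a • (1 : CircleFreeProduct E)) :
      (a : GraphCStarAlgebra Γ) ∈ (LinearMap.range Φ).comap Ψ :=
    ⟨a ⊗ₜ x, Prod.ext haction.symm htau⟩
  have hle : V2plus Γ ≤ (LinearMap.range Φ).comap Ψ := by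
    refine Submodule.span_le.2 ?_
    rintro a (⟨u, hu, rfl⟩ | ⟨e, f, hef, rfl⟩)
    · exact hmem ⟨_, Submodule.subset_span (.inl ⟨u, hu, rfl⟩)⟩ 1 (diagonalAction_p u) rfl
    · refine hmem ⟨_, Submodule.subset_span (.inr ⟨e, f, hef, rfl⟩)⟩ (z e * star (z f)) ?_ ?_
      · rw [map_mul, map_star, diagonalAction_S, diagonalAction_S, star_tmul, tmul_mul_tmul]
      · rw [R.tau_S_mul_star]
        split_ifs with h
        · rw [h, z_mul_star_z]
        · rw [zero_smul, zero_smul]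
  refine ⟨τ, R.isTau_tau, fun x => ?_⟩
  obtain ⟨t, ht⟩ := hle x.2
  exact ⟨t, congrArg Prod.fst ht, congrArg Prod.snd ht⟩

theorem isLinTauObject_diagonalQTG : IsLinTauObject Γ (diagonalQTG Γ) :=
  ⟨isLinearAction_diagonalQTG, preservesTau_diagonalQTG⟩

end Diagonal

/-! ### The universal object -/

section Universal

open MinTensor GraphCStarAlgebra CircleFreeProduct

section Slices

variable {A B C Q : Type u} [CStarAlgebra A] [CStarAlgebra B] [CStarAlgebra C] [CStarAlgebra Q]

theorem MinTensor.mem_of_tmul_mem {T : Submodule ℂ (MinTensor A B)}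
    (hT : IsClosed (T : Set (MinTensor A B))) (h : ∀ a b, tmul a b ∈ T) (x : MinTensor A B) :
    x ∈ T :=
  closure_minimal subset_rfl hT <|
    dense_of_tmul_mem T (fun a b => T.le_topologicalClosure (h a b)) x

theorem MinTensor.map_id_map_id (φ : B →⋆ₐ[ℂ] C) (ψ : C →⋆ₐ[ℂ] Q) (x : MinTensor A B) :
    MinTensor.map (StarAlgHom.id ℂ A) ψ (MinTensor.map (StarAlgHom.id ℂ A) φ x) =
      MinTensor.map (StarAlgHom.id ℂ A) (ψ.comp φ) x := by
  let F := (MinTensor.map (StarAlgHom.id ℂ A) ψ).comp (MinTensor.map (StarAlgHom.id ℂ A) φ)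
  let G := MinTensor.map (StarAlgHom.id ℂ A) (ψ.comp φ)
  refine mem_of_tmul_mem (T := LinearMap.eqLocus F.toAlgHom.toLinearMap G.toAlgHom.toLinearMap)
    (isClosed_eq (continuous_starAlgHom F) (continuous_starAlgHom G)) (fun a b => ?_) x
  change MinTensor.map (StarAlgHom.id ℂ A) ψ (MinTensor.map (StarAlgHom.id ℂ A) φ (tmul a b)) =
    MinTensor.map (StarAlgHom.id ℂ A) (ψ.comp φ) (tmul a b)
  simp only [map_tmul]
  rfl

theorem IsSliceMap.apply_map {θ : A →L[ℂ] ℂ} {R : MinTensor A B →L[ℂ] B}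
    {R' : MinTensor A Q →L[ℂ] Q} (hR : IsSliceMap θ R) (hR' : IsSliceMap θ R')
    (φ : B →⋆ₐ[ℂ] Q) (x : MinTensor A B) :
    R' (MinTensor.map (StarAlgHom.id ℂ A) φ x) = φ (R x) := by
  let F := MinTensor.map (StarAlgHom.id ℂ A) φ
  refine mem_of_tmul_mem (T := LinearMap.eqLocus (R'.toLinearMap ∘ₗ F.toAlgHom.toLinearMap)
    (φ.toAlgHom.toLinearMap ∘ₗ R.toLinearMap))
    (isClosed_eq (R'.continuous.comp (continuous_starAlgHom F))
      ((continuous_starAlgHom φ).comp R.continuous)) (fun a b => ?_) x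
  change R' (MinTensor.map (StarAlgHom.id ℂ A) φ (tmul a b)) = φ (R (tmul a b))
  rw [map_tmul, hR', hR, map_smul]
  rfl

theorem IsSliceMap.apply_map_mem_range {θ : A →L[ℂ] ℂ} {R : MinTensor A Q →L[ℂ] Q}
    (hR : IsSliceMap θ R) (φ : B →⋆ₐ[ℂ] Q) (x : MinTensor A B) :
    R (MinTensor.map (StarAlgHom.id ℂ A) φ x) ∈ φ.range := by
  let F := MinTensor.map (StarAlgHom.id ℂ A) φ
  refine mem_of_tmul_mem (T := φ.range.toSubmodule.comap
    (R.toLinearMap ∘ₗ F.toAlgHom.toLinearMap))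
    ((isClosed_range_starAlgHom φ).preimage (R.continuous.comp (continuous_starAlgHom F)))
    (fun a b => ⟨θ a • b, ?_⟩) x
  change φ (θ a • b) = R (MinTensor.map (StarAlgHom.id ℂ A) φ (tmul a b))
  rw [map_tmul, hR, map_smul]
  rfl

end Slices

section General

variable {C : Type u} [CStarAlgebra C] {U W : QuantumTransformationGroup C}

theorem surjective_of_map_action {Q : Type u} [CStarAlgebra Q] {α : C →⋆ₐ[ℂ] MinTensor C Q}
    {φ : Q →⋆ₐ[ℂ] U.cqg.carrier}
    (h : ∀ c, MinTensor.map (StarAlgHom.id ℂ C) φ (α c) = U.action c) :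
    Function.Surjective φ := by
  refine mem_of_dense_adjoin U.faithful (T := φ.range) (isClosed_range_starAlgHom φ) ?_
  rintro _ ⟨θ, R, hR, c, rfl⟩
  rw [← h]
  exact hR.apply_map_mem_range φ _

theorem eq_id_of_map_action {χ : U.cqg.carrier →⋆ₐ[ℂ] U.cqg.carrier}
    (h : ∀ c, MinTensor.map (StarAlgHom.id ℂ C) χ (U.action c) = U.action c) :
    χ = StarAlgHom.id ℂ _ := by
  refine starAlgHom_ext_of_dense_adjoin U.faithful ?_
  rintro _ ⟨θ, R, hR, c, rfl⟩
  rw [← hR.apply_map hR, h]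
  rfl

theorem IsUniversalObject.isomorphicCQG {P : QuantumTransformationGroup C → Prop}
    (hU : IsUniversalObject P U) (hW : IsUniversalObject P W) : IsomorphicCQG U.cqg W.cqg := by
  obtain ⟨φ, hφ, hφ_surj, hφ_action⟩ := hU.2 W hW.1
  obtain ⟨ψ, -, -, hψ_action⟩ := hW.2 U hU.1
  have hid : ψ.comp φ = StarAlgHom.id ℂ _ := eq_id_of_map_action fun c => by
    rw [← MinTensor.map_id_map_id, hφ_action, hψ_action]
  exact ⟨φ, hφ, Function.LeftInverse.injective (g := ψ) (DFunLike.congr_fun hid), hφ_surj⟩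

end General

variable {V E : Type u} [Fintype V] [Fintype E] {Γ : DirectedGraph V E}

theorem comul_eq_tmul_of_action {U : QuantumTransformationGroup (GraphCStarAlgebra Γ)} {e : E}
    {x : U.cqg.carrier} (h : U.action (S Γ e) = tmul (S Γ e) x) : U.cqg.comul x = tmul x x := by
  have hcoaction := U.coaction (S Γ e)
  rw [h, map_tmul, map_tmul, h] at hcoaction
  exact eq_tmul_of_assocEq hcoaction (S_ne_zero e)

theorem IsLinTauObject.exists_morphism (hR : Γ.PropertyR)
    {U : QuantumTransformationGroup (GraphCStarAlgebra Γ)} (hU : IsLinTauObject Γ U) :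
    ∃ φ : CircleFreeProduct E →⋆ₐ[ℂ] U.cqg.carrier,
      IsCQGMorphism (circleFreeProductCQG E) U.cqg φ ∧ Function.Surjective φ ∧
      ∀ c, MinTensor.map (StarAlgHom.id ℂ _) φ (diagonalAction Γ c) = U.action c := by
  obtain ⟨u, hu⟩ := hU.exists_unitary hR
  let φ : CircleFreeProduct E →⋆ₐ[ℂ] U.cqg.carrier :=
    CircleFreeProduct.lift (fun e => u e) (fun e => Unitary.coe_star_mul_self (u e)) fun e =>
      Unitary.coe_mul_star_self (u e)
  have hz (e : E) : φ (z e) = u e := lift_z _ _ _ e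
  have haction : (MinTensor.map (StarAlgHom.id ℂ _) φ).comp (diagonalAction Γ) = U.action :=
    hom_ext_S hR fun e => by
      rw [StarAlgHom.comp_apply, diagonalAction_S, map_tmul, hz, hu]
      rfl
  have hcomul : (MinTensor.map φ φ).comp comul = U.cqg.comul.comp φ :=
    CircleFreeProduct.hom_ext fun e => by
      rw [StarAlgHom.comp_apply, StarAlgHom.comp_apply, comul_z, map_tmul, hz,
        comul_eq_tmul_of_action (hu e)]
  exact ⟨φ, DFunLike.congr_fun hcomul,
    surjective_of_map_action (α := diagonalAction Γ) (DFunLike.congr_fun haction),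
    DFunLike.congr_fun haction⟩

theorem isUniversalObject_diagonalQTG (hR : Γ.PropertyR) :
    IsUniversalObject (IsLinTauObject Γ) (diagonalQTG Γ) :=
  ⟨isLinTauObject_diagonalQTG, fun _ hW => hW.exists_morphism hR⟩

end Universal

end

theorem theorem4p1 {V E : Type u} [Fintype V] [Fintype E] (Γ : DirectedGraph V E)
    (hconn : Γ.IsConnected) (hR : Γ.PropertyR) :
    (∃ U : QuantumTransformationGroup (GraphCStarAlgebra Γ),
      IsUniversalObject (IsLinTauObject Γ) U) ∧
    ∀ U : QuantumTransformationGroup (GraphCStarAlgebra Γ),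
      IsUniversalObject (IsLinTauObject Γ) U →
        IsomorphicCQG U.cqg (circleFreeProductCQG E) :=
  have h := isUniversalObject_diagonalQTG hR
  ⟨⟨diagonalQTG Γ, h⟩, fun _ hU => hU.isomorphicCQG h⟩
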